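/- **Setting.** An $m$-player general-sum episodic Markov game has horizon $H$, a finite state space of size $S$, finite action sets of sizes $A_1,\dots,A_m$ (put $A=\max_j A_j$), transition kernels $\mathbb P_h(\cdot\mid s,\boldsymbol a)$, rewards $r_{j,h}(s,\boldsymbol a)\in[0,1]$ and a fixed initial state $s_1$ (all of $m,H,S,A_j,K$ are $\ge 1$). A policy of player $j$ maps a random sample $\omega$, drawn once per episode, and the past states and joint actions together with the current state, to an action. In a joint policy $\pi=\pi_1\odot\dots\odot\pi_m$ all players use the same $\omega$; $V^{\pi}_{j,1}(s_1)$ is the expected total reward of player $j$, and $V_{j,1}^{\dagger,\pi_{-j}}(s_1)$ is the supremum of her value over all her policies that use randomness independent of $\omega$, the others playing $\pi_{-j}$. **Weights.** $\alpha_t=\frac{H+1}{H+t}$, $\alpha_t^0=\prod_{l=1}^t(1-\alpha_l)$, $\alpha_t^i=\alpha_i\prod_{l=i+1}^t(1-\alpha_l)$ for $1\le i\le t$. **Bandit subroutine.** For every $B\ge1$ a subroutine maps the history of played actions and observed losses to the next strategy $\theta\in\Delta_{B}$; the first strategy is uniform. In round $i$ an adaptive adversary chooses $\ell_i\in[0,1]^B$,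 the learner draws $b_i\sim\theta_i$ and observes a loss in $[0,1]$ whose conditional mean, given the past and $b_i$, is $\ell_i(b_i)$. *Weighted external regret assumption:* there are functions $\xi,\Xi$ such that for all $B,t\ge 1$ and $\delta\in(0,1)$, against every such adversary, with probability at least $1-\delta$, $$\max_{\theta\in\Delta_B}\sum_{i=1}^t\alpha_t^i\,[\langle\theta_i,\ell_i\rangle-\langle\theta,\ell_i\rangle]\le\xi(B,t,\log(1/\delta));$$ moreover $\Xi(B,t,x)\ge\sum_{t'=1}^t\xi(B,t',x)$ for all $t\in\mathbb N=\{0,1,\dots\}$ and $x>0$, $\xi$ is non-decreasing in $B$, and $\Xi(B,t,x)$ is concave in the real variable $t\ge 0$. **V-learning.** With bonuses $\beta_{j,t}$, each player $j$ initializes $\tilde V_h(s)=V_h(s)=H+1-h$ and $N_h(s)=0$ for $1\le h\le H+1$, runs one copy of the subroutine for each $(s,h)$, which supplies $\pi_h(\cdot\mid s)$, and in each of $K$ episodes, for $h=1,\dots,H$: plays $a_h\sim\pi_h(\cdot\mid s_h)$ (independently of the other players), observes $r_h$ and $s_{h+1}$, sets $t=N_h(s_h)\leftarrow N_h(s_h)+1$,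 $\tilde V_h(s_h)\leftarrow(1-\alpha_t)\tilde V_h(s_h)+\alpha_t(r_h+V_{h+1}(s_{h+1})+\beta_{j,t})$, $V_h(s_h)\leftarrow\min\{H+1-h,\tilde V_h(s_h)\}$, and feeds the action $a_h$ and the loss $(H-r_h-V_{h+1}(s_{h+1}))/H$ to the $(s_h,h)$-th copy. Let $N^k_{j,h}$, $\pi^k_{j,h}$ be the counter and the policy at the beginning of episode $k$, and $k_h^i(s)$ the index of the episode in which $s$ is visited at step $h$ for the $i$-th time. **Output policy** $\hat\pi_j$: draw $k$ uniformly from $\{1,\dots,K\}$; at each step $h$, with $t=N_{j,h}^k(s_h)$, replace $k$ by $k_h^i(s_h)$, where $i\in\{1,\dots,t\}$ has probability $\alpha_t^i$ (if $t=0$, keep $k$); then play $a_{j,h}\sim\pi_{j,h}^k(\cdot\mid s_h)$. In $\hat\pi=\hat\pi_1\odot\dots\odot\hat\pi_m$ all players share the initial $k$ and the sampled indices $i$, and, given these and the states, draw their actions independently. **FTRL.** With parameters $w_t,\eta_t,\gamma_t$: $\theta_1$ is uniform, $\hat l_t(b)=\tilde l_t(b_t)\mathbb 1\{b_t=b\}/(\theta_t(b)+\gamma_t)$,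 where $\tilde l_t(b_t)$ is the observed loss, and $\theta_{t+1}(b)\propto\exp[-(\eta_t/w_t)\sum_{i\le t}w_i\hat l_i(b)]$. **Theorem.** (1) There is an absolute constant $c_0>0$ such that for every $c_1$ there is a constant $C>0$, depending only on $c_1$, with the following property. Take any game as above, any subroutine satisfying the weighted external regret assumption with $\xi,\Xi$, any $K\ge1$ and $\delta\in(0,1)$, put $\iota=\log(mHSAK/\delta)$, and let the bonuses satisfy, for all $j\le m$ and $1\le t\le K$, $$c_0\big(H\xi(A_j,t,\iota)+\sqrt{H^3\iota/t}\big)\le\sum_{i=1}^t\alpha_t^i\beta_{j,i}\le c_1\big(H\xi(A_j,t,\iota)+\sqrt{H^3\iota/t}\big).$$ Then, with probability at least $1-\delta$ over $K$ episodes in which all players run V-learning, $$\max_{j\le m}\big[V_{j,1}^{\dagger,\hat\pi_{-j}}(s_1)-V_{j,1}^{\hat\pi}(s_1)\big]\le C\Big(\frac{H^2S}{K}\,\Xi(A,K/S,\iota)+\sqrt{H^5S\iota/K}\Big).$$ (2) There are absolute constants $c,C>0$ such that, for every game, $K\ge 1$ and $\delta\in(0,1)$, if player $j$ uses FTRL with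 $w_t=\alpha_t\big(\prod_{i=2}^t(1-\alpha_i)\big)^{-1}$ and $\eta_t=\gamma_t=\sqrt{H\iota/(A_jt)}$ as the subroutine, and bonuses $\beta_{j,t}=c\sqrt{H^3A_j\iota/t}$, then with probability at least $1-\delta$ $$\max_{j\le m}\big[V_{j,1}^{\dagger,\hat\pi_{-j}}(s_1)-V_{j,1}^{\hat\pi}(s_1)\big]\le C\sqrt{H^5SA\iota/K}.$$ -/

import Mathlib

open scoped BigOperators

noncomputable section

namespace VLearning

/-! ### Finite products of probability mass functions -/

/-- Independent sampling of finitely many coordinates. -/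
def pmfPi {ι : Type} [Fintype ι] [DecidableEq ι] {α : ι → Type} [∀ i, Fintype (α i)]
    (p : ∀ i, PMF (α i)) : PMF (∀ i, α i) :=
  PMF.ofFintype (fun f => ∏ i, p i (f i)) (by
    have h1 : ∀ i, ∑ a, p i a = 1 := fun i => by
      rw [← tsum_fintype (L := .unconditional _)]; exact (p i).tsum_coe
    have h2 := Finset.prod_univ_sum (fun i => (Finset.univ : Finset (α i))) (fun i a => p i a)
    rw [Fintype.piFinset_univ] at h2
    rw [← h2]
    simp [h1])

/-! ### Markov games, policies, values

Steps of an episode are numbered `h = 0, …, H - 1`; the data of a game at indices `h ≥ H` is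
never used. -/

/-- Joint actions; player `j` has the action set `Fin (A j)`. -/
abbrev JointAction {m : ℕ} (A : Fin m → ℕ) : Type := ∀ j, Fin (A j)

/-- A tabular episodic general-sum Markov game with `m` players, `S` states and fixed initial
state. -/
structure MarkovGame (m S : ℕ) (A : Fin m → ℕ) where
  /-- transition kernel `ℙ_h(· | s, a)` -/
  trans : ℕ → Fin S → JointAction A → PMF (Fin S)
  /-- reward `r_{j,h}(s, a)` -/
  reward : Fin m → ℕ → Fin S → JointAction A → ℝ
  reward_mem : ∀ j h s a, reward j h s a ∈ Set.Icc (0 : ℝ) 1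
  /-- the initial state -/
  s₁ : Fin S

/-- The past `(s_1, a_1), …, (s_{h-1}, a_{h-1})` of an episode, most recent entry first. -/
abbrev History (S : ℕ) {m : ℕ} (A : Fin m → ℕ) : Type := List (Fin S × JointAction A)

/-- A deterministic history-dependent policy of player `j`: maps the past and the current state to
an action. The step is the length of the past. -/
abbrev DetPolicy (S : ℕ) {m : ℕ} (A : Fin m → ℕ) (j : Fin m) : Type :=
  History S A → Fin S → Fin (A j)

section Values

variable {m S : ℕ} {A : Fin m → ℕ}

/-- Expected reward of player `j` collected in the `n` remaining steps, when the past is `τ`, the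
current state is `s` and everybody follows the deterministic policies `σ`. -/
def MarkovGame.valueToGo (G : MarkovGame m S A) (σ : ∀ j, DetPolicy S A j) (j : Fin m) :
    ℕ → History S A → Fin S → ℝ
  | 0, _, _ => 0
  | n + 1, τ, s =>
      G.reward j τ.length s (fun i => σ i τ s) +
        ∑ s' : Fin S, (G.trans τ.length s (fun i => σ i τ s) s').toReal *
          G.valueToGo σ j n ((s, fun i => σ i τ s) :: τ) s'

/-- Value `V^π_{j,1}(s_1)` over `H` steps of the joint (correlated) policy in which player `i`
plays `π i ω`, with one random sample `ω ∼ P` shared by all players and all steps. -/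
def MarkovGame.value (G : MarkovGame m S A) (H : ℕ) {Ω : Type} [MeasurableSpace Ω]
    (P : MeasureTheory.Measure Ω) (π : ∀ i, Ω → DetPolicy S A i) (j : Fin m) : ℝ :=
  ∫ ω, G.valueToGo (fun i => π i ω) j H [] G.s₁ ∂P

/-- Best-response value `V^{†,π_{-j}}_{j,1}(s_1)`: supremum of the values of player `j` over all
her random policies `π'` (on any probability space) that are independent of the sample `ω` used
by the other players, who keep playing `π`. -/
def MarkovGame.bestResponseValue (G : MarkovGame m S A) (H : ℕ) {Ω : Type} [MeasurableSpace Ω]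
    (P : MeasureTheory.Measure Ω) (π : ∀ i, Ω → DetPolicy S A i) (j : Fin m) : ℝ :=
  sSup {v : ℝ | ∃ (Ω' : Type) (_ : MeasurableSpace Ω') (P' : MeasureTheory.Measure Ω')
    (_ : MeasureTheory.IsProbabilityMeasure P') (π' : Ω' → DetPolicy S A j),
    (∀ τ s, Measurable fun ω' => π' ω' τ s) ∧
    v = G.value H (P.prod P')
      (fun i (ω : Ω × Ω') => Function.update (fun i => π i ω.1) j (π' ω.2) i) j}

/-- The joint policy `(P, π)` is an `ε`-approximate coarse correlated equilibrium. -/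
def MarkovGame.IsApproxCCE (G : MarkovGame m S A) (H : ℕ) {Ω : Type} [MeasurableSpace Ω]
    (P : MeasureTheory.Measure Ω) (π : ∀ i, Ω → DetPolicy S A i) (ε : ℝ) : Prop :=
  ∀ j, G.bestResponseValue H P π j - G.value H P π j ≤ ε

end Values

/-! ### Learning rate and its weights -/

/-- `α_t = (H + 1) / (H + t)`. -/
def alpha (H t : ℕ) : ℝ := ((H : ℝ) + 1) / ((H : ℝ) + t)

/-- `α_t^0 = ∏_{j=1}^t (1 - α_j)` and `α_t^i = α_i ∏_{j=i+1}^t (1 - α_j)` for `i ≥ 1`. -/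
def alphaW (H t i : ℕ) : ℝ :=
  (if i = 0 then 1 else alpha H i) * ∏ j ∈ Finset.Ioc i t, (1 - alpha H j)

theorem alpha_nonneg (H t : ℕ) : 0 ≤ alpha H t := by unfold alpha; positivity

theorem alpha_le_one (H t : ℕ) (ht : 1 ≤ t) : alpha H t ≤ 1 := by
  unfold alpha
  have h : (1 : ℝ) ≤ t := by exact_mod_cast ht
  have h0 : (0 : ℝ) ≤ H := Nat.cast_nonneg H
  rw [div_le_one (by linarith)]
  linarith

theorem alphaW_nonneg (H t i : ℕ) : 0 ≤ alphaW H t i := by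
  unfold alphaW
  refine mul_nonneg ?_ (Finset.prod_nonneg fun j hj => ?_)
  · split_ifs
    · exact zero_le_one
    · exact alpha_nonneg H i
  · have := alpha_le_one H j (by have := (Finset.mem_Ioc.1 hj).1; omega)
    linarith

theorem sum_alphaW (H t : ℕ) : ∑ i ∈ Finset.range (t + 1), alphaW H t i = 1 := by
  induction t with
  | zero => simp [alphaW]
  | succ t ih =>
    rw [Finset.sum_range_succ]
    have h1 : ∀ i ∈ Finset.range (t + 1),
        alphaW H (t + 1) i = alphaW H t i * (1 - alpha H (t + 1)) := by
      intro i hi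
      have hi' : i ≤ t := by have := Finset.mem_range.1 hi; omega
      unfold alphaW
      rw [← Finset.insert_Ioc_right_eq_Ioc_add_one hi', Finset.prod_insert (by simp)]
      ring
    rw [Finset.sum_congr rfl h1, ← Finset.sum_mul, ih]
    simp [alphaW]

/-- The law on `{0, …, t}` with weights `α_t^i`. For `t ≥ 1` we have `α_t^0 = 0`, so it lives on
`{1, …, t}`; for `t = 0` it is the point mass at `0`. -/
def indexLaw (H t : ℕ) : PMF (Fin (t + 1)) :=
  PMF.ofFintype (fun i => ENNReal.ofReal (alphaW H t i)) (by
    rw [← ENNReal.ofReal_sum_of_nonneg (fun (i : Fin (t + 1)) _ => alphaW_nonneg H t i),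
      Fin.sum_univ_eq_sum_range (fun i => alphaW H t i) (t + 1), sum_alphaW, ENNReal.ofReal_one])

/-! ### Adversarial bandits -/

/-- An adversarial bandit subroutine on `B` actions: maps the history of the played actions and
observed losses (most recent round first) to the next strategy. -/
abbrev BanditAlg (B : ℕ) : Type := List (Fin B × ℝ) → PMF (Fin B)

/-- The strategy in use after a given history; the first strategy is uniform. -/
def BanditAlg.strategy {B : ℕ} [NeZero B] (alg : BanditAlg B) (τ : List (Fin B × ℝ)) :
    PMF (Fin B) :=
  if τ = [] then PMF.uniformOfFintype (Fin B) else alg τ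

/-- An adaptive adversary with noisy bandit feedback. Its hidden state `x` determines the loss
vector of the round; after the action `b` it draws the observed loss, of conditional mean
`loss x b`, and the next hidden state, which may record the whole past. -/
structure BanditEnv (B : ℕ) where
  X : Type
  init : PMF X
  loss : X → Fin B → ℝ
  respond : X → Fin B → PMF (ℝ × X)
  loss_mem : ∀ x b, loss x b ∈ Set.Icc (0 : ℝ) 1
  feedback_mem : ∀ x b, ∀ y ∈ (respond x b).support, y.1 ∈ Set.Icc (0 : ℝ) 1
  feedback_mean : ∀ x b, ∑' y : ℝ × X, (respond x b y).toReal * y.1 = loss x b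

/-- State of the bandit protocol after some rounds: hidden state of the adversary, history of the
learner, and the strategies `θ_i` and loss vectors `ℓ_i` of the rounds `i = 1, 2, …` so far. -/
structure BanditRun (B : ℕ) (X : Type) where
  env : X
  hist : List (Fin B × ℝ)
  θ : ℕ → Fin B → ℝ
  ℓ : ℕ → Fin B → ℝ

/-- Law of the protocol after `t` rounds. -/
def banditLaw {B : ℕ} [NeZero B] (alg : BanditAlg B) (E : BanditEnv B) :
    ℕ → PMF (BanditRun B E.X)
  | 0 => E.init.map fun x => ⟨x, [], fun _ _ => 0, fun _ _ => 0⟩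
  | t + 1 => (banditLaw alg E t).bind fun ρ =>
      (alg.strategy ρ.hist).bind fun b =>
        (E.respond ρ.env b).map fun y =>
          { env := y.2
            hist := (b, y.1) :: ρ.hist
            θ := Function.update ρ.θ (t + 1) fun b' => (alg.strategy ρ.hist b').toReal
            ℓ := Function.update ρ.ℓ (t + 1) (E.loss ρ.env) }

/-- `∑_{i=1}^t α_t^i [⟨θ_i, ℓ_i⟩ - ⟨θ, ℓ_i⟩]`. -/
def weightedRegret (H t : ℕ) {B : ℕ} {X : Type} (ρ : BanditRun B X) (θ : Fin B → ℝ) : ℝ :=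
  ∑ i ∈ Finset.Icc 1 t, alphaW H t i *
    ((∑ b, ρ.θ i b * ρ.ℓ i b) - ∑ b, θ b * ρ.ℓ i b)

/-- High-probability weighted external regret guarantee `ξ` of a subroutine (given for every number
`B` of actions), with the upper bound `Ξ` on its partial sums. The last argument of `ξ` and `Ξ`
stands for `log (1/δ)`. -/
structure WeightedExternalRegret (H : ℕ) (alg : (B : ℕ) → [NeZero B] → BanditAlg B)
    (ξ : ℕ → ℕ → ℝ → ℝ) (Ξ : ℕ → ℝ → ℝ → ℝ) : Prop where
  regret_le : ∀ (B : ℕ) [NeZero B] (E : BanditEnv B) (t : ℕ), 1 ≤ t →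
    ∀ δ : ℝ, 0 < δ → δ < 1 →
      ENNReal.ofReal (1 - δ) ≤ (banditLaw (alg B) E t).toOuterMeasure
        {ρ | ∀ θ ∈ stdSimplex ℝ (Fin B), weightedRegret H t ρ θ ≤ ξ B t (Real.log (1 / δ))}
  sum_le : ∀ (B : ℕ) [NeZero B] (t : ℕ) (x : ℝ), 0 < x →
    ∑ t' ∈ Finset.Icc 1 t, ξ B t' x ≤ Ξ B t x
  mono : ∀ (B B' : ℕ) [NeZero B], B ≤ B' → ∀ (t : ℕ), 1 ≤ t → ∀ x : ℝ, 0 < x →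
    ξ B t x ≤ ξ B' t x
  concave : ∀ (B : ℕ) [NeZero B] (x : ℝ), 0 < x →
    ConcaveOn ℝ (Set.Ici 0) fun t : ℝ => Ξ B t x

/-! ### Follow the regularized leader -/

/-- `b ↦ exp (- c * L b) / ∑_{b'} exp (- c * L b')`. -/
def expWeights {B : ℕ} (c : ℝ) (L : Fin B → ℝ) (b : Fin B) : ℝ :=
  Real.exp (-c * L b) / ∑ b', Real.exp (-c * L b')

/-- `∑_{i=1}^t w_i * lhat_i(b)` after a history of length `t` (most recent round first), where
`lhat_i(b) = l_i(b_i) 1{b_i = b} / (θ_i(b) + γ_i)` and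
`θ_{i+1} ∝ exp (-(η_i / w_i) ∑_{i' ≤ i} w_{i'} lhat_{i'})`. -/
def ftrlLoss (w η γ : ℕ → ℝ) {B : ℕ} : List (Fin B × ℝ) → Fin B → ℝ
  | [], _ => 0
  | (b₀, y) :: τ, b =>
      ftrlLoss w η γ τ b + w (τ.length + 1) *
        ((if b₀ = b then y else 0) /
          (expWeights (η τ.length / w τ.length) (ftrlLoss w η γ τ) b + γ (τ.length + 1)))

/-- The FTRL subroutine with weights `w`, learning rates `η` and exploration parameters `γ`. -/
def ftrl (w η γ : ℕ → ℝ) (B : ℕ) [NeZero B] : BanditAlg B := fun τ =>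
  PMF.ofFintype
    (fun b => ENNReal.ofReal
      (expWeights (η τ.length / w τ.length) (ftrlLoss w η γ τ) b)) (by
    have hpos : 0 < ∑ b', Real.exp (-(η τ.length / w τ.length) * ftrlLoss w η γ τ b') :=
      Finset.sum_pos (fun _ _ => Real.exp_pos _) ⟨0, Finset.mem_univ _⟩
    unfold expWeights
    rw [← ENNReal.ofReal_sum_of_nonneg
      (fun b _ => div_nonneg (Real.exp_pos _).le hpos.le)]
    rw [← Finset.sum_div, div_self hpos.ne', ENNReal.ofReal_one])

/-- The weights `w_t = α_t (∏_{i=2}^t (1 - α_i))⁻¹`. -/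
def ftrlWeight (H t : ℕ) : ℝ := alpha H t * (∏ i ∈ Finset.Icc 2 t, (1 - alpha H i))⁻¹

/-! ### V-learning -/

/-- What one V-learning agent with `B` actions stores: `V_h(s)`, its untruncated version, the
counter `N_h(s)`, the history of the `(s, h)`-th bandit, and the index `k_h^i(s)` of the episode
in which `s` was visited at step `h` for the `i`-th time. -/
structure AgentState (S B : ℕ) where
  V : ℕ → Fin S → ℝ
  Vt : ℕ → Fin S → ℝ
  N : ℕ → Fin S → ℕ
  hist : ℕ → Fin S → List (Fin B × ℝ)
  ep : ℕ → Fin S → ℕ → ℕ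

/-- Change the entry `(h, s)` of a table. -/
def set2 {S : ℕ} {α : Type} (f : ℕ → Fin S → α) (h : ℕ) (s : Fin S) (v : α) : ℕ → Fin S → α :=
  Function.update f h (Function.update (f h) s v)

/-- Initialization; the step `h` counted from `0` has `V_h = H - h`. -/
def AgentState.initial (H S B : ℕ) : AgentState S B where
  V h _ := (H : ℝ) - h
  Vt h _ := (H : ℝ) - h
  N _ _ := 0
  hist _ _ := []
  ep _ _ _ := 0

/-- The current strategy `π_h(· | s)` of the agent. -/
def AgentState.policy {S B : ℕ} [NeZero B] (st : AgentState S B) (alg : BanditAlg B) (h : ℕ)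
    (s : Fin S) : PMF (Fin B) :=
  alg.strategy (st.hist h s)

/-- The new untruncated value `(1 - α_t) Ṽ_h(s) + α_t (r + V_{h+1}(s') + β_t)`. -/
def AgentState.newVt {S B : ℕ} (st : AgentState S B) (H : ℕ) (β : ℕ → ℝ) (h : ℕ) (s : Fin S)
    (r : ℝ) (s' : Fin S) : ℝ :=
  (1 - alpha H (st.N h s + 1)) * st.Vt h s +
    alpha H (st.N h s + 1) * (r + st.V (h + 1) s' + β (st.N h s + 1))

/-- Update of the agent in episode `k` at step `h`, after playing `a` in state `s`, receiving `r`
and moving to `s'`. -/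
def AgentState.step {S B : ℕ} (st : AgentState S B) (H : ℕ) (β : ℕ → ℝ) (k h : ℕ) (s : Fin S)
    (a : Fin B) (r : ℝ) (s' : Fin S) : AgentState S B where
  V := set2 st.V h s (min ((H : ℝ) - h) (st.newVt H β h s r s'))
  Vt := set2 st.Vt h s (st.newVt H β h s r s')
  N := set2 st.N h s (st.N h s + 1)
  hist := set2 st.hist h s ((a, ((H : ℝ) - r - st.V (h + 1) s') / H) :: st.hist h s)
  ep := set2 st.ep h s (Function.update (st.ep h s) (st.N h s + 1) k)

/-- The states of all agents. -/
abbrev Profile (S : ℕ) {m : ℕ} (A : Fin m → ℕ) : Type := ∀ j : Fin m, AgentState S (A j)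

section Training

variable {m S : ℕ} {A : Fin m → ℕ} [∀ j, NeZero (A j)]

/-- Law of the agents' states after the last `n` steps of episode `k`, which begin at step `h` in
state `s` with the agents in the states `σ`. All agents act independently. -/
def episodeLaw (G : MarkovGame m S A) (H : ℕ) (alg : ∀ j, BanditAlg (A j))
    (β : Fin m → ℕ → ℝ) (k : ℕ) : (n h : ℕ) → Fin S → Profile S A → PMF (Profile S A)
  | 0, _, _, σ => PMF.pure σ
  | n + 1, h, s, σ =>
      (pmfPi fun j => (σ j).policy (alg j) h s).bind fun a =>
        (G.trans h s a).bind fun s' =>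
          episodeLaw G H alg β k n (h + 1) s'
            fun j => (σ j).step H (β j) k h s (a j) (G.reward j h s a) s'

/-- Law of the record of `n` episodes of training: entry `k` of the record is the agents' states
at the beginning of episode `k` (episodes are numbered from `0`). -/
def trainLaw (G : MarkovGame m S A) (H : ℕ) (alg : ∀ j, BanditAlg (A j))
    (β : Fin m → ℕ → ℝ) : ℕ → PMF (ℕ → Profile S A)
  | 0 => PMF.pure fun _ j => AgentState.initial H S (A j)
  | n + 1 => (trainLaw G H alg β n).bind fun R =>
      (episodeLaw G H alg β n H 0 G.s₁ (R n)).map fun σ =>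
        fun k => if k ≤ n then R k else σ

end Training

/-! ### The correlated output policy

The random sample is drawn before the execution and shared by all agents. It consists of the
initial episode index and, for every step `h`, of an index `i ∼ (α_t^i)_i` for every possible
count `t` (so that all agents use the same index), and of an action `a_j ∼ π_{j,h}^k(· | s)` for
every agent, episode and state, drawn independently. `Fin.ofNat n i` is just `i` for `i < n`. -/

/-- Randomness used in one step. -/
abbrev StepSeed (S K : ℕ) {m : ℕ} (A : Fin m → ℕ) : Type :=
  ((t : Fin K) → Fin ((t : ℕ) + 1)) × (Fin K → Fin S → JointAction A)

/-- The random sample of the output policy. -/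
abbrev Seed (S H K : ℕ) {m : ℕ} (A : Fin m → ℕ) : Type :=
  Fin K × (Fin H → StepSeed S K A)

section Output

variable {m S : ℕ} {A : Fin m → ℕ} [∀ j, NeZero (A j)]

/-- Law of the randomness of step `h`. -/
def stepSeedLaw (H K : ℕ) (alg : ∀ j, BanditAlg (A j)) (R : ℕ → Profile S A) (h : ℕ) :
    PMF (StepSeed S K A) :=
  (pmfPi fun t : Fin K => indexLaw H t).bind fun idx =>
    (pmfPi fun k : Fin K => pmfPi fun s : Fin S => pmfPi fun j : Fin m =>
      (R k j).policy (alg j) h s).map fun act => (idx, act)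

/-- Law of the random sample: uniform initial episode index, independent steps. -/
def seedLaw (H K : ℕ) [NeZero K] (alg : ∀ j, BanditAlg (A j)) (R : ℕ → Profile S A) :
    PMF (Seed S H K A) :=
  (PMF.uniformOfFintype (Fin K)).bind fun k =>
    (pmfPi fun h : Fin H => stepSeedLaw H K alg R h).map fun z => (k, z)

end Output

section Execution

variable {m S : ℕ} {A : Fin m → ℕ}

/-- The index kept by agent `j` after observing `s` at step `h` with the current index `k`: with
`t = N_h^k(s)`, it becomes `k_h^i(s)`, where `i` is the shared index for the count `t`. If
`t = 0` (no earlier visit, hence `i = 0`), the index `k` is kept. -/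
def nextIndex {H K : ℕ} [NeZero H] [NeZero K] (R : ℕ → Profile S A) (ω : Seed S H K A)
    (j : Fin m) (h : ℕ) (k : Fin K) (s : Fin S) : Fin K :=
  let t : ℕ := (R k j).N h s
  let i : ℕ := (ω.2 (Fin.ofNat H h)).1 (Fin.ofNat K t)
  if i = 0 then k else Fin.ofNat K ((R k j).ep h s i)

/-- The index kept by agent `j` after the past `τ`. -/
def indexAfter {H K : ℕ} [NeZero H] [NeZero K] (R : ℕ → Profile S A) (ω : Seed S H K A)
    (j : Fin m) : History S A → Fin K
  | [] => ω.1
  | (s, _) :: τ => nextIndex R ω j τ.length (indexAfter R ω j τ) s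

/-- The output policy of agent `j` for the sample `ω`. -/
def outputPolicy {H K : ℕ} [NeZero H] [NeZero K] (R : ℕ → Profile S A) (j : Fin m)
    (ω : Seed S H K A) : DetPolicy S A j := fun τ s =>
  (ω.2 (Fin.ofNat H τ.length)).2 (nextIndex R ω j τ.length (indexAfter R ω j τ) s) s j

end Execution

/-- The training records whose correlated output policy is an `ε`-approximate CCE. -/
def goodRecords {m S : ℕ} {A : Fin m → ℕ} [∀ j, NeZero (A j)] (G : MarkovGame m S A) (H K : ℕ)
    [NeZero H] [NeZero K] (alg : ∀ j, BanditAlg (A j)) (ε : ℝ) : Set (ℕ → Profile S A) :=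
  {R | G.IsApproxCCE H (seedLaw H K alg R).toMeasure
    (fun j (ω : Seed S H K A) => outputPolicy R j ω) ε}

/-- `A = max_j A_j`. -/
def maxA {m : ℕ} (A : Fin m → ℕ) : ℕ := Finset.univ.sup A

/-- `ι = log (m H S A K / δ)`. -/
def logTerm (m H S K : ℕ) (A : Fin m → ℕ) (δ : ℝ) : ℝ :=
  Real.log ((m * H * S * maxA A * K : ℝ) / δ)

/-- FTRL for a player with `B` actions: weights `w_t` and `η_t = γ_t = √(H ι / (B t))`. -/
def ftrlTuned (H : ℕ) (ι : ℝ) (B : ℕ) [NeZero B] : BanditAlg B :=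
  ftrl (ftrlWeight H) (fun t => √(H * ι / (B * t))) (fun t => √(H * ι / (B * t))) B

end VLearning

end

open VLearning

noncomputable section

open scoped ENNReal

set_option linter.unusedSectionVars false

namespace VLearning

/-! ### Expectations under probability mass functions -/

/-! Fix a training run. Unrolling the updates, the estimate of player `j` at a state visited `t`
times is the `α_t^i`-weighted average of `r + V_{h+1} + β` over these visits, truncated at the
remaining horizon (`IsRun.Vt_eq`). The output policy averages in the same way: on reaching the state
it moves to the episode of the `i`-th visit with probability `α_t^i` and plays the joint strategy
used there. All agents count the same visits, so they move together. Revealing the common sample one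
step at a time turns the value of the output policy, with or without a deterministic deviation, into
a recursion over the current episode index (`rexp_valueToGo`).

Optimism (`deviation_le_V`): at a given past and state a deterministic deviator picks one action,
and small weighted external regret says that no single action improves the average of the backups by
much. Concentration replaces the expected backups by the observed ones, and the bonus pays for both
errors. Backward induction shows that no deviation, however history-dependent, is worth more than
the current estimate, which does not see the past. Random deviations are mixtures of deterministic
ones, so the mean of the initial estimates over the episodes bounds the best response.

Gap (`sum_gap_le`): the value without deviation, `ownValue`, obeys the same averaging without bonus.
Hence its distance to the estimate is at most twice the averaged bonus plus the average of the
distances one step later. Summed over episodes, every visit is charged total weight `∑_{t ≥ i} α_t^i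
≤ 1 + 1/H`, so a backward pass through the horizon inflates errors by at most `(1 + 1/H)^H ≤ 3`.
Cauchy-Schwarz and the concavity of `Ξ` then handle the unknown distribution of the visits over the
states.

Probability: training is recorded as a path of joint actions and successors. The own value at an
episode depends only on earlier training, so both it and the estimates give martingale differences
along the visits of a state (`azuma_visits`). For the regret, the visits of one state at one step
form a run of the subroutine against an adversary that simulates everything else (`badVisits_le`). A
union bound over players, steps, states and visit numbers gives `goodRecords_of_regret`.

For FTRL, the weights `w` make `α_t^i` equal to `w_i` times a factor depending on `t` only, so a
potential argument for exponential weights applies (`ftrl_regret_le`). Implicit exploration controls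
the loss estimates from above and an Azuma bound controls the played ones; together they give the
regret `25 √(HBι/t)` (`ftrlTuned_regret`). This subroutine is tuned to one confidence level, so the
second claim is derived from `goodRecords_of_regret` and not from the first claim. Two regimes are
trivial: one action per player, and `S > KHι`, where the claimed error exceeds the horizon. -/

/-- Expectation of a nonnegative function. -/
def pexp {α : Type*} (p : PMF α) (f : α → ℝ≥0∞) : ℝ≥0∞ := ∑' a, p a * f a

/-- Expectation of a real function on a finite type. -/
def rexp {α : Type*} [Fintype α] (p : PMF α) (f : α → ℝ) : ℝ := ∑ a, (p a).toReal * f a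

section pexp

variable {α β : Type*}

theorem pexp_pure (a : α) (f : α → ℝ≥0∞) : pexp (PMF.pure a) f = f a := by
  classical
  unfold pexp
  rw [tsum_eq_single a]
  · simp
  · intro b hb; simp [PMF.pure_apply, hb]

theorem pexp_bind (p : PMF α) (q : α → PMF β) (f : β → ℝ≥0∞) :
    pexp (p.bind q) f = pexp p fun a => pexp (q a) f := by
  unfold pexp
  simp only [PMF.bind_apply, ← ENNReal.tsum_mul_right, ← ENNReal.tsum_mul_left]
  rw [ENNReal.tsum_comm]
  simp only [mul_assoc]

theorem pexp_map (p : PMF α) (g : α → β) (f : β → ℝ≥0∞) :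
    pexp (p.map g) f = pexp p fun a => f (g a) := by
  rw [← PMF.bind_pure_comp, pexp_bind]
  simp [pexp_pure]

theorem pexp_mono_support (p : PMF α) {f g : α → ℝ≥0∞} (h : ∀ a ∈ p.support, f a ≤ g a) :
    pexp p f ≤ pexp p g := by
  refine ENNReal.tsum_le_tsum fun a => ?_
  by_cases ha : p a = 0
  · simp [ha]
  · exact mul_le_mul_right (h a ((p.mem_support_iff a).2 ha)) _

theorem pexp_mono (p : PMF α) {f g : α → ℝ≥0∞} (h : ∀ a, f a ≤ g a) : pexp p f ≤ pexp p g :=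
  pexp_mono_support p fun a _ => h a

theorem pexp_congr_support (p : PMF α) {f g : α → ℝ≥0∞} (h : ∀ a ∈ p.support, f a = g a) :
    pexp p f = pexp p g :=
  le_antisymm (pexp_mono_support p fun a ha => (h a ha).le)
    (pexp_mono_support p fun a ha => (h a ha).ge)

theorem pexp_const (p : PMF α) (c : ℝ≥0∞) : pexp p (fun _ => c) = c := by
  unfold pexp
  rw [ENNReal.tsum_mul_right, p.tsum_coe, one_mul]

theorem pexp_const_mul (p : PMF α) (c : ℝ≥0∞) (f : α → ℝ≥0∞) :
    pexp p (fun a => c * f a) = c * pexp p f := by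
  unfold pexp
  rw [← ENNReal.tsum_mul_left]
  exact tsum_congr fun a => by ring

theorem pexp_add (p : PMF α) (f g : α → ℝ≥0∞) :
    pexp p (fun a => f a + g a) = pexp p f + pexp p g := by
  unfold pexp
  rw [← ENNReal.tsum_add]
  exact tsum_congr fun a => by ring

theorem toOuterMeasure_eq_pexp (p : PMF α) (s : Set α) :
    p.toOuterMeasure s = pexp p (s.indicator 1) := by
  rw [PMF.toOuterMeasure_apply]
  unfold pexp
  refine tsum_congr fun a => ?_
  by_cases ha : a ∈ s <;> simp [ha]

/-- Markov's inequality. -/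
theorem toOuterMeasure_le_of_pexp_le (p : PMF α) (s : Set α) (f : α → ℝ≥0∞) (c x : ℝ≥0∞)
    (h : ∀ a ∈ s, 1 ≤ c * f a) (hf : pexp p f ≤ x) : p.toOuterMeasure s ≤ c * x := by
  rw [toOuterMeasure_eq_pexp]
  calc pexp p (s.indicator 1) ≤ pexp p (fun a => c * f a) := by
        refine pexp_mono p fun a => ?_
        by_cases ha : a ∈ s
        · simpa [ha] using h a ha
        · simp [ha]
    _ ≤ c * x := by rw [pexp_const_mul]; exact mul_le_mul_right hf c

theorem toOuterMeasure_compl (p : PMF α) (s : Set α) :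
    p.toOuterMeasure s + p.toOuterMeasure sᶜ = 1 := by
  rw [toOuterMeasure_eq_pexp, toOuterMeasure_eq_pexp, ← pexp_add]
  conv_rhs => rw [← pexp_const p 1]
  congr 1
  funext a
  by_cases ha : a ∈ s <;> simp [ha]

theorem ofReal_one_sub_le_iff (p : PMF α) (s : Set α) (δ : ℝ) (h0 : 0 ≤ δ) :
    ENNReal.ofReal (1 - δ) ≤ p.toOuterMeasure s ↔ p.toOuterMeasure sᶜ ≤ ENNReal.ofReal δ := by
  have h := toOuterMeasure_compl p s
  have hs : p.toOuterMeasure s ≠ ∞ := by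
    intro hh; rw [hh] at h; simp at h
  have hc : p.toOuterMeasure sᶜ ≠ ∞ := by
    intro hh; rw [hh] at h; simp at h
  have h' := congrArg ENNReal.toReal h
  rw [ENNReal.toReal_add hs hc, ENNReal.toReal_one] at h'
  rw [ENNReal.ofReal_le_iff_le_toReal hs, ENNReal.le_ofReal_iff_toReal_le hc h0]
  constructor <;> intro _ <;> linarith

/-- The mean of a `[0, 1]`-valued coordinate. -/
theorem pexp_ofReal_eq (p : PMF α) (f : α → ℝ) (hf : ∀ a ∈ p.support, f a ∈ Set.Icc (0 : ℝ) 1) :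
    pexp p (fun a => ENNReal.ofReal (f a)) = ENNReal.ofReal (∑' a, (p a).toReal * f a) := by
  have h0 : ∀ a, 0 ≤ (p a).toReal * f a := by
    intro a
    by_cases ha : p a = 0
    · simp [ha]
    · exact mul_nonneg ENNReal.toReal_nonneg (hf a ((p.mem_support_iff a).2 ha)).1
  have hs : Summable fun a => (p a).toReal * f a := by
    refine Summable.of_nonneg_of_le h0 (fun a => ?_)
      (ENNReal.summable_toReal (f := p) (by rw [p.tsum_coe]; simp))
    by_cases ha : p a = 0
    · simp [ha]
    · exact mul_le_of_le_one_right ENNReal.toReal_nonneg (hf a ((p.mem_support_iff a).2 ha)).2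
  rw [ENNReal.ofReal_tsum_of_nonneg h0 hs]
  unfold pexp
  refine tsum_congr fun a => ?_
  rw [ENNReal.ofReal_mul ENNReal.toReal_nonneg, ENNReal.ofReal_toReal (p.apply_ne_top a)]

/-- An affine function that is nonnegative at `0` and `1` is a nonnegative combination of `f` and `1
- f`, both of known mean. It serves to replace a noisy observed loss by its conditional mean inside
an exponential inequality. -/
theorem pexp_affine (p : PMF α) (f : α → ℝ) (hf : ∀ a ∈ p.support, f a ∈ Set.Icc (0 : ℝ) 1)
    (c d : ℝ) (hc : 0 ≤ c) (hd : 0 ≤ c + d) :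
    pexp p (fun a => ENNReal.ofReal (c + d * f a)) =
      ENNReal.ofReal (c + d * ∑' a, (p a).toReal * f a) := by
  have h1 : pexp p (fun a => ENNReal.ofReal (c + d * f a)) =
      ENNReal.ofReal c * pexp p (fun a => ENNReal.ofReal (1 - f a)) +
        ENNReal.ofReal (c + d) * pexp p (fun a => ENNReal.ofReal (f a)) := by
    rw [← pexp_const_mul, ← pexp_const_mul, ← pexp_add]
    refine pexp_congr_support p fun a ha => ?_
    have := hf a ha
    rw [← ENNReal.ofReal_mul hc, ← ENNReal.ofReal_mul hd, ← ENNReal.ofReal_add]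
    · congr 1; ring
    · exact mul_nonneg hc (by linarith [this.2])
    · exact mul_nonneg hd this.1
  have h2 : pexp p (fun a => ENNReal.ofReal (1 - f a)) + pexp p (fun a => ENNReal.ofReal (f a))
      = 1 := by
    rw [← pexp_add]
    rw [← pexp_const p 1]
    refine pexp_congr_support p fun a ha => ?_
    have := hf a ha
    rw [← ENNReal.ofReal_add (by linarith [this.2]) this.1]
    simp
  have h3 := pexp_ofReal_eq p f hf
  set M := ∑' a, (p a).toReal * f a
  have hM0 : 0 ≤ M := by
    refine tsum_nonneg fun a => ?_
    by_cases ha : p a = 0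
    · simp [ha]
    · exact mul_nonneg ENNReal.toReal_nonneg (hf a ((p.mem_support_iff a).2 ha)).1
  have hM1 : M ≤ 1 := by
    have : ENNReal.ofReal M ≤ 1 := by rw [← h3, ← h2]; exact le_add_self
    simpa using this
  have h4 : pexp p (fun a => ENNReal.ofReal (1 - f a)) = ENNReal.ofReal (1 - M) := by
    rw [h3] at h2
    have : ENNReal.ofReal (1 - M) + ENNReal.ofReal M = 1 := by
      rw [← ENNReal.ofReal_add (by linarith) hM0]; simp
    rw [← this] at h2
    exact (ENNReal.add_left_inj ENNReal.ofReal_ne_top).1 h2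
  rw [h1, h3, h4, ← ENNReal.ofReal_mul hc, ← ENNReal.ofReal_mul hd, ← ENNReal.ofReal_add]
  · congr 1; ring
  · exact mul_nonneg hc (by linarith)
  · exact mul_nonneg hd hM0

end pexp

/-! ### Real expectations on finite types. -/

section rexp

variable {α β : Type*} [Fintype α] [Fintype β]

theorem sum_toReal_eq_one (p : PMF α) : ∑ a, (p a).toReal = 1 := by
  rw [← ENNReal.toReal_sum (fun a _ => p.apply_ne_top a), ← tsum_fintype (L := .unconditional _),
    p.tsum_coe, ENNReal.toReal_one]

theorem rexp_pure (a : α) (f : α → ℝ) : rexp (PMF.pure a) f = f a := by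
  classical
  unfold rexp
  rw [Finset.sum_eq_single a]
  · simp
  · intro b _ hb; simp [PMF.pure_apply, hb]
  · simp

theorem rexp_bind (p : PMF α) (q : α → PMF β) (f : β → ℝ) :
    rexp (p.bind q) f = rexp p fun a => rexp (q a) f := by
  unfold rexp
  simp only [PMF.bind_apply, tsum_fintype]
  have : ∀ b, (∑ a, p a * q a b).toReal = ∑ a, (p a).toReal * (q a b).toReal := by
    intro b
    rw [ENNReal.toReal_sum (fun a _ => ENNReal.mul_ne_top (p.apply_ne_top a)
      ((q a).apply_ne_top b))]
    simp
  simp only [this, Finset.sum_mul, Finset.mul_sum]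
  rw [Finset.sum_comm]
  simp only [mul_assoc]

theorem rexp_map (p : PMF α) (g : α → β) (f : β → ℝ) :
    rexp (p.map g) f = rexp p fun a => f (g a) := by
  rw [← PMF.bind_pure_comp, rexp_bind]
  simp [rexp_pure]

theorem rexp_mono_support (p : PMF α) {f g : α → ℝ} (h : ∀ a ∈ p.support, f a ≤ g a) :
    rexp p f ≤ rexp p g := by
  refine Finset.sum_le_sum fun a _ => ?_
  by_cases ha : p a = 0
  · simp [ha]
  · exact mul_le_mul_of_nonneg_left (h a ((p.mem_support_iff a).2 ha)) ENNReal.toReal_nonneg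

theorem rexp_mono (p : PMF α) {f g : α → ℝ} (h : ∀ a, f a ≤ g a) : rexp p f ≤ rexp p g :=
  rexp_mono_support p fun a _ => h a

theorem rexp_congr_support (p : PMF α) {f g : α → ℝ} (h : ∀ a ∈ p.support, f a = g a) :
    rexp p f = rexp p g :=
  le_antisymm (rexp_mono_support p fun a ha => (h a ha).le)
    (rexp_mono_support p fun a ha => (h a ha).ge)

theorem rexp_const (p : PMF α) (c : ℝ) : rexp p (fun _ => c) = c := by
  unfold rexp
  rw [← Finset.sum_mul, sum_toReal_eq_one, one_mul]

theorem rexp_add (p : PMF α) (f g : α → ℝ) :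
    rexp p (fun a => f a + g a) = rexp p f + rexp p g := by
  unfold rexp
  rw [← Finset.sum_add_distrib]
  exact Finset.sum_congr rfl fun a _ => by ring

theorem rexp_sub (p : PMF α) (f g : α → ℝ) :
    rexp p (fun a => f a - g a) = rexp p f - rexp p g := by
  unfold rexp
  rw [← Finset.sum_sub_distrib]
  exact Finset.sum_congr rfl fun a _ => by ring

theorem rexp_const_mul (p : PMF α) (c : ℝ) (f : α → ℝ) :
    rexp p (fun a => c * f a) = c * rexp p f := by
  unfold rexp
  rw [Finset.mul_sum]
  exact Finset.sum_congr rfl fun a _ => by ring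

theorem rexp_nonneg (p : PMF α) {f : α → ℝ} (h : ∀ a, 0 ≤ f a) : 0 ≤ rexp p f :=
  Finset.sum_nonneg fun a _ => mul_nonneg ENNReal.toReal_nonneg (h a)

theorem rexp_le_const (p : PMF α) {f : α → ℝ} {c : ℝ} (h : ∀ a, f a ≤ c) : rexp p f ≤ c :=
  (rexp_mono p h).trans_eq (rexp_const p c)

theorem rexp_sum {ι : Type*} (s : Finset ι) (p : PMF α) (f : ι → α → ℝ) :
    rexp p (fun a => ∑ i ∈ s, f i a) = ∑ i ∈ s, rexp p (f i) := by
  unfold rexp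
  rw [Finset.sum_comm]
  exact Finset.sum_congr rfl fun a _ => by rw [Finset.mul_sum]

theorem pexp_ofReal (p : PMF α) {f : α → ℝ} (h : ∀ a, 0 ≤ f a) :
    pexp p (fun a => ENNReal.ofReal (f a)) = ENNReal.ofReal (rexp p f) := by
  unfold pexp rexp
  rw [tsum_fintype, ENNReal.ofReal_sum_of_nonneg
    (fun a _ => mul_nonneg ENNReal.toReal_nonneg (h a))]
  refine Finset.sum_congr rfl fun a _ => ?_
  rw [ENNReal.ofReal_mul ENNReal.toReal_nonneg, ENNReal.ofReal_toReal (p.apply_ne_top a)]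

end rexp

/-! ### Product laws. -/

section pmfPi

variable {ι : Type} [Fintype ι] [DecidableEq ι] {α : ι → Type} [∀ i, Fintype (α i)]

theorem pmfPi_apply (p : ∀ i, PMF (α i)) (f : ∀ i, α i) : pmfPi p f = ∏ i, p i (f i) := rfl

/-- Sampling one coordinate first. -/
theorem pmfPi_eq_bind (p : ∀ i, PMF (α i)) (i : ι) :
    pmfPi p = (p i).bind fun x => pmfPi (Function.update p i (PMF.pure x)) := by
  classical
  ext f
  rw [PMF.bind_apply, tsum_fintype, Finset.sum_eq_single (f i)]
  · rw [pmfPi_apply, pmfPi_apply, ← Finset.mul_prod_erase _ _ (Finset.mem_univ i),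
      ← Finset.mul_prod_erase _ (fun j => Function.update p i (PMF.pure (f i)) j (f j))
        (Finset.mem_univ i)]
    have : ∏ j ∈ Finset.univ.erase i, Function.update p i (PMF.pure (f i)) j (f j) =
        ∏ j ∈ Finset.univ.erase i, p j (f j) :=
      Finset.prod_congr rfl fun j hj => by
        rw [Function.update_of_ne (Finset.ne_of_mem_erase hj)]
    rw [this]
    simp
  · intro b _ hb
    rw [pmfPi_apply, Finset.prod_eq_zero (Finset.mem_univ i), mul_zero]
    rw [Function.update_self, PMF.pure_apply, if_neg (Ne.symm hb)]
  · simp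

theorem mem_support_pmfPi {p : ∀ i, PMF (α i)} {f : ∀ i, α i} (h : f ∈ (pmfPi p).support)
    (i : ι) : f i ∈ (p i).support := by
  rw [PMF.mem_support_iff] at h ⊢
  intro h0
  exact h (by rw [pmfPi_apply]; exact Finset.prod_eq_zero (Finset.mem_univ i) h0)

theorem eq_of_mem_support_pmfPi_update {p : ∀ i, PMF (α i)} {f : ∀ i, α i} {i : ι} {x : α i}
    (h : f ∈ (pmfPi (Function.update p i (PMF.pure x))).support) : f i = x := by
  have := mem_support_pmfPi h i
  rwa [Function.update_self, PMF.mem_support_pure_iff] at this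

theorem rexp_pmfPi_coord [Fintype (∀ i, α i)] (p : ∀ i, PMF (α i)) (i : ι) (f : α i → ℝ) :
    rexp (pmfPi p) (fun z => f (z i)) = rexp (p i) f := by
  rw [pmfPi_eq_bind p i, rexp_bind]
  congr 1
  funext x
  rw [rexp_congr_support _ (g := fun _ => f x)
    (fun z hz => by rw [eq_of_mem_support_pmfPi_update hz]), rexp_const]

/-- Overriding a coordinate does not depend on its law. -/
theorem rexp_pmfPi_update [Fintype (∀ i, α i)] (p : ∀ i, PMF (α i)) (i : ι) (x : α i)
    (f : (∀ i, α i) → ℝ) :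
    rexp (pmfPi p) (fun z => f (Function.update z i x)) =
      rexp (pmfPi (Function.update p i (PMF.pure x))) f := by
  classical
  have key : ∀ b : α i, rexp (pmfPi (Function.update p i (PMF.pure b)))
      (fun z => f (Function.update z i x)) =
      rexp (pmfPi (Function.update p i (PMF.pure x))) f := by
    intro b
    -- Once coordinate `i` is frozen at `b`, overwriting it by `x` is a bijection between the
    -- supports: the only preimage of `g` that carries mass is `g` with `b` put back. The image law
    -- no longer depends on `b`.
    have hmap : (pmfPi (Function.update p i (PMF.pure b))).map (fun z => Function.update z i x) =
        pmfPi (Function.update p i (PMF.pure x)) := by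
      ext g
      rw [PMF.map_apply, tsum_fintype, pmfPi_apply]
      by_cases hg : g i = x
      · rw [Finset.sum_eq_single (Function.update g i b)]
        · rw [if_pos, pmfPi_apply]
          · refine Finset.prod_congr rfl fun j _ => ?_
            by_cases hj : j = i
            · subst hj; simp [hg]
            · simp [Function.update_of_ne hj]
          · rw [Function.update_idem, ← hg, Function.update_eq_self]
        · intro z _ hz
          split_ifs with h
          · rw [pmfPi_apply, Finset.prod_eq_zero (Finset.mem_univ i)]
            rw [Function.update_self, PMF.pure_apply, if_neg]
            intro hb
            apply hz
            rw [h, Function.update_idem, ← hb, Function.update_eq_self]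
          · rfl
        · simp
      · rw [Finset.prod_eq_zero (Finset.mem_univ i)
          (by rw [Function.update_self, PMF.pure_apply, if_neg hg])]
        refine Finset.sum_eq_zero fun z _ => ?_
        rw [if_neg]
        intro h
        exact hg (by rw [h, Function.update_self])
    rw [← hmap, rexp_map]
  rw [pmfPi_eq_bind p i, rexp_bind]
  simp only [key, rexp_const]

end pmfPi

/-! ### The learning rate -/

theorem one_sub_alpha (H t : ℕ) (ht : 1 ≤ t) : 1 - alpha H t = ((t : ℝ) - 1) / (H + t) := by
  have : (0 : ℝ) < H + t := by positivity
  unfold alpha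
  field_simp
  ring

theorem alphaW_self (H t : ℕ) (ht : 1 ≤ t) : alphaW H t t = alpha H t := by
  simp [alphaW, Nat.one_le_iff_ne_zero.1 ht]

theorem alphaW_succ (H t i : ℕ) (hi : i ≤ t) :
    alphaW H (t + 1) i = alphaW H t i * (1 - alpha H (t + 1)) := by
  unfold alphaW
  rw [← Finset.insert_Ioc_right_eq_Ioc_add_one hi, Finset.prod_insert (by simp)]
  ring

theorem alphaW_zero (H t : ℕ) (ht : 1 ≤ t) : alphaW H t 0 = 0 := by
  unfold alphaW
  rw [Finset.prod_eq_zero (i := 1) (by simp [ht])]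
  · simp
  · rw [one_sub_alpha H 1 le_rfl]; simp

theorem sum_alphaW_Icc (H t : ℕ) (ht : 1 ≤ t) : ∑ i ∈ Finset.Icc 1 t, alphaW H t i = 1 := by
  have h := sum_alphaW H t
  rw [Finset.sum_range_succ', alphaW_zero H t ht, add_zero] at h
  rw [← h, Finset.sum_bij' (fun i _ => i - 1) (fun i _ => i + 1)]
  all_goals simp +contextual
  all_goals omega

theorem sum_Icc_alphaW_succ (H t : ℕ) (f : ℕ → ℝ) :
    ∑ i ∈ Finset.Icc 1 (t + 1), alphaW H (t + 1) i * f i =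
      (1 - alpha H (t + 1)) * ∑ i ∈ Finset.Icc 1 t, alphaW H t i * f i +
        alpha H (t + 1) * f (t + 1) := by
  rw [Finset.sum_Icc_succ_top (by omega), alphaW_self H _ (by omega), Finset.mul_sum]
  congr 1
  refine Finset.sum_congr rfl fun i hi => ?_
  rw [alphaW_succ H t i (Finset.mem_Icc.1 hi).2]
  ring

/-- Passing from `t` to `t + 1` multiplies the weight by `1 - α_{t+1}`, and `α_t (1 - α_{t+1}) ≤
α_{t+1}`. So every weight is of order `H / t`. -/
theorem alphaW_le_alpha (H t i : ℕ) (hi : 1 ≤ i) (hit : i ≤ t) : alphaW H t i ≤ alpha H t := by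
  induction t, hit using Nat.le_induction with
  | base => rw [alphaW_self H i hi]
  | succ t hit ih =>
    rw [alphaW_succ H t i hit]
    have h1 := alpha_le_one H (t + 1) (by omega)
    refine (mul_le_mul_of_nonneg_right ih (by linarith)).trans ?_
    rw [one_sub_alpha H (t + 1) (by omega)]
    unfold alpha
    have h2 : (0 : ℝ) < H + t := by have : (1 : ℝ) ≤ t := by exact_mod_cast hi.trans hit
                                    positivity
    push_cast
    rw [div_mul_div_comm, div_le_div_iff₀ (by positivity) (by positivity)]
    have h3 : (0 : ℝ) ≤ H * (H + 1) * (H + t + 1) := by positivity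
    nlinarith

theorem alpha_le (H t : ℕ) (hH : 1 ≤ H) (ht : 1 ≤ t) : alpha H t ≤ 2 * H / t := by
  unfold alpha
  have h1 : (1 : ℝ) ≤ H := by exact_mod_cast hH
  have h2 : (1 : ℝ) ≤ t := by exact_mod_cast ht
  rw [div_le_div_iff₀ (by linarith) (by linarith)]
  nlinarith

/-- One factor of each square is at most `α_t`, and the remaining weights sum to one. This is the
variance proxy in the Azuma bounds. -/
theorem sum_alphaW_sq_le (H t : ℕ) (hH : 1 ≤ H) (ht : 1 ≤ t) :
    ∑ i ∈ Finset.Icc 1 t, alphaW H t i ^ 2 ≤ 2 * H / t := by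
  calc ∑ i ∈ Finset.Icc 1 t, alphaW H t i ^ 2
      ≤ ∑ i ∈ Finset.Icc 1 t, alpha H t * alphaW H t i := by
        refine Finset.sum_le_sum fun i hi => ?_
        rw [sq]
        have := Finset.mem_Icc.1 hi
        exact mul_le_mul_of_nonneg_right (alphaW_le_alpha H t i this.1 this.2)
          (alphaW_nonneg H t i)
    _ = alpha H t := by rw [← Finset.mul_sum, sum_alphaW_Icc H t ht, mul_one]
    _ ≤ 2 * H / t := alpha_le H t hH ht

/-- `∑_{t ≥ i} α_t^i ≤ 1 + 1/H`. -/
theorem sum_alphaW_index_le (H i M : ℕ) (hH : 1 ≤ H) (hi : 1 ≤ i) :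
    ∑ t ∈ Finset.Icc i M, alphaW H t i ≤ 1 + 1 / H := by
  have hHr : (1 : ℝ) ≤ H := by exact_mod_cast hH
  rcases lt_or_ge M i with hM | hM
  · rw [Finset.Icc_eq_empty (by omega), Finset.sum_empty]
    positivity
  -- The partial sums telescope to a closed form whose correction term is nonnegative.
  have key : ∑ t ∈ Finset.Icc i M, alphaW H t i = 1 + 1 / H - M / H * alphaW H M i := by
    induction M, hM using Nat.le_induction with
    | base =>
      rw [Finset.Icc_self, Finset.sum_singleton, alphaW_self H i hi]
      unfold alpha
      field_simp
      ring
    | succ M hM ih =>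
      rw [Finset.sum_Icc_succ_top (by omega), ih, alphaW_succ H M i hM,
        one_sub_alpha H (M + 1) (by omega)]
      push_cast
      field_simp
      ring
  rw [key]
  have := mul_nonneg (div_nonneg (Nat.cast_nonneg (α := ℝ) M) (Nat.cast_nonneg (α := ℝ) H))
    (alphaW_nonneg H M i)
  linarith

/-- The induction step comes down to `2 √t √(t+1) ≤ 2t + 1`. Together with `le_sum_alphaW_div_sqrt`
it shows that bonuses of order `1/√t` average to their last value up to a factor `2`. -/
theorem sum_alphaW_div_sqrt_le (H t : ℕ) (ht : 1 ≤ t) :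
    ∑ i ∈ Finset.Icc 1 t, alphaW H t i * (1 / √(i : ℝ)) ≤ 2 / √(t : ℝ) := by
  induction t, ht using Nat.le_induction with
  | base => simp [alphaW_self H 1 le_rfl, alpha]; rw [div_self (by positivity)]; norm_num
  | succ t ht ih =>
    rw [sum_Icc_alphaW_succ]
    have h1 := alpha_le_one H (t + 1) (by omega)
    refine (add_le_add_left (mul_le_mul_of_nonneg_left ih (by linarith)) _).trans ?_
    rw [one_sub_alpha H (t + 1) (by omega)]
    unfold alpha
    have h2 : (1 : ℝ) ≤ t := by exact_mod_cast ht
    push_cast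
    have hs : 0 < √(t : ℝ) := Real.sqrt_pos.2 (by linarith)
    have hs' : 0 < √((t : ℝ) + 1) := Real.sqrt_pos.2 (by linarith)
    have e1 : √(t : ℝ) ^ 2 = t := Real.sq_sqrt (by linarith)
    have e2 : √((t : ℝ) + 1) ^ 2 = t + 1 := Real.sq_sqrt (by linarith)
    have e3 : ((t : ℝ) + 1 - 1) / (H + (t + 1)) * (2 / √(t : ℝ)) = 2 * √(t : ℝ) / (H + (t + 1)) := by
      rw [add_sub_cancel_right, div_mul_div_comm, div_eq_div_iff (by positivity) (by positivity)]
      linear_combination (-2 * ((H : ℝ) + (t + 1))) * e1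
    rw [e3, div_mul_div_comm, div_add_div _ _ (by positivity) (by positivity),
      div_le_div_iff₀ (by positivity) hs']
    have h4 : 2 * √(t : ℝ) * √((t : ℝ) + 1) ≤ 2 * t + 1 := by
      nlinarith [sq_nonneg (√(t : ℝ) - √((t : ℝ) + 1))]
    have hpos : (0 : ℝ) < (H + (t + 1)) * √((t : ℝ) + 1) := by positivity
    have hH0 : (0 : ℝ) ≤ H := Nat.cast_nonneg H
    have : 2 * √(t : ℝ) * √((t : ℝ) + 1) + (H + 1) ≤ 2 * (H + (t + 1)) := by linarith
    calc _ = (2 * √(t : ℝ) * √((t : ℝ) + 1) + (H + 1)) * ((H + (t + 1)) * √((t : ℝ) + 1)) := by ring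
      _ ≤ (2 * (H + (t + 1))) * ((H + (t + 1)) * √((t : ℝ) + 1)) :=
        mul_le_mul_of_nonneg_right this hpos.le
      _ = _ := by ring

theorem le_sum_alphaW_div_sqrt (H t : ℕ) (ht : 1 ≤ t) :
    1 / √(t : ℝ) ≤ ∑ i ∈ Finset.Icc 1 t, alphaW H t i * (1 / √(i : ℝ)) := by
  calc 1 / √(t : ℝ) = ∑ i ∈ Finset.Icc 1 t, alphaW H t i * (1 / √(t : ℝ)) := by
        rw [← Finset.sum_mul, sum_alphaW_Icc H t ht, one_mul]
    _ ≤ _ := by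
        refine Finset.sum_le_sum fun i hi => ?_
        have := Finset.mem_Icc.1 hi
        refine mul_le_mul_of_nonneg_left ?_ (alphaW_nonneg H t i)
        refine one_div_le_one_div_of_le (Real.sqrt_pos.2 (by exact_mod_cast this.1)) ?_
        exact Real.sqrt_le_sqrt (by exact_mod_cast this.2)

/-! ### Values of the output policy -/

section OutputValue

variable {m S : ℕ} {A : Fin m → ℕ} [∀ j, NeZero (A j)]

/-- The joint strategy of the agents with record `R` at the beginning of episode `k`. -/
def jointPolicy (alg : ∀ j, BanditAlg (A j)) (R : ℕ → Profile S A) (k h : ℕ) (s : Fin S) :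
    PMF (JointAction A) :=
  pmfPi fun j => (R k j).policy (alg j) h s

/-- Reward of player `j` plus the expectation of `W` at the next state. -/
def MarkovGame.backup (G : MarkovGame m S A) (j : Fin m) (h : ℕ) (s : Fin S) (W : Fin S → ℝ)
    (a : JointAction A) : ℝ :=
  G.reward j h s a + rexp (G.trans h s a) W

/-- Expectation over the new index when the current index is `k`. -/
def indexExp {K : ℕ} [NeZero K] (H : ℕ) (R : ℕ → Profile S A) (j : Fin m) (h : ℕ) (k : Fin K)
    (s : Fin S) (F : Fin K → ℝ) : ℝ :=
  ∑ i ∈ Finset.range ((R k j).N h s + 1),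
    alphaW H ((R k j).N h s) i * F (if i = 0 then k else Fin.ofNat K ((R k j).ep h s i))

/-- Expected reward of player `j` in the `n` remaining steps under the output policy, with the
joint action `a` replaced by `Φ τ s a`. -/
def outputValue {K : ℕ} [NeZero K] (G : MarkovGame m S A) (H : ℕ)
    (alg : ∀ j, BanditAlg (A j)) (R : ℕ → Profile S A) (j : Fin m)
    (Φ : History S A → Fin S → JointAction A → JointAction A) :
    ℕ → History S A → Fin K → Fin S → ℝ
  | 0, _, _, _ => 0
  | n + 1, τ, k, s =>
      indexExp H R j τ.length k s fun k' =>
        rexp (jointPolicy alg R k' τ.length s) fun a =>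
          G.backup j τ.length s (fun s' => outputValue G H alg R j Φ n ((s, Φ τ s a) :: τ) k' s')
            (Φ τ s a)

variable {H K : ℕ} [NeZero H] [NeZero K]

/-- Agents with equal counters and equal episode tables read the same entry of the shared sample.
Hence one index describes the whole joint policy. -/
theorem nextIndex_eq (R : ℕ → Profile S A)
    (hN : ∀ k < K, ∀ i j, ∀ h < H, ∀ s, (R k i).N h s = (R k j).N h s)
    (hep : ∀ k < K, ∀ i j, ∀ h < H, ∀ s l, (R k i).ep h s l = (R k j).ep h s l) (ω : Seed S H K A)
    (i j : Fin m) (h : ℕ) (hh : h < H) (k : Fin K) (s : Fin S) :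
    nextIndex R ω i h k s = nextIndex R ω j h k s := by
  unfold nextIndex
  rw [hN k k.2 i j h hh]
  simp only [hep k k.2 i j h hh]

theorem indexAfter_eq (R : ℕ → Profile S A)
    (hN : ∀ k < K, ∀ i j, ∀ h < H, ∀ s, (R k i).N h s = (R k j).N h s)
    (hep : ∀ k < K, ∀ i j, ∀ h < H, ∀ s l, (R k i).ep h s l = (R k j).ep h s l) (ω : Seed S H K A)
    (i j : Fin m) (τ : History S A) (hτ : τ.length ≤ H) :
    indexAfter R ω i τ = indexAfter R ω j τ := by
  induction τ with
  | nil => rfl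
  | cons x τ ih =>
    rw [List.length_cons] at hτ
    simp only [indexAfter]
    rw [ih (by omega), nextIndex_eq R hN hep ω i j _ (by omega)]

theorem nextIndex_congr (R : ℕ → Profile S A) (k₀ k₁ : Fin K) (z z' : Fin H → StepSeed S K A)
    (j : Fin m) (h : ℕ) (hz : z (Fin.ofNat H h) = z' (Fin.ofNat H h)) (k : Fin K) (s : Fin S) :
    nextIndex R (k₀, z) j h k s = nextIndex R (k₁, z') j h k s := by
  unfold nextIndex
  simp only [hz]

/-- The index reached after a past reads only the seeds of the steps in that past, so the seed of
the present step is still fresh. -/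
theorem indexAfter_congr (R : ℕ → Profile S A) (k₀ : Fin K) (z z' : Fin H → StepSeed S K A)
    (j : Fin m) (τ : History S A) (hz : ∀ h < τ.length, z (Fin.ofNat H h) = z' (Fin.ofNat H h)) :
    indexAfter R (k₀, z) j τ = indexAfter R (k₀, z') j τ := by
  induction τ with
  | nil => rfl
  | cons x τ ih =>
    simp only [indexAfter]
    rw [ih fun h hh => hz h (by simp; omega)]
    exact nextIndex_congr R _ _ z z' j _ (hz _ (by simp)) _ _

/-- The seed laws after the seeds of the first `h` steps have been revealed to be `z`. -/
def revealedLaw (alg : ∀ j, BanditAlg (A j)) (R : ℕ → Profile S A) (h : ℕ)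
    (z : Fin H → StepSeed S K A) (i : Fin H) : PMF (StepSeed S K A) :=
  if (i : ℕ) < h then PMF.pure (z i) else stepSeedLaw H K alg R i

theorem update_revealedLaw (alg : ∀ j, BanditAlg (A j)) (R : ℕ → Profile S A) (h : Fin H)
    (z : Fin H → StepSeed S K A) (x : StepSeed S K A) :
    Function.update (revealedLaw alg R h z) h (PMF.pure x) =
      revealedLaw alg R (h + 1) (Function.update z h x) := by
  funext i
  unfold revealedLaw
  by_cases hi : i = h
  · subst hi; simp
  · have : (i : ℕ) ≠ h := fun e => hi (Fin.ext e)
    rw [Function.update_of_ne hi, Function.update_of_ne hi]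
    by_cases h1 : (i : ℕ) < h
    · rw [if_pos h1, if_pos (by omega)]
    · rw [if_neg h1, if_neg (by omega)]

theorem eq_of_mem_support_revealedLaw {alg : ∀ j, BanditAlg (A j)} {R : ℕ → Profile S A} {h : ℕ}
    {z z' : Fin H → StepSeed S K A} (hz : z' ∈ (pmfPi (revealedLaw alg R h z)).support)
    {i : Fin H} (hi : (i : ℕ) < h) : z' i = z i := by
  have := mem_support_pmfPi hz i
  rwa [revealedLaw, if_pos hi, PMF.mem_support_pure_iff] at this

theorem rexp_indexLaw (t : ℕ) (f : ℕ → ℝ) :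
    rexp (indexLaw H t) (fun i => f i) = ∑ i ∈ Finset.range (t + 1), alphaW H t i * f i := by
  rw [← Fin.sum_univ_eq_sum_range (fun i => alphaW H t i * f i)]
  unfold rexp indexLaw
  refine Finset.sum_congr rfl fun i _ => ?_
  rw [PMF.ofFintype_apply, ENNReal.toReal_ofReal (alphaW_nonneg H t i)]

/-- Expectation over the seed of one step, which determines the next index and the action. -/
theorem rexp_stepSeedLaw (alg : ∀ j, BanditAlg (A j)) (R : ℕ → Profile S A) (j : Fin m) (h : ℕ)
    (k : Fin K) (s : Fin S) (hK : (R k j).N h s < K) (F : Fin K → JointAction A → ℝ)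
    (g : StepSeed S K A → Fin K)
    (hg : ∀ x, g x = if (x.1 (Fin.ofNat K ((R k j).N h s)) : ℕ) = 0 then k else
      Fin.ofNat K ((R k j).ep h s (x.1 (Fin.ofNat K ((R k j).N h s))))) :
    rexp (stepSeedLaw H K alg R h) (fun x => F (g x) (x.2 (g x) s)) =
      indexExp H R j h k s fun k' => rexp (jointPolicy alg R k' h s) (F k') := by
  unfold stepSeedLaw
  rw [rexp_bind]
  simp only [rexp_map]
  -- The seed holds independent actions for every episode and state, and only the entry at `k'` and
  -- `s` is read. Its marginal is the joint strategy of episode `k'`, and it is independent of the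
  -- indices that select `k'`.
  have h1 : ∀ (k' : Fin K), rexp (pmfPi fun k : Fin K => pmfPi fun s : Fin S =>
      pmfPi fun j : Fin m => (R k j).policy (alg j) h s) (fun act => F k' (act k' s)) =
      rexp (jointPolicy alg R k' h s) (F k') := by
    intro k'
    rw [rexp_pmfPi_coord (fun k : Fin K => pmfPi fun s : Fin S =>
      pmfPi fun j : Fin m => (R k j).policy (alg j) h s) k' (fun y => F k' (y s)),
      rexp_pmfPi_coord (fun s : Fin S =>
      pmfPi fun j : Fin m => (R k' j).policy (alg j) h s) s (fun y => F k' y)]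
    rfl
  simp only [hg]
  simp only [h1]
  set t' : Fin K := Fin.ofNat K ((R k j).N h s) with ht'
  have hval : (t' : ℕ) = (R k j).N h s := by
    rw [ht', Fin.val_ofNat, Nat.mod_eq_of_lt hK]
  rw [rexp_pmfPi_coord (fun t : Fin K => indexLaw H t) t' (fun i =>
      rexp (jointPolicy alg R ((if (i : ℕ) = 0 then k else
        Fin.ofNat K ((R k j).ep h s i) : Fin K) : ℕ) h s) (F (if (i : ℕ) = 0 then k else
        Fin.ofNat K ((R k j).ep h s i))))]
  rw [rexp_indexLaw (t' : ℕ) (fun i => rexp (jointPolicy alg R ((if (i : ℕ) = 0 then k else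
        Fin.ofNat K ((R k j).ep h s i) : Fin K) : ℕ) h s) (F (if (i : ℕ) = 0 then k else
        Fin.ofNat K ((R k j).ep h s i))))]
  rw [hval]
  rfl

/-- With the seeds of the elapsed steps revealed, the random policy is Markov in the current index:
revealing the next seed performs one step of the recursion for `outputValue`. The map `Φ` covers
following the policy and deviating from it at once. -/
theorem rexp_valueToGo (G : MarkovGame m S A) (alg : ∀ j, BanditAlg (A j)) (R : ℕ → Profile S A)
    (hN : ∀ k < K, ∀ i j, ∀ h < H, ∀ s, (R k i).N h s = (R k j).N h s)
    (hep : ∀ k < K, ∀ i j, ∀ h < H, ∀ s l, (R k i).ep h s l = (R k j).ep h s l)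
    (hK : ∀ k < K, ∀ j, ∀ h < H, ∀ s, (R k j).N h s < K) (j : Fin m)
    (Φ : History S A → Fin S → JointAction A → JointAction A)
    (σ : Seed S H K A → ∀ i, DetPolicy S A i)
    (hσ : ∀ ω τ s, (fun i => σ ω i τ s) = Φ τ s fun i => outputPolicy R i ω τ s)
    (k₀ : Fin K) (n : ℕ) (τ : History S A) (hn : n + τ.length = H) (s : Fin S)
    (z : Fin H → StepSeed S K A) :
    rexp (pmfPi (revealedLaw alg R τ.length z))
        (fun z' => G.valueToGo (σ (k₀, z')) j n τ s) =
      outputValue G H alg R j Φ n τ (indexAfter R (k₀, z) j τ) s := by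
  induction n generalizing τ s z with
  | zero => simp only [MarkovGame.valueToGo, outputValue, rexp_const]
  | succ n ih =>
    have hlt : τ.length < H := by omega
    set h : Fin H := ⟨τ.length, hlt⟩ with hh
    have hofNat : Fin.ofNat H τ.length = h := Fin.ext (by simp [hh, Nat.mod_eq_of_lt hlt])
    have hofNat' : ∀ l < τ.length, ((Fin.ofNat H l : Fin H) : ℕ) = l := fun l hl => by
      rw [Fin.val_ofNat, Nat.mod_eq_of_lt (by omega)]
    rw [pmfPi_eq_bind _ h, rexp_bind]
    have hlaw : revealedLaw alg R τ.length z h = stepSeedLaw H K alg R τ.length := by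
      simp [revealedLaw, hh]
    rw [hlaw]
    set k := indexAfter R (k₀, z) j τ with hk
    -- Given the present seed `x`, the new index and the joint action are determined; the inductive
    -- hypothesis then applies with `x` added to the revealed seeds.
    have key : ∀ x, rexp (pmfPi (Function.update (revealedLaw alg R τ.length z) h (PMF.pure x)))
        (fun z' => G.valueToGo (σ (k₀, z')) j (n + 1) τ s) =
        (fun k' a => G.backup j τ.length s
          (fun s' => outputValue G H alg R j Φ n ((s, Φ τ s a) :: τ) k' s') (Φ τ s a))
          (nextIndex R (k₀, Function.update z h x) j τ.length k s)
          (x.2 (nextIndex R (k₀, Function.update z h x) j τ.length k s) s) := by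
      intro x
      have hu : Function.update (revealedLaw alg R τ.length z) h (PMF.pure x) =
        revealedLaw alg R (τ.length + 1) (Function.update z h x) := update_revealedLaw alg R h z x
      rw [hu]
      set k' := nextIndex R (k₀, Function.update z h x) j τ.length k s with hk'
      have hia : ∀ z' : Fin H → StepSeed S K A,
          (∀ i : Fin H, (i : ℕ) < τ.length + 1 → z' i = Function.update z h x i) →
          indexAfter R (k₀, z') j τ = k := by
        intro z' hz'
        refine indexAfter_congr R k₀ z' z j τ fun l hl => ?_
        rw [hz' _ (by rw [hofNat' l hl]; omega), Function.update_of_ne]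
        intro e
        have := congrArg Fin.val e
        rw [hofNat' l hl] at this
        simp [hh] at this
        omega
      have hact : ∀ z' : Fin H → StepSeed S K A,
          (∀ i : Fin H, (i : ℕ) < τ.length + 1 → z' i = Function.update z h x i) →
          (fun i => σ (k₀, z') i τ s) = Φ τ s (x.2 k' s) := by
        intro z' hz'
        rw [hσ]
        congr 1
        funext i
        unfold outputPolicy
        rw [indexAfter_eq R hN hep _ i j τ hlt.le, nextIndex_eq R hN hep _ i j _ hlt, hia z' hz']
        rw [nextIndex_congr R k₀ k₀ z' (Function.update z h x) j τ.length
          (by rw [hofNat]; exact hz' h (by simp [hh]))]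
        simp only [hofNat]
        rw [hz' h (by simp [hh]), Function.update_self]
      have hstep : rexp (pmfPi (revealedLaw alg R (τ.length + 1) (Function.update z h x)))
          (fun z' => G.valueToGo (σ (k₀, z')) j (n + 1) τ s) =
          rexp (pmfPi (revealedLaw alg R (τ.length + 1) (Function.update z h x)))
          (fun z' => G.reward j τ.length s (Φ τ s (x.2 k' s)) +
            ∑ s', (G.trans τ.length s (Φ τ s (x.2 k' s)) s').toReal *
              G.valueToGo (σ (k₀, z')) j n ((s, Φ τ s (x.2 k' s)) :: τ) s') := by
        refine rexp_congr_support _ fun z' hz' => ?_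
        have hz'' : ∀ i : Fin H, (i : ℕ) < τ.length + 1 → z' i = Function.update z h x i :=
          fun i hi => eq_of_mem_support_revealedLaw hz' hi
        simp only [MarkovGame.valueToGo, hact z' hz'']
      rw [hstep, rexp_add, rexp_const, rexp_sum]
      simp only [rexp_const_mul]
      unfold MarkovGame.backup rexp
      congr 1
      refine Finset.sum_congr rfl fun s' _ => ?_
      congr 1
      have := ih ((s, Φ τ s (x.2 k' s)) :: τ) (by simp; omega) s' (Function.update z h x)
      simp only [List.length_cons] at this
      unfold rexp at this
      rw [this]
      simp only [indexAfter]
      rw [hia _ fun i _ => rfl]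
    refine (congrArg (rexp _) (funext key)).trans ((rexp_stepSeedLaw alg R j τ.length k s
      (hK k k.2 j _ hlt s) (fun k' a => G.backup j τ.length s
          (fun s' => outputValue G H alg R j Φ n ((s, Φ τ s a) :: τ) k' s') (Φ τ s a))
      (fun x => nextIndex R (k₀, Function.update z h x) j τ.length k s) ?_).trans rfl)
    intro x
    unfold nextIndex
    simp only [hofNat, Function.update_self]

theorem rexp_uniform (f : Fin K → ℝ) :
    rexp (PMF.uniformOfFintype (Fin K)) f = 1 / (K : ℝ) * ∑ k, f k := by
  unfold rexp
  rw [Finset.mul_sum]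
  refine Finset.sum_congr rfl fun k _ => ?_
  simp [PMF.uniformOfFintype_apply]

theorem rexp_seedLaw_valueToGo (G : MarkovGame m S A) (alg : ∀ j, BanditAlg (A j))
    (R : ℕ → Profile S A)
    (hN : ∀ k < K, ∀ i j, ∀ h < H, ∀ s, (R k i).N h s = (R k j).N h s)
    (hep : ∀ k < K, ∀ i j, ∀ h < H, ∀ s l, (R k i).ep h s l = (R k j).ep h s l)
    (hK : ∀ k < K, ∀ j, ∀ h < H, ∀ s, (R k j).N h s < K) (j : Fin m)
    (Φ : History S A → Fin S → JointAction A → JointAction A)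
    (σ : Seed S H K A → ∀ i, DetPolicy S A i)
    (hσ : ∀ ω τ s, (fun i => σ ω i τ s) = Φ τ s fun i => outputPolicy R i ω τ s) :
    rexp (seedLaw H K alg R) (fun ω => G.valueToGo (σ ω) j H [] G.s₁) =
      1 / (K : ℝ) * ∑ k : Fin K, outputValue G H alg R j Φ H [] k G.s₁ := by
  unfold seedLaw
  rw [rexp_bind, rexp_uniform]
  congr 1
  refine Finset.sum_congr rfl fun k _ => ?_
  rw [rexp_map]
  -- Nothing is revealed before the first step, so the revealed seeds are an arbitrary filler.
  have := rexp_valueToGo G alg R hN hep hK j Φ σ hσ k H [] (by simp) G.s₁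
    (fun _ => (fun _ => 0, fun _ _ _ => 0))
  simp only [indexAfter] at this
  rw [← this]
  congr 1

theorem integral_toMeasure_eq_rexp {α : Type*} [Fintype α] [MeasurableSpace α]
    [MeasurableSingletonClass α] (p : PMF α) (f : α → ℝ) :
    ∫ a, f a ∂p.toMeasure = rexp p f := by
  rw [PMF.integral_eq_sum]
  rfl

/-- The value of the output policy. -/
theorem value_outputPolicy (G : MarkovGame m S A) (alg : ∀ j, BanditAlg (A j))
    (R : ℕ → Profile S A)
    (hN : ∀ k < K, ∀ i j, ∀ h < H, ∀ s, (R k i).N h s = (R k j).N h s)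
    (hep : ∀ k < K, ∀ i j, ∀ h < H, ∀ s l, (R k i).ep h s l = (R k j).ep h s l)
    (hK : ∀ k < K, ∀ j, ∀ h < H, ∀ s, (R k j).N h s < K) (j : Fin m) :
    G.value H (seedLaw H K alg R).toMeasure (fun i (ω : Seed S H K A) => outputPolicy R i ω) j =
      1 / (K : ℝ) * ∑ k : Fin K, outputValue G H alg R j (fun _ _ a => a) H [] k G.s₁ := by
  unfold MarkovGame.value
  rw [integral_toMeasure_eq_rexp, rexp_seedLaw_valueToGo G alg R hN hep hK j (fun _ _ a => a)
    (fun ω i => outputPolicy R i ω) (fun _ _ _ => rfl)]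

/-- A bound for all deterministic deviations is a bound for the best response. -/
theorem bestResponseValue_outputPolicy_le (G : MarkovGame m S A) (alg : ∀ j, BanditAlg (A j))
    (R : ℕ → Profile S A)
    (hN : ∀ k < K, ∀ i j, ∀ h < H, ∀ s, (R k i).N h s = (R k j).N h s)
    (hep : ∀ k < K, ∀ i j, ∀ h < H, ∀ s l, (R k i).ep h s l = (R k j).ep h s l)
    (hK : ∀ k < K, ∀ j, ∀ h < H, ∀ s, (R k j).N h s < K) (j : Fin m) (c : ℝ) (hc : 0 ≤ c)
    (hdev : ∀ μ : DetPolicy S A j, 1 / (K : ℝ) * ∑ k : Fin K,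
      outputValue G H alg R j (fun τ s a => Function.update a j (μ τ s)) H [] k G.s₁ ≤ c) :
    G.bestResponseValue H (seedLaw H K alg R).toMeasure
      (fun i (ω : Seed S H K A) => outputPolicy R i ω) j ≤ c := by
  refine Real.sSup_le ?_ hc
  rintro v ⟨Ω', _, P', _, π', -, rfl⟩
  unfold MarkovGame.value
  by_cases hint : MeasureTheory.Integrable (fun ω : Seed S H K A × Ω' => G.valueToGo
      (fun i => Function.update (fun i => outputPolicy R i ω.1) j (π' ω.2) i) j H [] G.s₁)
      ((seedLaw H K alg R).toMeasure.prod P')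
  -- By Fubini the sample of the deviator may be fixed first; what remains is a deterministic
  -- deviation.
  · rw [MeasureTheory.integral_prod_symm _ hint]
    have h1 : ∀ ω', ∫ ω, G.valueToGo
        (fun i => Function.update (fun i => outputPolicy R i ω) j (π' ω') i) j H [] G.s₁
        ∂(seedLaw H K alg R).toMeasure ≤ c := by
      intro ω'
      rw [integral_toMeasure_eq_rexp, rexp_seedLaw_valueToGo G alg R hN hep hK j
        (fun τ s a => Function.update a j (π' ω' τ s))
        (fun ω i => Function.update (fun i => outputPolicy R i ω) j (π' ω') i)]
      · exact hdev (π' ω')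
      · intro ω τ s
        funext i
        by_cases hi : i = j
        · subst hi; simp
        · simp [Function.update_of_ne hi]
    calc _ ≤ ∫ _, c ∂P' := by
          refine MeasureTheory.integral_mono hint.integral_prod_right
            (MeasureTheory.integrable_const c) h1
      _ = c := by simp
  -- A non-integrable value has Bochner integral zero, which `hc` covers.
  · rw [MeasureTheory.integral_undef hint]
    exact hc

end OutputValue

/-! ### Deterministic analysis of a training run -/

section Run

variable {m S : ℕ} {A : Fin m → ℕ} [∀ j, NeZero (A j)]

/-- `R k` is the profile at the beginning of episode `k`, in which the states `st k h` are visited,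
the joint actions `ac k h` are played and the successors `nx k h` are observed. -/
structure IsRun (G : MarkovGame m S A) (H : ℕ) (β : Fin m → ℕ → ℝ) (R : ℕ → Profile S A)
    (st : ℕ → ℕ → Fin S) (ac : ℕ → ℕ → JointAction A) (nx : ℕ → ℕ → Fin S) : Prop where
  init : ∀ j, R 0 j = AgentState.initial H S (A j)
  st_zero : ∀ k, st k 0 = G.s₁
  st_succ : ∀ k h, h + 1 < H → st k (h + 1) = nx k h
  V_last : ∀ k j s, (R k j).V H s = 0
  N_succ : ∀ k j h s, h < H → (R (k + 1) j).N h s =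
    if s = st k h then (R k j).N h s + 1 else (R k j).N h s
  ep_succ : ∀ k j h s, h < H → (R (k + 1) j).ep h s =
    if s = st k h then Function.update ((R k j).ep h s) ((R k j).N h s + 1) k else (R k j).ep h s
  Vt_succ : ∀ k j h s, h < H → (R (k + 1) j).Vt h s =
    if s = st k h then (R k j).newVt H (β j) h s (G.reward j h s (ac k h)) (nx k h)
    else (R k j).Vt h s
  V_succ : ∀ k j h s, h < H → (R (k + 1) j).V h s =
    if s = st k h then min ((H : ℝ) - h)
      ((R k j).newVt H (β j) h s (G.reward j h s (ac k h)) (nx k h))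
    else (R k j).V h s

/-! ### Counters, episode indices and estimates along a run. -/

namespace IsRun

variable {G : MarkovGame m S A} {H : ℕ} {β : Fin m → ℕ → ℝ} {R : ℕ → Profile S A}
  {st : ℕ → ℕ → Fin S} {ac : ℕ → ℕ → JointAction A} {nx : ℕ → ℕ → Fin S}

theorem N_le (hR : IsRun G H β R st ac nx) (j : Fin m) {h : ℕ} (hh : h < H) (s : Fin S) (k : ℕ) :
    (R k j).N h s ≤ k := by
  induction k with
  | zero => simp [hR.init, AgentState.initial]
  | succ k ih => rw [hR.N_succ k j h s hh]; split_ifs <;> omega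

theorem N_mono (hR : IsRun G H β R st ac nx) (j : Fin m) {h : ℕ} (hh : h < H) (s : Fin S)
    {k k' : ℕ} (hk : k ≤ k') : (R k j).N h s ≤ (R k' j).N h s := by
  induction k', hk using Nat.le_induction with
  | base => exact le_rfl
  | succ k' _ ih => rw [hR.N_succ k' j h s hh]; split_ifs <;> omega

/-- A visit writes the slot just above the current counter, so filled slots never change. Averages
held in episode `k` can therefore be read off the table of any later episode. -/
theorem ep_eq (hR : IsRun G H β R st ac nx) (j : Fin m) {h : ℕ} (hh : h < H) (s : Fin S)
    {k k' : ℕ} (hk : k ≤ k') {i : ℕ} (hi : i ≤ (R k j).N h s) :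
    (R k' j).ep h s i = (R k j).ep h s i := by
  induction k', hk using Nat.le_induction with
  | base => rfl
  | succ k' hk ih =>
    rw [hR.ep_succ k' j h s hh]
    have := hR.N_mono j hh s hk
    split_ifs
    · rw [Function.update_of_ne (by omega), ih]
    · exact ih

theorem sum_ep_eq (hR : IsRun G H β R st ac nx) (j : Fin m) {h : ℕ} (hh : h < H) (s : Fin S)
    {k k' : ℕ} (hk : k ≤ k') (f : ℕ → ℝ) :
    ∑ i ∈ Finset.Icc 1 ((R k j).N h s), alphaW H ((R k j).N h s) i * f ((R k' j).ep h s i) =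
      ∑ i ∈ Finset.Icc 1 ((R k j).N h s), alphaW H ((R k j).N h s) i * f ((R k j).ep h s i) :=
  Finset.sum_congr rfl fun i hi => by rw [hR.ep_eq j hh s hk (Finset.mem_Icc.1 hi).2]

theorem N_eq (hR : IsRun G H β R st ac nx) (i j : Fin m) {h : ℕ} (hh : h < H) (s : Fin S)
    (k : ℕ) : (R k i).N h s = (R k j).N h s := by
  induction k with
  | zero => simp [hR.init, AgentState.initial]
  | succ k ih => rw [hR.N_succ k i h s hh, hR.N_succ k j h s hh, ih]

theorem ep_eq_ep (hR : IsRun G H β R st ac nx) (i j : Fin m) {h : ℕ} (hh : h < H) (s : Fin S)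
    (k : ℕ) : (R k i).ep h s = (R k j).ep h s := by
  induction k with
  | zero => simp [hR.init, AgentState.initial]
  | succ k ih => rw [hR.ep_succ k i h s hh, hR.ep_succ k j h s hh, ih, hR.N_eq i j hh]

/-- The recorded episodes lie strictly in the past, which makes inductions over episodes possible;
the counter during the `i`-th visit is still `i - 1`, because profiles are taken at the beginning of
an episode. -/
theorem ep_spec (hR : IsRun G H β R st ac nx) (j : Fin m) {h : ℕ} (hh : h < H) (s : Fin S)
    (k i : ℕ) (hi : 1 ≤ i) (hik : i ≤ (R k j).N h s) :
    (R k j).ep h s i < k ∧ st ((R k j).ep h s i) h = s ∧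
      (R ((R k j).ep h s i) j).N h s = i - 1 := by
  induction k with
  | zero => simp [hR.init, AgentState.initial] at hik; omega
  | succ k ih =>
    rw [hR.ep_succ k j h s hh]
    rw [hR.N_succ k j h s hh] at hik
    split_ifs at hik ⊢ with hs
    · by_cases hi' : i = (R k j).N h s + 1
      · subst hi'
        simp [hs]
      · rw [Function.update_of_ne hi']
        have := ih (by omega)
        exact ⟨by omega, this.2⟩
    · have := ih hik
      exact ⟨by omega, this.2⟩

/-- The weights `α_t^i` are the coefficients obtained by iterating `(1 - α_t) x + α_t y`. The
initial value survives only before the first visit. -/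
theorem Vt_eq (hR : IsRun G H β R st ac nx) (j : Fin m) {h : ℕ} (hh : h < H) (s : Fin S)
    (k : ℕ) :
    (R k j).Vt h s = alphaW H ((R k j).N h s) 0 * ((H : ℝ) - h) +
      ∑ i ∈ Finset.Icc 1 ((R k j).N h s), alphaW H ((R k j).N h s) i *
        (G.reward j h s (ac ((R k j).ep h s i) h) +
          (R ((R k j).ep h s i) j).V (h + 1) (nx ((R k j).ep h s i) h) + β j i) := by
  induction k with
  | zero => simp [hR.init, AgentState.initial, alphaW]
  | succ k ih =>
    rw [hR.Vt_succ k j h s hh, hR.N_succ k j h s hh]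
    split_ifs with hs
    · rw [sum_Icc_alphaW_succ, alphaW_succ H _ 0 (Nat.zero_le _)]
      unfold AgentState.newVt
      rw [ih]
      have e1 : (R (k + 1) j).ep h s ((R k j).N h s + 1) = k := by
        rw [hR.ep_succ k j h s hh, if_pos hs, Function.update_self]
      have e2 : ∀ f : ℕ → ℕ → ℝ, ∑ i ∈ Finset.Icc 1 ((R k j).N h s),
          alphaW H ((R k j).N h s) i * f i ((R (k + 1) j).ep h s i) =
          ∑ i ∈ Finset.Icc 1 ((R k j).N h s), alphaW H ((R k j).N h s) i *
            f i ((R k j).ep h s i) := fun f => Finset.sum_congr rfl fun i hi => by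
        rw [hR.ep_eq j hh s (Nat.le_succ k) (Finset.mem_Icc.1 hi).2]
      rw [e1, e2 fun i k' => G.reward j h s (ac k' h) + (R k' j).V (h + 1) (nx k' h) + β j i]
      ring
    · rw [ih]
      congr 1
      refine Finset.sum_congr rfl fun i hi => ?_
      rw [hR.ep_eq j hh s (Nat.le_succ k) (Finset.mem_Icc.1 hi).2]

theorem V_eq (hR : IsRun G H β R st ac nx) (j : Fin m) {h : ℕ} (hh : h < H) (s : Fin S)
    (k : ℕ) : (R k j).V h s = min ((H : ℝ) - h) ((R k j).Vt h s) := by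
  induction k with
  | zero => simp [hR.init, AgentState.initial]
  | succ k ih =>
    rw [hR.V_succ k j h s hh, hR.Vt_succ k j h s hh]
    split_ifs
    · rfl
    · exact ih

theorem V_le (hR : IsRun G H β R st ac nx) (j : Fin m) {h : ℕ} (hh : h ≤ H) (s : Fin S)
    (k : ℕ) : (R k j).V h s ≤ (H : ℝ) - h := by
  rcases hh.lt_or_eq with hh | rfl
  · rw [hR.V_eq j hh]; exact min_le_left _ _
  · rw [hR.V_last]; simp

/-- Single bonuses may be negative; only their weighted sums are controlled. Nonnegativity is
therefore read off the unrolled formula, by strong induction on the episode, and not from one update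
to the next. -/
theorem V_nonneg (hR : IsRun G H β R st ac nx) (j : Fin m) (K : ℕ)
    (hβ : ∀ t, 1 ≤ t → t ≤ K → 0 ≤ ∑ i ∈ Finset.Icc 1 t, alphaW H t i * β j i)
    {h : ℕ} (hh : h ≤ H) (s : Fin S) (k : ℕ) (hk : k ≤ K) : 0 ≤ (R k j).V h s := by
  induction k using Nat.strong_induction_on generalizing h s with
  | _ k ih =>
    rcases hh.lt_or_eq with hh | rfl
    · have hHh : (0 : ℝ) ≤ (H : ℝ) - h := by
        have : (h : ℝ) ≤ H := by exact_mod_cast hh.le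
        linarith
      rw [hR.V_eq j hh, hR.Vt_eq j hh]
      refine le_min hHh (add_nonneg (mul_nonneg (alphaW_nonneg _ _ _) hHh) ?_)
      simp only [mul_add (alphaW _ _ _), Finset.sum_add_distrib]
      refine add_nonneg (add_nonneg ?_ ?_) ?_
      · exact Finset.sum_nonneg fun i _ =>
          mul_nonneg (alphaW_nonneg _ _ _) (G.reward_mem _ _ _ _).1
      · refine Finset.sum_nonneg fun i hi => mul_nonneg (alphaW_nonneg _ _ _) ?_
        have hi' := Finset.mem_Icc.1 hi
        have := (hR.ep_spec j hh s k i hi'.1 hi'.2).1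
        exact ih _ this (by omega) _ (by omega)
      · rcases Nat.eq_zero_or_pos ((R k j).N h s) with h0 | h0
        · simp [h0]
        · exact hβ _ h0 ((hR.N_le j hh s k).trans hk)
    · rw [hR.V_last]

/-- Sums over episodes, grouped by the visited state. -/
theorem sum_episodes (hR : IsRun G H β R st ac nx) (j : Fin m) {h : ℕ} (hh : h < H) (K : ℕ)
    (f : Fin S → ℕ → ℕ → ℝ) :
    ∑ k ∈ Finset.range K, f (st k h) ((R k j).N h (st k h)) k =
      ∑ s, ∑ i ∈ Finset.Icc 1 ((R K j).N h s), f s (i - 1) ((R K j).ep h s i) := by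
  induction K with
  | zero => simp [hR.init, AgentState.initial]
  | succ K ih =>
    rw [Finset.sum_range_succ, ih]
    have h1 : ∀ s, ∑ i ∈ Finset.Icc 1 ((R (K + 1) j).N h s),
        f s (i - 1) ((R (K + 1) j).ep h s i) =
        ∑ i ∈ Finset.Icc 1 ((R K j).N h s), f s (i - 1) ((R K j).ep h s i) +
          if s = st K h then f s ((R K j).N h s) K else 0 := by
      intro s
      rw [hR.N_succ K j h s hh]
      have e2 : ∀ i ∈ Finset.Icc 1 ((R K j).N h s), (R (K + 1) j).ep h s i = (R K j).ep h s i :=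
        fun i hi => hR.ep_eq j hh s (Nat.le_succ K) (Finset.mem_Icc.1 hi).2
      split_ifs with hs
      · rw [Finset.sum_Icc_succ_top (by omega), Finset.sum_congr rfl
          (fun i hi => by rw [e2 i hi]), hR.ep_succ K j h s hh, if_pos hs, Function.update_self]
        simp
      · rw [Finset.sum_congr rfl (fun i hi => by rw [e2 i hi]), add_zero]
    rw [Finset.sum_congr rfl fun s _ => h1 s, Finset.sum_add_distrib]
    simp

theorem sum_N (hR : IsRun G H β R st ac nx) (j : Fin m) {h : ℕ} (hh : h < H) (K : ℕ) :
    ∑ s, (R K j).N h s = K := by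
  have := hR.sum_episodes j hh K (fun _ _ _ => 1)
  simp at this
  exact_mod_cast this.symm

end IsRun

/-! ### The value of the output policy along a run. -/

/-- Expected reward of player `j` in the `n` remaining steps, starting at step `h`, when all
agents follow the output policy with current index `k`. -/
def ownValue (G : MarkovGame m S A) (H : ℕ) (alg : ∀ j, BanditAlg (A j)) (R : ℕ → Profile S A)
    (j : Fin m) : ℕ → ℕ → ℕ → Fin S → ℝ
  | 0, _, _, _ => 0
  | n + 1, h, k, s =>
      ∑ i ∈ Finset.range ((R k j).N h s + 1), alphaW H ((R k j).N h s) i *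
        rexp (jointPolicy alg R (if i = 0 then k else (R k j).ep h s i) h s)
          (G.backup j h s fun s' =>
            ownValue G H alg R j n (h + 1) (if i = 0 then k else (R k j).ep h s i) s')

section

variable {G : MarkovGame m S A} {H : ℕ} {alg : ∀ j, BanditAlg (A j)} {β : Fin m → ℕ → ℝ}
  {R : ℕ → Profile S A} {st : ℕ → ℕ → Fin S} {ac : ℕ → ℕ → JointAction A} {nx : ℕ → ℕ → Fin S}

theorem MarkovGame.backup_le (j : Fin m) (h : ℕ) (s : Fin S) {W : Fin S → ℝ} {c : ℝ}
    (hW : ∀ s', W s' ≤ c) (a : JointAction A) : G.backup j h s W a ≤ 1 + c :=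
  add_le_add (G.reward_mem _ _ _ _).2 (rexp_le_const _ hW)

theorem MarkovGame.backup_nonneg (j : Fin m) (h : ℕ) (s : Fin S) {W : Fin S → ℝ}
    (hW : ∀ s', 0 ≤ W s') (a : JointAction A) : 0 ≤ G.backup j h s W a :=
  add_nonneg (G.reward_mem _ _ _ _).1 (rexp_nonneg _ hW)

theorem MarkovGame.backup_mono (j : Fin m) (h : ℕ) (s : Fin S) {W W' : Fin S → ℝ}
    (hW : ∀ s', W s' ≤ W' s') (a : JointAction A) : G.backup j h s W a ≤ G.backup j h s W' a :=
  add_le_add le_rfl (rexp_mono _ hW)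

theorem sum_alphaW_mul_le {t : ℕ} {F : ℕ → ℝ} {c : ℝ} (hF : ∀ i ∈ Finset.range (t + 1), F i ≤ c) :
    ∑ i ∈ Finset.range (t + 1), alphaW H t i * F i ≤ c := by
  calc _ ≤ ∑ i ∈ Finset.range (t + 1), alphaW H t i * c :=
        Finset.sum_le_sum fun i hi => mul_le_mul_of_nonneg_left (hF i hi) (alphaW_nonneg H t i)
    _ = c := by rw [← Finset.sum_mul, sum_alphaW, one_mul]

theorem ownValue_le (j : Fin m) (n h k : ℕ) (s : Fin S) : ownValue G H alg R j n h k s ≤ n := by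
  induction n generalizing h k s with
  | zero => simp [ownValue]
  | succ n ih =>
    unfold ownValue
    refine sum_alphaW_mul_le fun i _ => rexp_le_const _ fun a => ?_
    refine (MarkovGame.backup_le j h s (fun s' => ih _ _ s') a).trans_eq ?_
    push_cast
    ring

theorem ownValue_nonneg (j : Fin m) (n h k : ℕ) (s : Fin S) :
    0 ≤ ownValue G H alg R j n h k s := by
  induction n generalizing h k s with
  | zero => simp [ownValue]
  | succ n ih =>
    unfold ownValue
    exact Finset.sum_nonneg fun i _ => mul_nonneg (alphaW_nonneg _ _ _)
      (rexp_nonneg _ fun a => MarkovGame.backup_nonneg j h s (fun s' => ih _ _ s') a)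

/-- Indices only ever move to earlier episodes, so the value at index `k` reads no profile after
`k`. This is the adaptedness behind the upper concentration bound. -/
theorem ownValue_congr (hR : IsRun G H β R st ac nx) (R' : ℕ → Profile S A) (j : Fin m)
    (n h k : ℕ) (hn : h + n ≤ H) (hRR : ∀ k' ≤ k, R k' = R' k') (s : Fin S) :
    ownValue G H alg R j n h k s = ownValue G H alg R' j n h k s := by
  induction n generalizing h k s with
  | zero => simp [ownValue]
  | succ n ih =>
    unfold ownValue
    rw [← hRR k le_rfl]
    refine Finset.sum_congr rfl fun i hi => ?_
    have hle : (if i = 0 then k else (R k j).ep h s i) ≤ k := by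
      split_ifs with h0
      · exact le_rfl
      · exact (hR.ep_spec j (by omega) s k i (by omega)
          (by have := Finset.mem_range.1 hi; omega)).1.le
    generalize (if i = 0 then k else (R k j).ep h s i) = k' at hle ⊢
    unfold jointPolicy
    rw [hRR k' hle]
    have : (fun s' => ownValue G H alg R j n (h + 1) k' s') =
        fun s' => ownValue G H alg R' j n (h + 1) k' s' :=
      funext fun s' => ih (h + 1) k' (by omega) (fun l hl => hRR l (hl.trans hle)) s'
    rw [this]

/-- Without a deviation the past matters only through its length and the current index; the
reduction modulo `K` in `Fin.ofNat` never acts, since recorded episodes precede `k`. -/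
theorem outputValue_eq_ownValue {K : ℕ} [NeZero K] (hR : IsRun G H β R st ac nx) (j : Fin m)
    (n : ℕ) (τ : History S A) (hn : n + τ.length ≤ H) (k : Fin K) (s : Fin S) :
    outputValue G H alg R j (fun _ _ a => a) n τ k s = ownValue G H alg R j n τ.length k s := by
  induction n generalizing τ k s with
  | zero => simp [ownValue, outputValue]
  | succ n ih =>
    unfold outputValue ownValue indexExp
    refine Finset.sum_congr rfl fun i hi => ?_
    have hval : (((if i = 0 then k else Fin.ofNat K ((R k j).ep τ.length s i)) : Fin K) : ℕ) =
        if i = 0 then (k : ℕ) else (R k j).ep τ.length s i := by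
      split_ifs with h0
      · rfl
      · rw [Fin.val_ofNat, Nat.mod_eq_of_lt]
        exact (hR.ep_spec j (by omega) s k i (by omega)
          (by have := Finset.mem_range.1 hi; omega)).1.trans k.2
    rw [← hval]
    simp only [ih ((s, _) :: τ) (by simp; omega), List.length_cons]

end

/-! ### Optimism and propagation of gaps on the good events. -/

/-- The good events of the analysis of player `j`: `e` lists the visits of `s` at step `h`. -/
structure GoodEvents (G : MarkovGame m S A) (H K : ℕ) (alg : ∀ j, BanditAlg (A j))
    (R : ℕ → Profile S A) (ac : ℕ → ℕ → JointAction A) (nx : ℕ → ℕ → Fin S)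
    (ρ w : ℕ → ℝ) (j : Fin m) : Prop where
  regret : ∀ h < H, ∀ s, ∀ t ∈ Finset.Icc 1 ((R K j).N h s), ∀ b : Fin (A j),
    ∑ i ∈ Finset.Icc 1 t, alphaW H t i * rexp (jointPolicy alg R ((R K j).ep h s i) h s)
        (fun a => G.backup j h s ((R ((R K j).ep h s i) j).V (h + 1)) (Function.update a j b)) ≤
      ∑ i ∈ Finset.Icc 1 t, alphaW H t i * rexp (jointPolicy alg R ((R K j).ep h s i) h s)
        (G.backup j h s ((R ((R K j).ep h s i) j).V (h + 1))) + H * ρ t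
  lower : ∀ h < H, ∀ s, ∀ t ∈ Finset.Icc 1 ((R K j).N h s),
    ∑ i ∈ Finset.Icc 1 t, alphaW H t i * rexp (jointPolicy alg R ((R K j).ep h s i) h s)
        (G.backup j h s ((R ((R K j).ep h s i) j).V (h + 1))) ≤
      ∑ i ∈ Finset.Icc 1 t, alphaW H t i * (G.reward j h s (ac ((R K j).ep h s i) h) +
        (R ((R K j).ep h s i) j).V (h + 1) (nx ((R K j).ep h s i) h)) + w t
  upper : ∀ h < H, ∀ s, ∀ t ∈ Finset.Icc 1 ((R K j).N h s),
    ∑ i ∈ Finset.Icc 1 t, alphaW H t i * (G.reward j h s (ac ((R K j).ep h s i) h) +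
        ownValue G H alg R j (H - (h + 1)) (h + 1) ((R K j).ep h s i)
          (nx ((R K j).ep h s i) h)) ≤
      ∑ i ∈ Finset.Icc 1 t, alphaW H t i * rexp (jointPolicy alg R ((R K j).ep h s i) h s)
        (G.backup j h s (ownValue G H alg R j (H - (h + 1)) (h + 1) ((R K j).ep h s i))) + w t

section

variable {G : MarkovGame m S A} {H K : ℕ} {alg : ∀ j, BanditAlg (A j)} {β : Fin m → ℕ → ℝ}
  {R : ℕ → Profile S A} {st : ℕ → ℕ → Fin S} {ac : ℕ → ℕ → JointAction A} {nx : ℕ → ℕ → Fin S}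
  {ρ w : ℕ → ℝ} {j : Fin m}

theorem sum_range_alphaW {t : ℕ} (ht : 1 ≤ t) (F : ℕ → ℝ) :
    ∑ i ∈ Finset.range (t + 1), alphaW H t i * F i =
      ∑ i ∈ Finset.Icc 1 t, alphaW H t i * F i := by
  rw [Finset.range_eq_Ico, Finset.sum_eq_sum_Ico_succ_bot (by omega), alphaW_zero H t ht,
    zero_mul, zero_add]
  rfl

/-- Optimism: a quantity bounded by the averaged backups of `V` up to the bonus is at most `V`. -/
theorem le_V_of_good (hR : IsRun G H β R st ac nx) (hg : GoodEvents G H K alg R ac nx ρ w j)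
    (hβ : ∀ t, 1 ≤ t → t ≤ K → H * ρ t + w t ≤ ∑ i ∈ Finset.Icc 1 t, alphaW H t i * β j i)
    {h : ℕ} (hh : h < H) (s : Fin S) {k : ℕ} (hk : k ≤ K) (X : ℝ) (hX : X ≤ (H : ℝ) - h)
    (hX' : 1 ≤ (R k j).N h s → X ≤ ∑ i ∈ Finset.Icc 1 ((R k j).N h s),
      alphaW H ((R k j).N h s) i * rexp (jointPolicy alg R ((R k j).ep h s i) h s)
        (G.backup j h s ((R ((R k j).ep h s i) j).V (h + 1))) + H * ρ ((R k j).N h s)) :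
    X ≤ (R k j).V h s := by
  rw [hR.V_eq j hh, hR.Vt_eq j hh]
  refine le_min hX ?_
  rcases Nat.eq_zero_or_pos ((R k j).N h s) with h0 | h0
  · simpa [h0, alphaW] using hX
  · have hNK := hR.N_mono j hh s hk
    have h1 := hg.lower h hh s _ (Finset.mem_Icc.2 ⟨h0, hNK⟩)
    have h2 := hβ _ h0 ((hR.N_le j hh s k).trans hk)
    have h3 := hX' h0
    rw [hR.sum_ep_eq j hh s hk fun k' => rexp (jointPolicy alg R k' h s)
        (G.backup j h s ((R k' j).V (h + 1))),
      hR.sum_ep_eq j hh s hk fun k' => G.reward j h s (ac k' h) +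
        (R k' j).V (h + 1) (nx k' h)] at h1
    rw [alphaW_zero H _ h0, zero_mul, zero_add]
    simp only [mul_add (alphaW _ _ _), Finset.sum_add_distrib] at h1 ⊢
    linarith

/-- By backward induction the next own values are below the next estimates, so the averaged backups
compare, and the bonus covers the sampling error. There is no deviation to pay for; `ρ` enters only
through its sign. -/
theorem ownValue_le_V (hR : IsRun G H β R st ac nx) (hg : GoodEvents G H K alg R ac nx ρ w j)
    (hρ : ∀ t, 1 ≤ t → t ≤ K → 0 ≤ ρ t)
    (hβ : ∀ t, 1 ≤ t → t ≤ K → H * ρ t + w t ≤ ∑ i ∈ Finset.Icc 1 t, alphaW H t i * β j i)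
    (n h : ℕ) (hn : h + n = H) (s : Fin S) (k : ℕ) (hk : k ≤ K) :
    ownValue G H alg R j n h k s ≤ (R k j).V h s := by
  induction n generalizing h k s with
  | zero =>
    have : h = H := by omega
    subst this
    simp [ownValue, hR.V_last]
  | succ n ih =>
    have hh : h < H := by omega
    refine le_V_of_good hR hg hβ hh s hk _ ?_ ?_
    · refine (ownValue_le j _ _ _ _).trans_eq ?_
      have : (H : ℝ) = h + (n + 1 : ℕ) := by exact_mod_cast hn.symm
      rw [this]; ring
    · intro h0
      have := mul_nonneg (Nat.cast_nonneg (α := ℝ) H)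
        (hρ _ h0 ((hR.N_le j hh s k).trans hk))
      unfold ownValue
      rw [sum_range_alphaW h0]
      refine le_add_of_le_of_nonneg (Finset.sum_le_sum fun i hi => ?_) this
      have hi' := Finset.mem_Icc.1 hi
      rw [if_neg (by omega)]
      refine mul_le_mul_of_nonneg_left (rexp_mono _ fun a => ?_) (alphaW_nonneg _ _ _)
      refine MarkovGame.backup_mono j h s (fun s' => ih (h + 1) (by omega) s' _ ?_) a
      have := (hR.ep_spec j hh s k i hi'.1 hi'.2).1
      omega

/-- At a fixed past and state the deviation is one action, to which the regret bound applies. The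
later gains are bounded by induction through estimates that do not depend on the past, so
history-dependent deviations cost nothing extra. -/
theorem deviation_le_V [NeZero K] (hR : IsRun G H β R st ac nx)
    (hg : GoodEvents G H K alg R ac nx ρ w j)
    (hβ : ∀ t, 1 ≤ t → t ≤ K → H * ρ t + w t ≤ ∑ i ∈ Finset.Icc 1 t, alphaW H t i * β j i)
    (μ : DetPolicy S A j) (n : ℕ) (τ : History S A) (hn : τ.length + n = H) (s : Fin S)
    (k : Fin K) :
    outputValue G H alg R j (fun τ s a => Function.update a j (μ τ s)) n τ k s ≤
      (R k j).V τ.length s := by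
  induction n generalizing τ k s with
  | zero =>
    have : τ.length = H := by omega
    rw [this, hR.V_last]
    simp [outputValue]
  | succ n ih =>
    have hh : τ.length < H := by omega
    have hk : (k : ℕ) ≤ K := k.2.le
    have hnH : (H : ℝ) = τ.length + (n + 1 : ℕ) := by exact_mod_cast hn.symm
    refine le_V_of_good hR hg hβ hh s hk _ ?_ ?_
    · unfold outputValue indexExp
      refine sum_alphaW_mul_le fun i _ => rexp_le_const _ fun a => ?_
      refine (MarkovGame.backup_le (c := (n : ℝ)) j _ s (fun s' => ?_) _).trans_eq ?_
      · refine (ih ((s, _) :: τ) (by simp; omega) s' _).trans ?_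
        refine (hR.V_le j (by simp; omega) s' _).trans_eq ?_
        rw [hnH]; push_cast [List.length_cons]; ring
      · rw [hnH]; push_cast; ring
    · intro h0
      have hNK := hR.N_mono j hh s hk
      have h1 := hg.regret _ hh s _ (Finset.mem_Icc.2 ⟨h0, hNK⟩) (μ τ s)
      rw [hR.sum_ep_eq j hh s hk fun k' => rexp (jointPolicy alg R k' τ.length s)
          (fun a => G.backup j τ.length s ((R k' j).V (τ.length + 1))
            (Function.update a j (μ τ s))),
        hR.sum_ep_eq j hh s hk fun k' => rexp (jointPolicy alg R k' τ.length s)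
          (G.backup j τ.length s ((R k' j).V (τ.length + 1)))] at h1
      refine le_trans ?_ h1
      unfold outputValue indexExp
      rw [sum_range_alphaW h0]
      refine Finset.sum_le_sum fun i hi => ?_
      have hi' := Finset.mem_Icc.1 hi
      rw [if_neg (by omega)]
      have hlt := (hR.ep_spec j hh s k i hi'.1 hi'.2).1
      have hval : ((Fin.ofNat K ((R k j).ep τ.length s i) : Fin K) : ℕ) =
          (R k j).ep τ.length s i := by
        rw [Fin.val_ofNat, Nat.mod_eq_of_lt (hlt.trans k.2)]
      refine mul_le_mul_of_nonneg_left ?_ (alphaW_nonneg _ _ _)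
      generalize (Fin.ofNat K ((R k j).ep τ.length s i) : Fin K) = q at hval ⊢
      rw [← hval]
      refine rexp_mono _ fun a => MarkovGame.backup_mono (G := G) j _ s (fun s' => ?_) _
      exact ih ((s, _) :: τ) (by simp; omega) s' _

/-- Exchange of summation for the propagated gaps. -/
theorem sum_propagated_le (hH : 1 ≤ H) (M : ℕ) (F b d : ℕ → ℝ) (c : ℝ)
    (hc : 0 ≤ c) (hb : ∀ t ∈ Finset.Icc 1 M, 0 ≤ b t) (hd : ∀ i ∈ Finset.Icc 1 M, 0 ≤ d i)
    (h0 : F 0 ≤ c)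
    (hF : ∀ t, 1 ≤ t → t + 1 ≤ M → F t ≤ b t + ∑ i ∈ Finset.Icc 1 t, alphaW H t i * d i) :
    ∑ i ∈ Finset.Icc 1 M, F (i - 1) ≤
      c + ∑ t ∈ Finset.Icc 1 M, b t + (1 + 1 / (H : ℝ)) * ∑ i ∈ Finset.Icc 1 M, d i := by
  have hterm : ∀ t ∈ Finset.Icc 1 M,
      0 ≤ b t + ∑ i ∈ Finset.Icc 1 t, alphaW H t i * d i := by
    intro t ht
    refine add_nonneg (hb t ht) (Finset.sum_nonneg fun i hi => mul_nonneg (alphaW_nonneg _ _ _)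
      (hd i ?_))
    simp only [Finset.mem_Icc] at ht hi ⊢
    omega
  -- The `i`-th visit uses an average over `i - 1` visits: the term `F 0` is isolated, and the
  -- nonnegative bound for `t = M` is added to keep the range `1, …, M`.
  have h1 : ∑ i ∈ Finset.Icc 1 M, F (i - 1) ≤
      c + ∑ t ∈ Finset.Icc 1 M, (b t + ∑ i ∈ Finset.Icc 1 t, alphaW H t i * d i) := by
    rcases M with _ | M
    · simpa using hc
    · have e : ∑ i ∈ Finset.Icc 1 (M + 1), F (i - 1) = F 0 + ∑ t ∈ Finset.Icc 1 M, F t := by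
        clear hb hd hF hterm
        induction M with
        | zero => simp
        | succ M ih =>
          rw [Finset.sum_Icc_succ_top (by omega), ih, Finset.sum_Icc_succ_top (by omega)]
          simp [add_assoc]
      rw [e, Finset.sum_Icc_succ_top (by omega)]
      have := hterm (M + 1) (by simp)
      have h2 : ∑ t ∈ Finset.Icc 1 M, F t ≤
          ∑ t ∈ Finset.Icc 1 M, (b t + ∑ i ∈ Finset.Icc 1 t, alphaW H t i * d i) :=
        Finset.sum_le_sum fun t ht => by
          have ht := Finset.mem_Icc.1 ht
          exact hF t ht.1 (by omega)
      linarith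
  refine h1.trans ?_
  rw [Finset.sum_add_distrib, add_assoc]
  refine add_le_add le_rfl (add_le_add le_rfl ?_)
  -- After the exchange, `d i` is multiplied by `∑_{t ≥ i} α_t^i`.
  rw [Finset.sum_comm' (t' := Finset.Icc 1 M) (s' := fun i => Finset.Icc i M)
    (by intro x y; simp only [Finset.mem_Icc]; omega), Finset.mul_sum]
  refine Finset.sum_le_sum fun i hi => ?_
  rw [← Finset.sum_mul]
  exact mul_le_mul_of_nonneg_right (sum_alphaW_index_le H i M hH (Finset.mem_Icc.1 hi).1) (hd i hi)

/-- The sum over all episodes of the gap between the upper estimate and the true value. -/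
theorem sum_gap_le (hR : IsRun G H β R st ac nx) (hg : GoodEvents G H K alg R ac nx ρ w j)
    (hρ : ∀ t, 1 ≤ t → t ≤ K → 0 ≤ ρ t) (hw : ∀ t, 1 ≤ t → t ≤ K → 0 ≤ w t)
    (hβ : ∀ t, 1 ≤ t → t ≤ K → H * ρ t + w t ≤ ∑ i ∈ Finset.Icc 1 t, alphaW H t i * β j i)
    (B : ℝ) (hB : ∀ M : Fin S → ℕ, ∑ s, M s = K → S * H + ∑ s, ∑ t ∈ Finset.Icc 1 (M s),
      2 * ∑ i ∈ Finset.Icc 1 t, alphaW H t i * β j i ≤ B)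
    (n h : ℕ) (hn : h + n = H) (hB0 : 0 ≤ B) :
    ∑ k ∈ Finset.range K, ((R k j).V h (st k h) - ownValue G H alg R j n h k (st k h)) ≤
      n * (1 + 1 / (H : ℝ)) ^ n * B := by
  induction n generalizing h with
  | zero =>
    have : h = H := by omega
    subst this
    simp [ownValue, hR.V_last]
  | succ n ih =>
    have hh : h < H := by omega
    have hnH : (H : ℝ) = h + (n + 1 : ℕ) := by exact_mod_cast hn.symm
    have hnsub : H - (h + 1) = n := by omega
    -- One averaged bonus is contained in the estimate; the second dominates the sampling error `w
    -- t` of the own value.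
    set b : ℕ → ℝ := fun t => 2 * ∑ i ∈ Finset.Icc 1 t, alphaW H t i * β j i with hb
    set d : ℕ → ℝ := fun k =>
      (R k j).V (h + 1) (nx k h) - ownValue G H alg R j n (h + 1) k (nx k h) with hd
    have hd0 : ∀ k ≤ K, 0 ≤ d k := fun k hk => sub_nonneg.2
      (ownValue_le_V hR hg hρ hβ n (h + 1) (by omega) _ k hk)
    have hstep : ∀ s, ∑ i ∈ Finset.Icc 1 ((R K j).N h s),
        ((R ((R K j).ep h s i) j).V h s - ownValue G H alg R j (n + 1) h ((R K j).ep h s i) s) ≤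
        H + ∑ t ∈ Finset.Icc 1 ((R K j).N h s), b t +
          (1 + 1 / (H : ℝ)) * ∑ i ∈ Finset.Icc 1 ((R K j).N h s), d ((R K j).ep h s i) := by
      intro s
      have hNK := hR.N_le j hh s K
      have := sum_propagated_le (H := H) (by omega) ((R K j).N h s)
        (fun t => (R ((R K j).ep h s (t + 1)) j).V h s -
          ownValue G H alg R j (n + 1) h ((R K j).ep h s (t + 1)) s)
        b (fun i => d ((R K j).ep h s i)) H (Nat.cast_nonneg H) ?_ ?_ ?_ ?_
      · refine le_trans (le_of_eq (Finset.sum_congr rfl fun i hi => ?_)) this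
        rw [Nat.sub_add_cancel (Finset.mem_Icc.1 hi).1]
      · intro t ht
        have ht := Finset.mem_Icc.1 ht
        have h1 := hβ t ht.1 (by omega)
        have h2 := mul_nonneg (Nat.cast_nonneg (α := ℝ) H) (hρ t ht.1 (by omega))
        have h3 := hw t ht.1 (by omega)
        simp only [hb]
        linarith
      · intro i hi
        have hi := Finset.mem_Icc.1 hi
        exact hd0 _ (hR.ep_spec j hh s K i hi.1 hi.2).1.le
      -- With no earlier visit to average, the gap is bounded by the horizon. Over all states this
      -- is the term `S * H` in the hypothesis on `B`.
      · have h1 := hR.V_le j hh.le s ((R K j).ep h s (0 + 1))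
        have h2 : 0 ≤ ownValue G H alg R j (n + 1) h ((R K j).ep h s (0 + 1)) s :=
          ownValue_nonneg _ _ _ _ _
        have h3 : (0 : ℝ) ≤ h := Nat.cast_nonneg h
        linarith
      · intro t ht1 htop
        have ht : 1 ≤ t ∧ t ≤ (R K j).N h s := ⟨ht1, by omega⟩
        -- During visit number `t + 1` the counter is `t`, so estimate and own value both average
        -- exactly the first `t` visits.
        obtain ⟨hk, hs, hN⟩ := hR.ep_spec j hh s K (t + 1) (by omega) htop
        set k := (R K j).ep h s (t + 1)
        have hN' : (R k j).N h s = t := by rw [hN]; rfl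
        have e : ∀ i ∈ Finset.Icc 1 t, (R k j).ep h s i = (R K j).ep h s i :=
          fun i hi => (hR.ep_eq j hh s hk.le (by rw [hN']; exact (Finset.mem_Icc.1 hi).2)).symm
        have hV : (R k j).V h s ≤ ∑ i ∈ Finset.Icc 1 t, alphaW H t i *
            (G.reward j h s (ac ((R K j).ep h s i) h) +
              (R ((R K j).ep h s i) j).V (h + 1) (nx ((R K j).ep h s i) h) + β j i) := by
          rw [hR.V_eq j hh, hR.Vt_eq j hh, hN', alphaW_zero H t ht.1, zero_mul, zero_add]
          refine (min_le_right _ _).trans (le_of_eq (Finset.sum_congr rfl fun i hi => ?_))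
          rw [e i hi]
        have hown : ownValue G H alg R j (n + 1) h k s = ∑ i ∈ Finset.Icc 1 t, alphaW H t i *
            rexp (jointPolicy alg R ((R K j).ep h s i) h s) (G.backup j h s
              (ownValue G H alg R j n (h + 1) ((R K j).ep h s i))) := by
          unfold ownValue
          rw [hN', sum_range_alphaW ht.1]
          refine Finset.sum_congr rfl fun i hi => ?_
          have := (Finset.mem_Icc.1 hi).1
          rw [if_neg (by omega), e i hi]
        have h1 := hg.upper h hh s t (Finset.mem_Icc.2 ht)
        rw [hnsub] at h1
        have h2 := hβ t ht.1 (by omega)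
        have h3 := mul_nonneg (Nat.cast_nonneg (α := ℝ) H) (hρ t ht.1 (by omega))
        simp only [hb, hd]
        simp only [mul_add (alphaW _ _ _), mul_sub (alphaW _ _ _), Finset.sum_add_distrib,
          Finset.sum_sub_distrib] at hV h1 ⊢
        linarith
    have hreg := hR.sum_episodes j hh K (fun s _ k =>
      (R k j).V h s - ownValue G H alg R j (n + 1) h k s)
    have hregd := hR.sum_episodes j hh K (fun _ _ k => d k)
    have hnext : ∑ k ∈ Finset.range K, d k ≤ n * (1 + 1 / (H : ℝ)) ^ n * B := by
      refine le_trans (le_of_eq ?_) (ih (h + 1) (by omega))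
      refine Finset.sum_congr rfl fun k _ => ?_
      rcases Nat.lt_or_ge (h + 1) H with hlt | hge
      · rw [hR.st_succ k h hlt]
      -- After the last step there is no next visited state, but estimate and value both vanish
      -- there.
      · have : n = 0 := by omega
        have hH1 : h + 1 = H := by omega
        subst this
        simp [hd, ownValue, hH1, hR.V_last]
    rw [hreg]
    have h1 : (1 : ℝ) ≤ 1 + 1 / (H : ℝ) := by
      have : (0 : ℝ) ≤ 1 / (H : ℝ) := by positivity
      linarith
    calc _ ≤ ∑ s, (H + ∑ t ∈ Finset.Icc 1 ((R K j).N h s), b t +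
          (1 + 1 / (H : ℝ)) * ∑ i ∈ Finset.Icc 1 ((R K j).N h s), d ((R K j).ep h s i)) :=
          Finset.sum_le_sum fun s _ => hstep s
      _ = (S * H + ∑ s, ∑ t ∈ Finset.Icc 1 ((R K j).N h s), b t) +
          (1 + 1 / (H : ℝ)) * ∑ k ∈ Finset.range K, d k := by
          rw [hregd, Finset.sum_add_distrib, Finset.sum_add_distrib, Finset.mul_sum]
          simp
      _ ≤ B + (1 + 1 / (H : ℝ)) * (n * (1 + 1 / (H : ℝ)) ^ n * B) :=
          add_le_add (hB _ (hR.sum_N j hh K)) (mul_le_mul_of_nonneg_left hnext (by linarith))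
      -- Inflating the fresh error `B` to the common factor lets the two terms add up to `n + 1`
      -- copies.
      _ ≤ (1 + 1 / (H : ℝ)) ^ (n + 1) * B +
          (1 + 1 / (H : ℝ)) * (n * (1 + 1 / (H : ℝ)) ^ n * B) := by
          have := mul_le_mul_of_nonneg_right (one_le_pow₀ (n := n + 1) h1) hB0
          linarith
      _ = _ := by push_cast; ring

theorem one_add_inv_pow_le (H : ℕ) (hH : 1 ≤ H) : (1 + 1 / (H : ℝ)) ^ H ≤ 3 := by
  have hH' : (H : ℝ) ≠ 0 := by positivity
  calc (1 + 1 / (H : ℝ)) ^ H ≤ Real.exp (1 / H) ^ H :=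
        pow_le_pow_left₀ (by positivity) (by linarith [Real.add_one_le_exp (1 / (H : ℝ))]) H
    _ = Real.exp 1 := by rw [← Real.exp_nat_mul]; congr 1; field_simp
    _ ≤ 3 := by linarith [Real.exp_one_lt_d9]

/-- On the good events the output policy is nearly unimprovable for player `j`. -/
theorem bestResponseValue_sub_value_le [NeZero H] [NeZero K] (hR : IsRun G H β R st ac nx)
    (hg : GoodEvents G H K alg R ac nx ρ w j)
    (hρ : ∀ t, 1 ≤ t → t ≤ K → 0 ≤ ρ t) (hw : ∀ t, 1 ≤ t → t ≤ K → 0 ≤ w t)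
    (hβ : ∀ t, 1 ≤ t → t ≤ K → H * ρ t + w t ≤ ∑ i ∈ Finset.Icc 1 t, alphaW H t i * β j i)
    (B : ℝ) (hB : ∀ M : Fin S → ℕ, ∑ s, M s = K → S * H + ∑ s, ∑ t ∈ Finset.Icc 1 (M s),
      2 * ∑ i ∈ Finset.Icc 1 t, alphaW H t i * β j i ≤ B) (hB0 : 0 ≤ B) :
    G.bestResponseValue H (seedLaw H K alg R).toMeasure
        (fun i (ω : Seed S H K A) => outputPolicy R i ω) j -
      G.value H (seedLaw H K alg R).toMeasure
        (fun i (ω : Seed S H K A) => outputPolicy R i ω) j ≤ 3 * H / K * B := by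
  have hH : 1 ≤ H := NeZero.one_le
  have hN : ∀ k < K, ∀ i j, ∀ h < H, ∀ s, (R k i).N h s = (R k j).N h s :=
    fun k _ i j h hh s => hR.N_eq i j hh s k
  have hep : ∀ k < K, ∀ i j, ∀ h < H, ∀ s l, (R k i).ep h s l = (R k j).ep h s l :=
    fun k _ i j h hh s l => by rw [hR.ep_eq_ep i j hh s k]
  have hK : ∀ k < K, ∀ j, ∀ h < H, ∀ s, (R k j).N h s < K :=
    fun k hk j h hh s => (hR.N_le j hh s k).trans_lt hk
  have hβ0 : ∀ t, 1 ≤ t → t ≤ K → 0 ≤ ∑ i ∈ Finset.Icc 1 t, alphaW H t i * β j i := by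
    intro t h1 h2
    have := mul_nonneg (Nat.cast_nonneg (α := ℝ) H) (hρ t h1 h2)
    linarith [hβ t h1 h2, hw t h1 h2]
  have hKpos : (0 : ℝ) < K := by exact_mod_cast NeZero.pos K
  have hbest := bestResponseValue_outputPolicy_le G alg R hN hep hK j
    (1 / (K : ℝ) * ∑ k ∈ Finset.range K, (R k j).V 0 G.s₁)
    (mul_nonneg (by positivity) (Finset.sum_nonneg fun k hk =>
      hR.V_nonneg j K hβ0 (Nat.zero_le _) _ k (Finset.mem_range.1 hk).le))
    (fun μ => by
      refine mul_le_mul_of_nonneg_left ?_ (by positivity)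
      rw [← Fin.sum_univ_eq_sum_range (fun k => (R k j).V 0 G.s₁)]
      exact Finset.sum_le_sum fun k _ => deviation_le_V hR hg hβ μ H [] (by simp) G.s₁ k)
  have hval : G.value H (seedLaw H K alg R).toMeasure
      (fun i (ω : Seed S H K A) => outputPolicy R i ω) j =
      1 / (K : ℝ) * ∑ k ∈ Finset.range K, ownValue G H alg R j H 0 k G.s₁ := by
    rw [value_outputPolicy G alg R hN hep hK j,
      ← Fin.sum_univ_eq_sum_range (fun k => ownValue G H alg R j H 0 k G.s₁)]
    congr 1
    exact Finset.sum_congr rfl fun k _ => outputValue_eq_ownValue hR j H [] (by simp) k G.s₁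
  have hgap := sum_gap_le hR hg hρ hw hβ B hB H 0 (by omega) hB0
  simp only [hR.st_zero, Finset.sum_sub_distrib] at hgap
  rw [hval]
  calc _ ≤ 1 / (K : ℝ) * ∑ k ∈ Finset.range K, (R k j).V 0 G.s₁ -
        1 / (K : ℝ) * ∑ k ∈ Finset.range K, ownValue G H alg R j H 0 k G.s₁ := by linarith
    _ ≤ 1 / (K : ℝ) * (H * (1 + 1 / (H : ℝ)) ^ H * B) := by
        rw [← mul_sub]; exact mul_le_mul_of_nonneg_left hgap (by positivity)
    _ ≤ 1 / (K : ℝ) * (H * 3 * B) := by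
        have := one_add_inv_pow_le H hH
        gcongr
    _ = 3 * H / K * B := by ring

end

end Run

theorem mul_add_mod_of_lt {k H h : ℕ} (hh : h < H) : (k * H + h) % H = h := by
  rw [Nat.mul_comm, Nat.mul_add_mod, Nat.mod_eq_of_lt hh]

/-! ### The law of the trajectories of training -/

section Path

variable {m S : ℕ} {A : Fin m → ℕ} [∀ j, NeZero (A j)]

/-- Joint actions and drawn successor states; step `h` of episode `k` is at time `k * H + h`. -/
abbrev Path (S : ℕ) {m : ℕ} (A : Fin m → ℕ) : Type := ℕ → JointAction A × Fin S

/-- The state visited at time `n`. -/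
def pathState (G : MarkovGame m S A) (H : ℕ) (ω : Path S A) (n : ℕ) : Fin S :=
  if n % H = 0 then G.s₁ else (ω (n - 1)).2

/-- The states of the agents at time `n`. -/
def pathProfile (G : MarkovGame m S A) (H : ℕ) (β : Fin m → ℕ → ℝ) (ω : Path S A) :
    ℕ → Profile S A
  | 0 => fun j => AgentState.initial H S (A j)
  | n + 1 => fun j => (pathProfile G H β ω n j).step H (β j) (n / H) (n % H) (pathState G H ω n)
      ((ω n).1 j) (G.reward j (n % H) (pathState G H ω n) (ω n).1) (ω n).2

/-- The law of the successor when all agents sample their actions from `p`. -/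
def MarkovGame.moveLaw (G : MarkovGame m S A) (h : ℕ) (s : Fin S) (p : PMF (JointAction A)) :
    PMF (JointAction A × Fin S) :=
  p.bind fun a => (G.trans h s a).map fun s' => (a, s')

/-- The law of the entry at time `n` of a path. -/
def pathStep (G : MarkovGame m S A) (H : ℕ) (alg : ∀ j, BanditAlg (A j)) (β : Fin m → ℕ → ℝ)
    (n : ℕ) (ω : Path S A) : PMF (JointAction A × Fin S) :=
  G.moveLaw (n % H) (pathState G H ω n)
    (pmfPi fun j => (pathProfile G H β ω n j).policy (alg j) (n % H) (pathState G H ω n))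

/-- The law of a path after `r` more entries are drawn from time `n` on. -/
def pathFrom (G : MarkovGame m S A) (H : ℕ) (alg : ∀ j, BanditAlg (A j)) (β : Fin m → ℕ → ℝ) :
    ℕ → ℕ → Path S A → PMF (Path S A)
  | 0, _, ω => PMF.pure ω
  | r + 1, n, ω => (pathStep G H alg β n ω).bind fun x =>
      pathFrom G H alg β r (n + 1) (Function.update ω n x)

variable {G : MarkovGame m S A} {H : ℕ} {alg : ∀ j, BanditAlg (A j)} {β : Fin m → ℕ → ℝ}

theorem pathState_congr {ω ω' : Path S A} {n : ℕ} (h : ∀ l < n, ω l = ω' l) :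
    pathState G H ω n = pathState G H ω' n := by
  unfold pathState
  split_ifs with hn
  · rfl
  · have : n ≠ 0 := by rintro rfl; simp at hn
    rw [h _ (by omega)]

theorem pathProfile_congr {ω ω' : Path S A} {n : ℕ} (h : ∀ l < n, ω l = ω' l) :
    pathProfile G H β ω n = pathProfile G H β ω' n := by
  induction n with
  | zero => rfl
  | succ n ih =>
    simp only [pathProfile]
    rw [ih fun l hl => h l (by omega), pathState_congr (n := n) fun l hl => h l (by omega),
      h n (by omega)]

theorem update_of_lt (ω : Path S A) (n : ℕ) (x : JointAction A × Fin S) :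
    ∀ l < n, Function.update ω n x l = ω l :=
  fun l hl => Function.update_of_ne (by omega) _ _

theorem pathState_update (ω : Path S A) {n n' : ℕ} (h : n' ≤ n) (x : JointAction A × Fin S) :
    pathState G H (Function.update ω n x) n' = pathState G H ω n' :=
  pathState_congr fun l hl => update_of_lt ω n x l (by omega)

theorem pathProfile_update (ω : Path S A) {n n' : ℕ} (h : n' ≤ n) (x : JointAction A × Fin S) :
    pathProfile G H β (Function.update ω n x) n' = pathProfile G H β ω n' :=
  pathProfile_congr fun l hl => update_of_lt ω n x l (by omega)

theorem pathFrom_add (r r' n : ℕ) (ω : Path S A) :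
    pathFrom G H alg β (r + r') n ω =
      (pathFrom G H alg β r n ω).bind (pathFrom G H alg β r' (n + r)) := by
  induction r generalizing n ω with
  | zero => simp [pathFrom, PMF.pure_bind]
  | succ r ih =>
    rw [Nat.succ_add]
    simp only [pathFrom, PMF.bind_bind, ih]
    congr 1
    funext x
    rw [show n + 1 + r = n + (r + 1) by ring]

theorem eq_of_mem_support_pathFrom {r n : ℕ} {ω ω' : Path S A}
    (h : ω' ∈ (pathFrom G H alg β r n ω).support) : ∀ l < n, ω' l = ω l := by
  induction r generalizing n ω with
  | zero =>
    rw [pathFrom, PMF.mem_support_pure_iff] at h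
    subst h
    exact fun _ _ => rfl
  | succ r ih =>
    rw [pathFrom, PMF.mem_support_bind_iff] at h
    obtain ⟨x, -, hx⟩ := h
    intro l hl
    rw [ih hx l (by omega), update_of_lt ω n x l hl]

/-- Backward induction for a process that decreases in conditional expectation. -/
theorem pexp_pathFrom_le (Z : ℕ → Path S A → ℝ≥0∞) (N : ℕ)
    (hZ : ∀ n < N, ∀ ω, pexp (pathStep G H alg β n ω)
      (fun x => Z (n + 1) (Function.update ω n x)) ≤ Z n ω)
    (r n : ℕ) (hn : n + r = N) (ω : Path S A) :
    pexp (pathFrom G H alg β r n ω) (Z N) ≤ Z n ω := by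
  induction r generalizing n ω with
  | zero =>
    subst hn
    simp [pathFrom, pexp_pure]
  | succ r ih =>
    rw [pathFrom, pexp_bind]
    exact le_trans (pexp_mono _ fun x => ih (n + 1) (by omega) _) (hZ n (by omega) ω)

/-! #### Training follows the path law -/

/-- The state is compared with the path only if steps remain: at the end of an episode the path
restarts at the initial state, while the recursion of `episodeLaw` still carries the last successor.
-/
theorem episodeLaw_eq_map (k n h : ℕ) (hn : h + n = H) (s : Fin S) (ω : Path S A)
    (hs : n ≠ 0 → s = pathState G H ω (k * H + h)) :
    episodeLaw G H alg β k n h s (pathProfile G H β ω (k * H + h)) =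
      (pathFrom G H alg β n (k * H + h) ω).map fun ω' => pathProfile G H β ω' ((k + 1) * H) := by
  induction n generalizing h s ω with
  | zero =>
    have : (k + 1) * H = k * H + h := by rw [Nat.add_mul]; omega
    rw [this]
    simp [episodeLaw, pathFrom, PMF.pure_map]
  | succ n ih =>
    have hlt : h < H := by omega
    have hmod : (k * H + h) % H = h := by
      exact mul_add_mod_of_lt hlt
    have hdiv : (k * H + h) / H = k := by
      rw [Nat.mul_comm, Nat.mul_add_div (by omega), Nat.div_eq_of_lt hlt, add_zero]
    rw [hs (by omega)]
    simp only [episodeLaw, pathFrom, pathStep, MarkovGame.moveLaw, PMF.map_bind, PMF.bind_bind,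
      PMF.bind_map]
    rw [hmod]
    congr 1
    funext a
    congr 1
    funext s'
    simp only [Function.comp]
    set ω' := Function.update ω (k * H + h) (a, s') with hω'
    have h1 := ih (h + 1) (by omega) s' ω' (fun hn0 => by
      have : (k * H + (h + 1)) % H = h + 1 := mul_add_mod_of_lt (by omega)
      simp [pathState, this, hω'])
    rw [← add_assoc] at h1
    rw [← h1]
    congr 1
    simp only [pathProfile, hmod, hdiv]
    rw [hω', pathProfile_update ω le_rfl, pathState_update ω le_rfl]
    simp

/-- The record of the first `K` episodes. -/
def pathRecord (G : MarkovGame m S A) (H K : ℕ) (β : Fin m → ℕ → ℝ) (ω : Path S A) (k : ℕ) :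
    Profile S A :=
  pathProfile G H β ω (min k K * H)

/-- The initial path is irrelevant, since every entry that the record reads is overwritten before it
is used. -/
theorem trainLaw_eq_map (K : ℕ) (ω : Path S A) :
    trainLaw G H alg β K = (pathFrom G H alg β (K * H) 0 ω).map (pathRecord G H K β) := by
  induction K with
  | zero =>
    simp only [trainLaw, Nat.zero_mul, pathFrom, PMF.pure_map]
    congr 1
    funext k
    simp [pathRecord, pathProfile]
  | succ K ih =>
    rw [trainLaw, ih, Nat.add_mul, one_mul, pathFrom_add, PMF.bind_map, PMF.map_bind, zero_add]
    have key : ∀ ω₁, ((fun R => (episodeLaw G H alg β K H 0 G.s₁ (R K)).map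
        fun σ k => if k ≤ K then R k else σ) ∘ pathRecord G H K β) ω₁ =
        (pathFrom G H alg β H (K * H) ω₁).map (pathRecord G H (K + 1) β) := by
      intro ω₁
      have h1 := episodeLaw_eq_map (G := G) (H := H) (alg := alg) (β := β) K H 0 (by omega) G.s₁ ω₁
        (fun _ => by simp [pathState])
      have h2 : pathRecord G H K β ω₁ K = pathProfile G H β ω₁ (K * H + 0) := by
        simp [pathRecord]
      simp only [Function.comp]
      rw [h2, h1, PMF.map_comp, add_zero]
      rw [← PMF.bind_pure_comp, ← PMF.bind_pure_comp]
      ext y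
      rw [PMF.bind_apply, PMF.bind_apply]
      refine tsum_congr fun ω₂ => ?_
      by_cases h0 : pathFrom G H alg β H (K * H) ω₁ ω₂ = 0
      · simp [h0]
      · congr 2
        have hag := eq_of_mem_support_pathFrom ((PMF.mem_support_iff _ _).2 h0)
        simp only [Function.comp]
        congr 1
        funext k
        unfold pathRecord
        by_cases hk : k ≤ K
        · rw [if_pos hk, min_eq_left hk, min_eq_left (by omega)]
          refine pathProfile_congr fun l hl => (hag l ?_).symm
          exact hl.trans_le (Nat.mul_le_mul_right H hk)
        · rw [if_neg hk, min_eq_right (by omega)]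
    rw [funext key]

/-! #### Paths give runs -/

/-- The entries of an agent's state that belong to one step. -/
def AgentState.row {B : ℕ} (σ : AgentState S B) (h : ℕ) :
    (Fin S → ℝ) × (Fin S → ℝ) × (Fin S → ℕ) × (Fin S → List (Fin B × ℝ)) × (Fin S → ℕ → ℕ) :=
  (σ.V h, σ.Vt h, σ.N h, σ.hist h, σ.ep h)

theorem set2_of_ne {α : Type} (f : ℕ → Fin S → α) {h h' : ℕ} (s : Fin S) (v : α) (hh : h' ≠ h) :
    set2 f h s v h' = f h' := Function.update_of_ne hh _ _

theorem set2_self {α : Type} (f : ℕ → Fin S → α) (h : ℕ) (s s' : Fin S) (v : α) :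
    set2 f h s v h s' = if s' = s then v else f h s' := by
  unfold set2
  rw [Function.update_self, Function.update_apply]

/-- An update at time `n` touches the row of the step `n % H` only. Hence the rows `h` and `h + 1`
in use at step `h` are still those from the beginning of the episode. -/
theorem row_succ_of_ne (ω : Path S A) {n h : ℕ} (hh : h ≠ n % H) (j : Fin m) :
    (pathProfile G H β ω (n + 1) j).row h = (pathProfile G H β ω n j).row h := by
  simp only [pathProfile, AgentState.row, AgentState.step, set2_of_ne _ _ _ hh]

theorem row_of_le (ω : Path S A) (k l h : ℕ) (hl : l ≤ h) (hh : l ≤ H) (j : Fin m) :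
    (pathProfile G H β ω (k * H + l) j).row h = (pathProfile G H β ω (k * H) j).row h := by
  induction l with
  | zero => rfl
  | succ l ih =>
    rw [← add_assoc, row_succ_of_ne, ih (by omega) (by omega)]
    rw [mul_add_mod_of_lt (by omega)]
    omega

theorem row_of_lt (ω : Path S A) (k l h : ℕ) (hl : h < l) (hh : l ≤ H) (j : Fin m) :
    (pathProfile G H β ω (k * H + l) j).row h =
      (pathProfile G H β ω (k * H + h + 1) j).row h := by
  induction l, hl using Nat.le_induction with
  | base => rfl
  | succ l hl ih =>
    rw [← add_assoc, row_succ_of_ne, ih (by omega)]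
    rw [mul_add_mod_of_lt (by omega)]
    omega

theorem row_last (ω : Path S A) (hH : 0 < H) (n : ℕ) (j : Fin m) :
    (pathProfile G H β ω n j).row H = (AgentState.initial H S (A j)).row H := by
  induction n with
  | zero => rfl
  | succ n ih => rw [row_succ_of_ne _ (Nat.mod_lt n hH).ne', ih]

theorem AgentState.V_eq_of_row {B : ℕ} {σ σ' : AgentState S B} {h : ℕ} (e : σ.row h = σ'.row h) :
    σ.V h = σ'.V h := congrArg (fun x => x.1) e

theorem AgentState.Vt_eq_of_row {B : ℕ} {σ σ' : AgentState S B} {h : ℕ} (e : σ.row h = σ'.row h) :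
    σ.Vt h = σ'.Vt h := congrArg (fun x => x.2.1) e

theorem AgentState.N_eq_of_row {B : ℕ} {σ σ' : AgentState S B} {h : ℕ} (e : σ.row h = σ'.row h) :
    σ.N h = σ'.N h := congrArg (fun x => x.2.2.1) e

theorem AgentState.hist_eq_of_row {B : ℕ} {σ σ' : AgentState S B} {h : ℕ}
    (e : σ.row h = σ'.row h) : σ.hist h = σ'.hist h := congrArg (fun x => x.2.2.2.1) e

theorem AgentState.ep_eq_of_row {B : ℕ} {σ σ' : AgentState S B} {h : ℕ} (e : σ.row h = σ'.row h) :
    σ.ep h = σ'.ep h := congrArg (fun x => x.2.2.2.2) e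

/-- The profiles at the beginning of the episodes of a path. -/
def pathEpisode (G : MarkovGame m S A) (H : ℕ) (β : Fin m → ℕ → ℝ) (ω : Path S A) (k : ℕ) :
    Profile S A :=
  pathProfile G H β ω (k * H)

theorem row_pathEpisode_succ (ω : Path S A) (k h : ℕ) (hh : h < H) (j : Fin m) :
    (pathEpisode G H β ω (k + 1) j).row h =
      ((pathProfile G H β ω (k * H + h) j).step H (β j) k h (pathState G H ω (k * H + h))
        ((ω (k * H + h)).1 j)
        (G.reward j h (pathState G H ω (k * H + h)) (ω (k * H + h)).1) (ω (k * H + h)).2).row h := by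
  have hmod : (k * H + h) % H = h := mul_add_mod_of_lt hh
  have hdiv : (k * H + h) / H = k := by
    rw [Nat.mul_comm, Nat.mul_add_div (by omega), Nat.div_eq_of_lt hh, add_zero]
  unfold pathEpisode
  rw [Nat.add_mul, one_mul, row_of_lt ω k H h hh le_rfl]
  simp only [pathProfile, hmod, hdiv]

theorem isRun_path (ω : Path S A) (hH : 0 < H) :
    IsRun G H β (pathEpisode G H β ω) (fun k h => pathState G H ω (k * H + h))
      (fun k h => (ω (k * H + h)).1) (fun k h => (ω (k * H + h)).2) := by
  have hrow : ∀ k h (j : Fin m), h ≤ H →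
      (pathProfile G H β ω (k * H + h) j).row h = (pathEpisode G H β ω k j).row h :=
    fun k h j hh => row_of_le ω k h h le_rfl hh j
  have hrow' : ∀ k h (j : Fin m), h < H →
      (pathProfile G H β ω (k * H + h) j).row (h + 1) = (pathEpisode G H β ω k j).row (h + 1) :=
    fun k h j hh => row_of_le ω k h (h + 1) (by omega) hh.le j
  have hnew : ∀ k h (j : Fin m) s r s', h < H →
      (pathProfile G H β ω (k * H + h) j).newVt H (β j) h s r s' =
        (pathEpisode G H β ω k j).newVt H (β j) h s r s' := by
    intro k h j s r s' hh
    unfold AgentState.newVt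
    rw [AgentState.N_eq_of_row (hrow k h j hh.le), AgentState.Vt_eq_of_row (hrow k h j hh.le),
      AgentState.V_eq_of_row (hrow' k h j hh)]
  constructor
  · intro j
    simp [pathEpisode, pathProfile]
  · intro k
    simp [pathState]
  · intro k h hh
    have : (k * H + (h + 1)) % H = h + 1 := mul_add_mod_of_lt hh
    simp only [pathState, this]
    simp
  · intro k j s
    unfold pathEpisode
    rw [AgentState.V_eq_of_row (row_last ω hH _ j)]
    simp [AgentState.initial]
  · intro k j h s hh
    rw [AgentState.N_eq_of_row (row_pathEpisode_succ ω k h hh j)]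
    simp only [AgentState.step, set2_self]
    rw [AgentState.N_eq_of_row (hrow k h j hh.le)]
    split_ifs with hs
    · rw [hs]
    · rfl
  · intro k j h s hh
    rw [AgentState.ep_eq_of_row (row_pathEpisode_succ ω k h hh j)]
    simp only [AgentState.step, set2_self]
    rw [AgentState.N_eq_of_row (hrow k h j hh.le), AgentState.ep_eq_of_row (hrow k h j hh.le)]
    split_ifs with hs
    · rw [hs]
    · rfl
  · intro k j h s hh
    rw [AgentState.Vt_eq_of_row (row_pathEpisode_succ ω k h hh j)]
    simp only [AgentState.step, set2_self]
    rw [AgentState.Vt_eq_of_row (hrow k h j hh.le)]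
    split_ifs with hs
    · rw [hnew k h j _ _ _ hh, hs]
    · rfl
  · intro k j h s hh
    rw [AgentState.V_eq_of_row (row_pathEpisode_succ ω k h hh j)]
    simp only [AgentState.step, set2_self]
    rw [AgentState.V_eq_of_row (hrow k h j hh.le)]
    split_ifs with hs
    · rw [hnew k h j _ _ _ hh, hs]
    · rfl

/-! #### Good records of paths -/

/-- Sample and output policy index episodes by `Fin K`. So the differing conventions for later
entries in `pathRecord` and `pathEpisode` do not matter. -/
theorem goodRecords_congr {K : ℕ} [NeZero H] [NeZero K] {R R' : ℕ → Profile S A}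
    (h : ∀ k < K, R k = R' k) (ε : ℝ) :
    R ∈ goodRecords G H K alg ε ↔ R' ∈ goodRecords G H K alg ε := by
  have h1 : seedLaw H K alg R = seedLaw H K alg R' := by
    have : ∀ l, stepSeedLaw H K alg R l = stepSeedLaw H K alg R' l := by
      intro l
      unfold stepSeedLaw
      simp only [h _ (Fin.is_lt _)]
    unfold seedLaw
    simp only [this]
  have h2 : ∀ (ω : Seed S H K A) j l k s,
      nextIndex R ω j l k s = nextIndex R' ω j l k s := by
    intro ω j l k s
    unfold nextIndex
    rw [h k k.2]
  have h3 : ∀ (ω : Seed S H K A) j τ, indexAfter R ω j τ = indexAfter R' ω j τ := by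
    intro ω j τ
    induction τ with
    | nil => rfl
    | cons x τ ih => simp only [indexAfter]; rw [ih, h2]
  have h4 : (fun j (ω : Seed S H K A) => outputPolicy R j ω) =
      fun j (ω : Seed S H K A) => outputPolicy R' j ω := by
    funext j ω τ s
    unfold outputPolicy
    rw [h3, h2]
  unfold goodRecords
  rw [Set.mem_ofPred_eq, Set.mem_ofPred_eq, h1, h4]

theorem trainLaw_compl_goodRecords_le {K : ℕ} [NeZero H] [NeZero K] (ω₀ : Path S A) (ε : ℝ) :
    (trainLaw G H alg β K).toOuterMeasure (goodRecords G H K alg ε)ᶜ =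
      (pathFrom G H alg β (K * H) 0 ω₀).toOuterMeasure
        {ω | pathEpisode G H β ω ∉ goodRecords G H K alg ε} := by
  rw [trainLaw_eq_map K ω₀, PMF.toOuterMeasure_map_apply]
  refine congrArg _ (Set.ext fun ω => not_congr (goodRecords_congr (fun k hk => ?_) ε))
  simp [pathRecord, pathEpisode, min_eq_left hk.le]

end Path

/-! ### Visits of a state along a path -/

section Visits

variable {m S : ℕ} {A : Fin m → ℕ} [∀ j, NeZero (A j)]

/-- The state `s` is visited at step `h` at time `n`. -/
def Visits (G : MarkovGame m S A) (H h : ℕ) (s : Fin S) (ω : Path S A) (n : ℕ) : Prop :=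
  n % H = h ∧ pathState G H ω n = s

instance (G : MarkovGame m S A) (H h : ℕ) (s : Fin S) (ω : Path S A) (n : ℕ) :
    Decidable (Visits G H h s ω n) := by unfold Visits; infer_instance

/-- Number of visits before time `n`. -/
def visitCount (G : MarkovGame m S A) (H : ℕ) (β : Fin m → ℕ → ℝ) (j : Fin m) (h : ℕ) (s : Fin S)
    (ω : Path S A) (n : ℕ) : ℕ :=
  (pathProfile G H β ω n j).N h s

/-- Time of the `i`-th visit, as known at time `n`. -/
def visitTime (G : MarkovGame m S A) (H : ℕ) (β : Fin m → ℕ → ℝ) (j : Fin m) (h : ℕ) (s : Fin S)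
    (ω : Path S A) (n i : ℕ) : ℕ :=
  (pathProfile G H β ω n j).ep h s i * H + h

variable {G : MarkovGame m S A} {H : ℕ} {alg : ∀ j, BanditAlg (A j)} {β : Fin m → ℕ → ℝ}
  {j : Fin m} {h : ℕ} {s : Fin S}

theorem visits_congr {ω ω' : Path S A} {n : ℕ} (hω : ∀ l < n, ω l = ω' l) :
    Visits G H h s ω n ↔ Visits G H h s ω' n := by
  unfold Visits; rw [pathState_congr hω]

theorem visitCount_congr {ω ω' : Path S A} {n : ℕ} (hω : ∀ l < n, ω l = ω' l) :
    visitCount G H β j h s ω n = visitCount G H β j h s ω' n := by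
  unfold visitCount; rw [pathProfile_congr hω]

theorem pathStep_congr {ω ω' : Path S A} {n : ℕ} (hω : ∀ l < n, ω l = ω' l) :
    pathStep G H alg β n ω = pathStep G H alg β n ω' := by
  unfold pathStep; rw [pathProfile_congr hω, pathState_congr hω]

theorem set2_apply {α : Type} (f : ℕ → Fin S → α) (h h' : ℕ) (s s' : Fin S) (v : α) :
    set2 f h s v h' s' = if h = h' ∧ s = s' then v else f h' s' := by
  by_cases hh : h' = h
  · subst hh
    rw [set2_self]
    simp [eq_comm]
  · rw [set2_of_ne _ _ _ hh, if_neg fun e => hh e.1.symm]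

theorem visitCount_succ (ω : Path S A) (n : ℕ) :
    visitCount G H β j h s ω (n + 1) =
      if Visits G H h s ω n then visitCount G H β j h s ω n + 1
      else visitCount G H β j h s ω n := by
  unfold visitCount
  by_cases hv : Visits G H h s ω n
  · rw [if_pos hv]
    obtain ⟨rfl, rfl⟩ := hv
    simp [pathProfile, AgentState.step, set2_apply]
  · rw [if_neg hv]
    have hv' : ¬(n % H = h ∧ pathState G H ω n = s) := hv
    simp only [pathProfile, AgentState.step, set2_apply, if_neg hv']

theorem ep_succ (ω : Path S A) (n : ℕ) :
    (pathProfile G H β ω (n + 1) j).ep h s =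
      if Visits G H h s ω n then
        Function.update ((pathProfile G H β ω n j).ep h s) (visitCount G H β j h s ω n + 1) (n / H)
      else (pathProfile G H β ω n j).ep h s := by
  unfold visitCount
  by_cases hv : Visits G H h s ω n
  · rw [if_pos hv]
    obtain ⟨rfl, rfl⟩ := hv
    simp [pathProfile, AgentState.step, set2_apply]
  · rw [if_neg hv]
    have hv' : ¬(n % H = h ∧ pathState G H ω n = s) := hv
    simp only [pathProfile, AgentState.step, set2_apply, if_neg hv']

theorem hist_succ (ω : Path S A) (n : ℕ) :
    (pathProfile G H β ω (n + 1) j).hist h s =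
      if Visits G H h s ω n then
        ((ω n).1 j, ((H : ℝ) - G.reward j (n % H) (pathState G H ω n) (ω n).1 -
          (pathProfile G H β ω n j).V (n % H + 1) (ω n).2) / H) ::
          (pathProfile G H β ω n j).hist h s
      else (pathProfile G H β ω n j).hist h s := by
  by_cases hv : Visits G H h s ω n
  · rw [if_pos hv]
    obtain ⟨rfl, rfl⟩ := hv
    simp [pathProfile, AgentState.step, set2_apply]
  · rw [if_neg hv]
    have hv' : ¬(n % H = h ∧ pathState G H ω n = s) := hv
    simp only [pathProfile, AgentState.step, set2_apply, if_neg hv']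

theorem visitTime_succ_of_le (ω : Path S A) (n i : ℕ) (hi : i ≤ visitCount G H β j h s ω n) :
    visitTime G H β j h s ω (n + 1) i = visitTime G H β j h s ω n i := by
  unfold visitTime
  rw [ep_succ]
  split_ifs
  · rw [Function.update_of_ne (by omega)]
  · rfl

theorem visitTime_succ_self (ω : Path S A) (n : ℕ) (hv : Visits G H h s ω n) :
    visitTime G H β j h s ω (n + 1) (visitCount G H β j h s ω n + 1) = n := by
  unfold visitTime
  rw [ep_succ, if_pos hv, Function.update_self, ← hv.1, Nat.mul_comm]
  exact Nat.div_add_mod n H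

/-- A sum over time, written as a sum over visits. -/
theorem sum_visits (g : ℕ → ℕ → ℝ) (ω : Path S A) (t n : ℕ) :
    ∑ l ∈ Finset.range n, (if Visits G H h s ω l ∧ visitCount G H β j h s ω l < t then
      g (visitCount G H β j h s ω l + 1) l else 0) =
    ∑ i ∈ Finset.Icc 1 (min (visitCount G H β j h s ω n) t),
      g i (visitTime G H β j h s ω n i) := by
  induction n with
  | zero => simp [visitCount, pathProfile, AgentState.initial]
  | succ n ih =>
    rw [Finset.sum_range_succ, ih]
    have hold : ∀ i ∈ Finset.Icc 1 (min (visitCount G H β j h s ω n) t),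
        g i (visitTime G H β j h s ω (n + 1) i) = g i (visitTime G H β j h s ω n i) := by
      intro i hi
      have := (Finset.mem_Icc.1 hi).2
      rw [visitTime_succ_of_le ω n i (by omega)]
    rw [visitCount_succ]
    by_cases hv : Visits G H h s ω n
    · rw [if_pos hv]
      by_cases ht : visitCount G H β j h s ω n < t
      · rw [if_pos ⟨hv, ht⟩, min_eq_left ht.le] at *
        rw [min_eq_left (by omega), Finset.sum_Icc_succ_top (by omega), visitTime_succ_self ω n hv,
          Finset.sum_congr rfl hold]
      · rw [if_neg fun e => ht e.2, add_zero, min_eq_right (by omega)] at *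
        rw [min_eq_right (by omega), Finset.sum_congr rfl hold]
    · rw [if_neg hv, if_neg fun e => hv e.1, add_zero, Finset.sum_congr rfl hold]

/-- The values of `f` at the times of the visits before time `n`. -/
def visitTable (G : MarkovGame m S A) (H : ℕ) (β : Fin m → ℕ → ℝ) (j : Fin m) (h : ℕ) (s : Fin S)
    {B : ℕ} (f : ℕ → Path S A → Fin B → ℝ) (ω : Path S A) : ℕ → ℕ → Fin B → ℝ
  | 0 => fun _ _ => 0
  | n + 1 => if Visits G H h s ω n then
      Function.update (visitTable G H β j h s f ω n) (visitCount G H β j h s ω n + 1) (f n ω)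
    else visitTable G H β j h s f ω n

theorem visitTable_apply {B : ℕ} (f : ℕ → Path S A → Fin B → ℝ) (ω : Path S A) (n i : ℕ)
    (hi : 1 ≤ i) (hin : i ≤ visitCount G H β j h s ω n) :
    visitTable G H β j h s f ω n i = f (visitTime G H β j h s ω n i) ω := by
  induction n with
  | zero => simp [visitCount, pathProfile, AgentState.initial] at hin; omega
  | succ n ih =>
    unfold visitTable
    rw [visitCount_succ] at hin
    split_ifs at hin ⊢ with hv
    · by_cases hi' : i = visitCount G H β j h s ω n + 1
      · rw [hi', Function.update_self, visitTime_succ_self ω n hv]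
      · rw [Function.update_of_ne hi', ih (by omega), visitTime_succ_of_le ω n i (by omega)]
    · rw [ih hin, visitTime_succ_of_le ω n i hin]

theorem visitTable_congr {B : ℕ} {f : ℕ → Path S A → Fin B → ℝ}
    (hf : ∀ n ω ω', (∀ l < n, ω l = ω' l) → f n ω = f n ω')
    {ω ω' : Path S A} {n : ℕ} (hω : ∀ l < n, ω l = ω' l) :
    visitTable G H β j h s f ω n = visitTable G H β j h s f ω' n := by
  induction n with
  | zero => rfl
  | succ n ih =>
    have h' : ∀ l < n, ω l = ω' l := fun l hl => hω l (by omega)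
    unfold visitTable
    rw [ih h', visitCount_congr h', hf n ω ω' h']
    simp only [visits_congr h']

/-! ### Concentration -/

/-- The difference vanishes at `0` and has derivative `-1 + x + e^{-x} ≥ 0`. No upper bound on `z`
is needed, which matters for large loss estimates. -/
theorem exp_neg_le_quadratic {z : ℝ} (hz : 0 ≤ z) : Real.exp (-z) ≤ 1 - z + z ^ 2 / 2 := by
  have hderiv : ∀ x : ℝ, HasDerivAt (fun x => 1 - x + x ^ 2 / 2 - Real.exp (-x))
      (-1 + x + Real.exp (-x)) x := by
    intro x
    have h1 : HasDerivAt (fun x : ℝ => Real.exp (-x)) (-Real.exp (-x)) x := by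
      simpa using (hasDerivAt_neg x).exp
    have h2 : HasDerivAt (fun x : ℝ => 1 - x + x ^ 2 / 2) (-1 + x) x := by
      exact HasDerivAt.congr_deriv
        (((hasDerivAt_id x).const_sub 1).add (((hasDerivAt_id x).pow 2).div_const 2)) (by simp)
    exact HasDerivAt.congr_deriv (h2.sub h1) (by ring)
  have hmono : MonotoneOn (fun x : ℝ => 1 - x + x ^ 2 / 2 - Real.exp (-x)) (Set.Ici 0) := by
    refine monotoneOn_of_deriv_nonneg (convex_Ici 0)
      (fun x _ => (hderiv x).continuousAt.continuousWithinAt)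
      (fun x _ => (hderiv x).differentiableAt.differentiableWithinAt) fun x _ => ?_
    rw [(hderiv x).deriv]
    have := Real.add_one_le_exp (-x)
    linarith
  have := hmono (Set.mem_Ici.2 le_rfl) (Set.mem_Ici.2 hz) hz
  simp at this
  linarith

/-- Only the lower tail of a nonnegative variable is needed, so the quadratic bound on `exp (-z)`
applies with second moment at most `c ^ 2`; then `1 + u ≤ exp u` cancels the centring. -/
theorem rexp_exp_le_one {α : Type*} [Fintype α] (p : PMF α) (f : α → ℝ)
    (hf : ∀ a, f a ∈ Set.Icc (0 : ℝ) 1) {c : ℝ} (hc : 0 ≤ c) :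
    rexp p (fun a => Real.exp (c * (rexp p f - f a) - c ^ 2 / 2)) ≤ 1 := by
  calc rexp p (fun a => Real.exp (c * (rexp p f - f a) - c ^ 2 / 2))
      ≤ rexp p (fun a => Real.exp (c * rexp p f - c ^ 2 / 2) *
          ((1 + c ^ 2 / 2) - c * f a)) := by
        refine rexp_mono p fun a => ?_
        rw [show c * (rexp p f - f a) - c ^ 2 / 2 = (c * rexp p f - c ^ 2 / 2) + -(c * f a) by ring,
          Real.exp_add]
        refine mul_le_mul_of_nonneg_left ?_ (Real.exp_pos _).le
        have h1 := hf a
        refine (exp_neg_le_quadratic (mul_nonneg hc h1.1)).trans ?_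
        have h2 : (c * f a) ^ 2 ≤ c ^ 2 := by
          rw [mul_pow]
          exact mul_le_of_le_one_right (sq_nonneg c) (pow_le_one₀ h1.1 h1.2)
        linarith
    _ = Real.exp (c * rexp p f - c ^ 2 / 2) * ((1 + c ^ 2 / 2) - c * rexp p f) := by
        rw [rexp_const_mul, rexp_sub, rexp_const, rexp_const_mul]
    _ ≤ Real.exp (c * rexp p f - c ^ 2 / 2) * Real.exp (-(c * rexp p f - c ^ 2 / 2)) := by
        refine mul_le_mul_of_nonneg_left ?_ (Real.exp_pos _).le
        have := Real.add_one_le_exp (-(c * rexp p f - c ^ 2 / 2))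
        linarith
    _ = 1 := by rw [← Real.exp_add]; simp

/-- Azuma's inequality for the visits of a state. -/
theorem azuma_visits (hH : 1 ≤ H) (N : ℕ) (f : ℕ → Path S A → JointAction A × Fin S → ℝ)
    (hf : ∀ n ω ω', (∀ l < n, ω l = ω' l) → f n ω = f n ω')
    (hf01 : ∀ n < N, ∀ ω x, f n ω x ∈ Set.Icc (0 : ℝ) 1) (t : ℕ) (ht : 1 ≤ t) (ι : ℝ)
    (hι : 0 ≤ ι) (ω₀ : Path S A) :
    (pathFrom G H alg β N 0 ω₀).toOuterMeasure
      {ω | t ≤ visitCount G H β j h s ω N ∧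
        3 * √(H * ι / t) < ∑ i ∈ Finset.Icc 1 t, alphaW H t i *
          (rexp (pathStep G H alg β (visitTime G H β j h s ω N i) ω)
            (f (visitTime G H β j h s ω N i) ω) -
            f (visitTime G H β j h s ω N i) ω (ω (visitTime G H β j h s ω N i)))} ≤
      ENNReal.ofReal (Real.exp (-2 * ι)) := by
  have hHpos : (0 : ℝ) < H := by exact_mod_cast hH
  have htpos : (0 : ℝ) < t := by exact_mod_cast ht
  set ε := 3 * √(H * ι / t) with hε
  have hε0 : 0 ≤ ε := by positivity
  have hε2 : ε ^ 2 = 9 * (H * ι / t) := by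
    rw [hε, mul_pow, Real.sq_sqrt (by positivity)]; norm_num
  -- This maximizes the exponent `c ε - c² H / t`; the value is `ε² t / (4H) = 9ι/4`, which exceeds
  -- the required `2ι`.
  set c := ε * t / (2 * H) with hc
  have hc0 : 0 ≤ c := by positivity
  set D : ℕ → Path S A → JointAction A × Fin S → ℝ := fun l ω x =>
    rexp (pathStep G H alg β l ω) (f l ω) - f l ω x with hD
  set g : Path S A → ℕ → ℕ → ℝ := fun ω i l =>
    (c * alphaW H t i) * D l ω (ω l) - (c * alphaW H t i) ^ 2 / 2 with hg
  -- Only the first `t` visits contribute. As `t` is fixed, the weight `α_t^i` is known when visit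
  -- `i` occurs, so `exp Y` is a supermartingale.
  set Y : ℕ → Path S A → ℝ := fun n ω => ∑ l ∈ Finset.range n,
    (if Visits G H h s ω l ∧ visitCount G H β j h s ω l < t then
      g ω (visitCount G H β j h s ω l + 1) l else 0) with hY
  have hYupd : ∀ n ω x, Y n (Function.update ω n x) = Y n ω := by
    intro n ω x
    refine Finset.sum_congr rfl fun l hl => ?_
    have hl := Finset.mem_range.1 hl
    have hag : ∀ i < l, Function.update ω n x i = ω i :=
      fun i hi => update_of_lt ω n x i (by omega)
    simp only [visits_congr hag, visitCount_congr hag, hg, hD, hf l _ _ hag, pathStep_congr hag,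
      update_of_lt ω n x l hl]
  have hstep : ∀ n < N, ∀ ω, pexp (pathStep G H alg β n ω)
      (fun x => ENNReal.ofReal (Real.exp (Y (n + 1) (Function.update ω n x)))) ≤
      ENNReal.ofReal (Real.exp (Y n ω)) := by
    intro n hn ω
    have hag : ∀ x, ∀ i < n, Function.update ω n x i = ω i :=
      fun x i hi => update_of_lt ω n x i hi
    have hYs : ∀ x, Y (n + 1) (Function.update ω n x) = Y n ω +
        if Visits G H h s ω n ∧ visitCount G H β j h s ω n < t then
          (c * alphaW H t (visitCount G H β j h s ω n + 1)) * D n ω x -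
            (c * alphaW H t (visitCount G H β j h s ω n + 1)) ^ 2 / 2 else 0 := by
      intro x
      rw [← hYupd n ω x]
      simp only [hY]
      rw [Finset.sum_range_succ]
      simp only [visits_congr (hag x), visitCount_congr (hag x), hg, hD, hf n _ _ (hag x),
        pathStep_congr (hag x), Function.update_self]
    simp only [hYs]
    split_ifs with hv
    · simp only [Real.exp_add, ENNReal.ofReal_mul (Real.exp_pos (Y n ω)).le]
      rw [pexp_const_mul, pexp_ofReal _ fun x => (Real.exp_pos _).le]
      refine mul_le_of_le_one_right zero_le ?_
      rw [ENNReal.ofReal_le_one]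
      exact rexp_exp_le_one _ _ (hf01 n hn ω) (mul_nonneg hc0 (alphaW_nonneg _ _ _))
    · simp only [add_zero]
      rw [pexp_const]
  have hmain := pexp_pathFrom_le (G := G) (H := H) (alg := alg) (β := β)
    (fun n ω => ENNReal.ofReal (Real.exp (Y n ω))) N hstep N 0 (by omega) ω₀
  have hY0 : Y 0 ω₀ = 0 := by simp [hY]
  rw [hY0, Real.exp_zero, ENNReal.ofReal_one] at hmain
  have := toOuterMeasure_le_of_pexp_le _ {ω | t ≤ visitCount G H β j h s ω N ∧
        ε < ∑ i ∈ Finset.Icc 1 t, alphaW H t i *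
          (rexp (pathStep G H alg β (visitTime G H β j h s ω N i) ω)
            (f (visitTime G H β j h s ω N i) ω) -
            f (visitTime G H β j h s ω N i) ω (ω (visitTime G H β j h s ω N i)))} _
    (ENNReal.ofReal (Real.exp (-2 * ι))) 1 ?_ hmain
  · simpa using this
  · rintro ω ⟨hω, hbad⟩
    rw [← ENNReal.ofReal_mul (Real.exp_pos _).le, ← Real.exp_add, ENNReal.one_le_ofReal,
      Real.one_le_exp_iff]
    have hsum : Y N ω = c * ∑ i ∈ Finset.Icc 1 t, alphaW H t i *
          (rexp (pathStep G H alg β (visitTime G H β j h s ω N i) ω)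
            (f (visitTime G H β j h s ω N i) ω) -
            f (visitTime G H β j h s ω N i) ω (ω (visitTime G H β j h s ω N i))) -
          c ^ 2 / 2 * ∑ i ∈ Finset.Icc 1 t, alphaW H t i ^ 2 := by
      simp only [hY]
      rw [sum_visits (g ω) ω t N, min_eq_right hω, Finset.mul_sum, Finset.mul_sum,
        ← Finset.sum_sub_distrib]
      refine Finset.sum_congr rfl fun i _ => ?_
      simp only [hg, hD]
      ring
    rw [hsum]
    have h1 := mul_le_mul_of_nonneg_left hbad.le hc0
    have h2 := mul_le_mul_of_nonneg_left (sum_alphaW_sq_le H t hH ht)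
      (show 0 ≤ c ^ 2 / 2 by positivity)
    have h3 : c * ε - c ^ 2 / 2 * (2 * H / t) = 9 / 4 * ι := by
      have : c * ε - c ^ 2 / 2 * (2 * H / t) = ε ^ 2 * t / (4 * H) := by
        rw [hc]; field_simp; ring
      rw [this, hε2]; field_simp
    linarith

end Visits

/-! ### The visits of a state as a bandit problem -/

section Reduction

/-- The protocol continued for `q` rounds after the first `i` rounds. -/
def banditFrom {B : ℕ} [NeZero B] (alg : BanditAlg B) (E : BanditEnv B) :
    ℕ → ℕ → BanditRun B E.X → PMF (BanditRun B E.X)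
  | 0, _, ρ => PMF.pure ρ
  | q + 1, i, ρ => (alg.strategy ρ.hist).bind fun b => (E.respond ρ.env b).bind fun y =>
      banditFrom alg E q (i + 1)
        { env := y.2
          hist := (b, y.1) :: ρ.hist
          θ := Function.update ρ.θ (i + 1) fun b' => (alg.strategy ρ.hist b').toReal
          ℓ := Function.update ρ.ℓ (i + 1) (E.loss ρ.env) }

theorem banditLaw_add {B : ℕ} [NeZero B] (alg : BanditAlg B) (E : BanditEnv B) (q i : ℕ) :
    banditLaw alg E (i + q) = (banditLaw alg E i).bind (banditFrom alg E q i) := by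
  induction q generalizing i with
  | zero => simp [banditFrom, PMF.bind_pure]
  | succ q ih =>
    rw [show i + (q + 1) = (i + 1) + q by ring, ih (i + 1)]
    simp only [banditLaw, banditFrom, PMF.bind_bind, PMF.bind_map]
    rfl

variable {m S : ℕ} {A : Fin m → ℕ} [∀ j, NeZero (A j)]

/-- Truncation to `[0, 1]`. -/
def clip (y : ℝ) : ℝ := max 0 (min 1 y)

theorem clip_mem (y : ℝ) : clip y ∈ Set.Icc (0 : ℝ) 1 :=
  ⟨le_max_left _ _, max_le zero_le_one (min_le_left _ _)⟩

theorem clip_eq {y : ℝ} (hy : y ∈ Set.Icc (0 : ℝ) 1) : clip y = y := by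
  unfold clip
  rw [min_eq_right hy.2, max_eq_right hy.1]

/-- The loss observed by agent `j` at time `n`. -/
def pathLoss (G : MarkovGame m S A) (H : ℕ) (β : Fin m → ℕ → ℝ) (j : Fin m) (n : ℕ)
    (ω : Path S A) (x : JointAction A × Fin S) : ℝ :=
  ((H : ℝ) - G.reward j (n % H) (pathState G H ω n) x.1 -
    (pathProfile G H β ω n j).V (n % H + 1) x.2) / H

/-- The law of the entry at time `n` when agent `j` plays `b`. -/
def pathStepPlay (G : MarkovGame m S A) (H : ℕ) (alg : ∀ j, BanditAlg (A j)) (β : Fin m → ℕ → ℝ)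
    (j : Fin m) (n : ℕ) (ω : Path S A) (b : Fin (A j)) : PMF (JointAction A × Fin S) :=
  G.moveLaw (n % H) (pathState G H ω n) (pmfPi (Function.update
    (fun i => (pathProfile G H β ω n i).policy (alg i) (n % H) (pathState G H ω n)) j
    (PMF.pure b)))

/-- Continue a path until the next visit of `s` at step `h`, for at most `r` entries. -/
def advance (G : MarkovGame m S A) (H : ℕ) (alg : ∀ j, BanditAlg (A j)) (β : Fin m → ℕ → ℝ)
    (h : ℕ) (s : Fin S) : ℕ → ℕ → Path S A → PMF (ℕ × Path S A)
  | 0, n, ω => PMF.pure (n, ω)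
  | r + 1, n, ω => if Visits G H h s ω n then PMF.pure (n, ω) else
      (pathStep G H alg β n ω).bind fun x => advance G H alg β h s r (n + 1)
        (Function.update ω n x)

/-- The adversary that simulates the first `N` entries of a path, as seen by agent `j` at the
visits of `s` at step `h`. -/
@[reducible] def visitEnv (G : MarkovGame m S A) (H : ℕ) (alg : ∀ j, BanditAlg (A j)) (β : Fin m → ℕ → ℝ)
    (j : Fin m) (h : ℕ) (s : Fin S) (N : ℕ) (ω₀ : Path S A) : BanditEnv (A j) where
  X := ℕ × Path S A
  init := advance G H alg β h s N 0 ω₀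
  -- Past the end of the simulated path all losses are zero. Clipping keeps the adversary admissible
  -- on every path; it changes nothing where the losses already lie in `[0, 1]`.
  loss c b := if c.1 < N then
    rexp (pathStepPlay G H alg β j c.1 c.2 b) (fun x => clip (pathLoss G H β j c.1 c.2 x)) else 0
  respond c b := if c.1 < N then (pathStepPlay G H alg β j c.1 c.2 b).bind fun x =>
      (advance G H alg β h s (N - (c.1 + 1)) (c.1 + 1) (Function.update c.2 c.1 x)).map
        fun c' => (clip (pathLoss G H β j c.1 c.2 x), c')
    else PMF.pure (0, c)
  loss_mem c b := by
    split_ifs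
    · exact ⟨rexp_nonneg _ fun x => (clip_mem _).1, rexp_le_const _ fun x => (clip_mem _).2⟩
    · exact ⟨le_rfl, zero_le_one⟩
  feedback_mem c b y hy := by
    split_ifs at hy with hc
    · simp only [PMF.mem_support_bind_iff, PMF.mem_support_map_iff] at hy
      obtain ⟨x, -, c', -, rfl⟩ := hy
      exact clip_mem _
    · rw [PMF.mem_support_pure_iff] at hy
      subst hy
      exact ⟨le_rfl, zero_le_one⟩
  feedback_mean c b := by
    split_ifs with hc
    · set p := (pathStepPlay G H alg β j c.1 c.2 b).bind fun x =>
        (advance G H alg β h s (N - (c.1 + 1)) (c.1 + 1) (Function.update c.2 c.1 x)).map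
          fun c' => (clip (pathLoss G H β j c.1 c.2 x), c') with hp
      have hmem : ∀ y ∈ p.support, y.1 ∈ Set.Icc (0 : ℝ) 1 := by
        intro y hy
        simp only [hp, PMF.mem_support_bind_iff, PMF.mem_support_map_iff] at hy
        obtain ⟨x, -, c', -, rfl⟩ := hy
        exact clip_mem _
      have h1 := pexp_ofReal_eq p (fun y => y.1) hmem
      rw [hp, pexp_bind] at h1
      simp only [pexp_map, pexp_const] at h1
      rw [pexp_ofReal _ fun x => (clip_mem _).1, ← hp] at h1
      have h2 : 0 ≤ ∑' y, (p y).toReal * y.1 := by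
        refine tsum_nonneg fun y => ?_
        by_cases hy : p y = 0
        · simp [hy]
        · exact mul_nonneg ENNReal.toReal_nonneg (hmem y ((p.mem_support_iff y).2 hy)).1
      have h3 := congrArg ENNReal.toReal h1
      rwa [ENNReal.toReal_ofReal (rexp_nonneg _ fun x => (clip_mem _).1),
        ENNReal.toReal_ofReal h2, eq_comm] at h3
    · rw [tsum_eq_single (0, c)]
      · simp
      · intro y hy
        simp [PMF.pure_apply, hy]

variable {G : MarkovGame m S A} {H : ℕ} {alg : ∀ j, BanditAlg (A j)} {β : Fin m → ℕ → ℝ}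
  {j : Fin m} {h : ℕ} {s : Fin S}

/-- Agents act independently, so the action of `j` can be drawn first. This separates the move of
the learner from the response of the adversary, which includes all other agents. -/
theorem pathStep_eq_bind (n : ℕ) (ω : Path S A) (j : Fin m) :
    pathStep G H alg β n ω =
      ((pathProfile G H β ω n j).policy (alg j) (n % H) (pathState G H ω n)).bind
        (pathStepPlay G H alg β j n ω) := by
  unfold pathStep pathStepPlay MarkovGame.moveLaw
  rw [pmfPi_eq_bind _ j, PMF.bind_bind]

theorem eq_of_mem_support_pathStepPlay {n : ℕ} {ω : Path S A} {b : Fin (A j)}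
    {x : JointAction A × Fin S} (hx : x ∈ (pathStepPlay G H alg β j n ω b).support) :
    x.1 j = b := by
  unfold pathStepPlay MarkovGame.moveLaw at hx
  simp only [PMF.mem_support_bind_iff, PMF.mem_support_map_iff] at hx
  obtain ⟨a, ha, s', -, rfl⟩ := hx
  exact eq_of_mem_support_pmfPi_update ha

/-- The strategy of agent `j` for the state `s` at step `h`, at time `n`. -/
def strategyAt (G : MarkovGame m S A) (H : ℕ) (alg : ∀ j, BanditAlg (A j)) (β : Fin m → ℕ → ℝ)
    (j : Fin m) (h : ℕ) (s : Fin S) (n : ℕ) (ω : Path S A) (b : Fin (A j)) : ℝ :=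
  ((alg j).strategy ((pathProfile G H β ω n j).hist h s) b).toReal

/-- The loss vector of agent `j` at time `n`. -/
def lossAt (G : MarkovGame m S A) (H : ℕ) (alg : ∀ j, BanditAlg (A j)) (β : Fin m → ℕ → ℝ)
    (j : Fin m) (n : ℕ) (ω : Path S A) (b : Fin (A j)) : ℝ :=
  rexp (pathStepPlay G H alg β j n ω b) (pathLoss G H β j n ω)

theorem strategyAt_congr (n : ℕ) (ω ω' : Path S A) (hω : ∀ l < n, ω l = ω' l) :
    strategyAt G H alg β j h s n ω = strategyAt G H alg β j h s n ω' := by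
  unfold strategyAt; rw [pathProfile_congr hω]

theorem lossAt_congr (n : ℕ) (ω ω' : Path S A) (hω : ∀ l < n, ω l = ω' l) :
    lossAt G H alg β j n ω = lossAt G H alg β j n ω' := by
  unfold lossAt pathStepPlay pathLoss; rw [pathProfile_congr hω, pathState_congr hω]

/-- The run of the bandit protocol recorded along a path. -/
def visitRun (G : MarkovGame m S A) (H : ℕ) (alg : ∀ j, BanditAlg (A j)) (β : Fin m → ℕ → ℝ)
    (j : Fin m) (h : ℕ) (s : Fin S) {X : Type} (ω : Path S A) (n : ℕ) (c : X) :
    BanditRun (A j) X where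
  env := c
  hist := (pathProfile G H β ω n j).hist h s
  θ := visitTable G H β j h s (strategyAt G H alg β j h s) ω n
  ℓ := visitTable G H β j h s (lossAt G H alg β j) ω n

theorem visitTable_update {B : ℕ} {f : ℕ → Path S A → Fin B → ℝ}
    (hf : ∀ n ω ω', (∀ l < n, ω l = ω' l) → f n ω = f n ω') (ω : Path S A) (n : ℕ)
    (x : JointAction A × Fin S) :
    visitTable G H β j h s f (Function.update ω n x) (n + 1) =
      if Visits G H h s ω n then Function.update (visitTable G H β j h s f ω n)
        (visitCount G H β j h s ω n + 1) (f n ω) else visitTable G H β j h s f ω n := by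
  have hag := update_of_lt ω n x
  conv_lhs => unfold visitTable
  rw [visitTable_congr hf hag, visitCount_congr hag, hf n _ _ hag]
  simp only [visits_congr hag]

theorem visitCount_update (ω : Path S A) (n : ℕ) (x : JointAction A × Fin S) :
    visitCount G H β j h s (Function.update ω n x) (n + 1) =
      if Visits G H h s ω n then visitCount G H β j h s ω n + 1
      else visitCount G H β j h s ω n := by
  have hag := update_of_lt ω n x
  rw [visitCount_succ, visitCount_congr hag]
  simp only [visits_congr hag]

theorem visitRun_update_of_not {X : Type} (ω : Path S A) (n : ℕ) (x : JointAction A × Fin S)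
    (c : X) (hv : ¬ Visits G H h s ω n) :
    visitRun G H alg β j h s (Function.update ω n x) (n + 1) c =
      visitRun G H alg β j h s ω n c := by
  have hag := update_of_lt ω n x
  unfold visitRun
  rw [visitTable_update strategyAt_congr, visitTable_update lossAt_congr, if_neg hv, if_neg hv,
    hist_succ, if_neg (by rwa [visits_congr hag]), pathProfile_congr hag]

/-- A visit extends the recorded run by exactly one round of the protocol. -/
theorem visitRun_update {X : Type} (ω : Path S A) (n : ℕ) (x : JointAction A × Fin S)
    (c : X) (hv : Visits G H h s ω n) :
    visitRun G H alg β j h s (Function.update ω n x) (n + 1) c =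
      { env := c
        hist := (x.1 j, pathLoss G H β j n ω x) :: (pathProfile G H β ω n j).hist h s
        θ := Function.update (visitTable G H β j h s (strategyAt G H alg β j h s) ω n)
          (visitCount G H β j h s ω n + 1) (strategyAt G H alg β j h s n ω)
        ℓ := Function.update (visitTable G H β j h s (lossAt G H alg β j) ω n)
          (visitCount G H β j h s ω n + 1) (lossAt G H alg β j n ω) } := by
  have hag := update_of_lt ω n x
  unfold visitRun
  rw [visitTable_update strategyAt_congr, visitTable_update lossAt_congr, if_pos hv, if_pos hv,
    hist_succ, if_pos (by rwa [visits_congr hag]), pathProfile_congr hag, pathState_congr hag,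
    Function.update_self]
  rfl

section

variable (Bad : (ℕ → Fin (A j) → ℝ) → (ℕ → Fin (A j) → ℝ) → Prop) (t N : ℕ)

/-- After `t` visits the first `t` rounds are frozen and `Bad` reads nothing else, so the event is
already decided. -/
theorem pexp_badRun_le_of_le
    (hBad : ∀ θ θ' ℓ ℓ', (∀ i ≤ t, θ i = θ' i) → (∀ i ≤ t, ℓ i = ℓ' i) → Bad θ ℓ → Bad θ' ℓ')
    (r n : ℕ) (hn : n + r = N) (ω : Path S A) (ht : t ≤ visitCount G H β j h s ω n) :
    pexp (pathFrom G H alg β r n ω) (Set.indicator {ω | t ≤ visitCount G H β j h s ω N ∧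
      Bad (visitTable G H β j h s (strategyAt G H alg β j h s) ω N)
        (visitTable G H β j h s (lossAt G H alg β j) ω N)} 1) ≤
    Set.indicator {ω | Bad (visitTable G H β j h s (strategyAt G H alg β j h s) ω n)
        (visitTable G H β j h s (lossAt G H alg β j) ω n)} 1 ω := by
  classical
  induction r generalizing n ω with
  | zero =>
    subst hn
    rw [pathFrom, pexp_pure]
    refine Set.indicator_le_indicator_of_subset (fun ω hω => hω.2) (fun _ => zero_le) ω
  | succ r ih =>
    rw [pathFrom, pexp_bind]
    rw [← pexp_const (pathStep G H alg β n ω) (Set.indicator _ 1 ω)]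
    refine pexp_mono _ fun x => ?_
    refine (ih (n + 1) (by omega) _ ?_).trans ?_
    · rw [visitCount_update]; split_ifs <;> omega
    · simp only [Set.indicator_apply, Set.mem_ofPred_eq]
      have himp : Bad (visitTable G H β j h s (strategyAt G H alg β j h s)
          (Function.update ω n x) (n + 1))
          (visitTable G H β j h s (lossAt G H alg β j) (Function.update ω n x) (n + 1)) →
          Bad (visitTable G H β j h s (strategyAt G H alg β j h s) ω n)
          (visitTable G H β j h s (lossAt G H alg β j) ω n) := by
        rw [visitTable_update strategyAt_congr, visitTable_update lossAt_congr]
        split_ifs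
        · refine hBad _ _ _ _ (fun i hi => ?_) (fun i hi => ?_) <;>
            rw [Function.update_of_ne (by omega)]
        · exact id
      split_ifs with h1 h2
      · exact le_rfl
      · exact absurd (himp h1) h2
      · exact zero_le
      · exact le_rfl

/-- A coupling by induction on the remaining path length `r`, with `q` rounds still to come:
`advance` consumes the entries between visits, and each visit is matched with one round of
`banditFrom`. The inequality absorbs paths on which the state is visited fewer than `t` times. -/
theorem pexp_badRun_le (ω₀ : Path S A)
    (hBad : ∀ θ θ' ℓ ℓ', (∀ i ≤ t, θ i = θ' i) → (∀ i ≤ t, ℓ i = ℓ' i) → Bad θ ℓ → Bad θ' ℓ')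
    (hloss : ∀ n < N, ∀ ω x, pathLoss G H β j n ω x ∈ Set.Icc (0 : ℝ) 1)
    (r n : ℕ) (hn : n + r = N) (ω : Path S A) (q : ℕ)
    (ht : visitCount G H β j h s ω n + q = t) :
    pexp (pathFrom G H alg β r n ω) (Set.indicator {ω | t ≤ visitCount G H β j h s ω N ∧
      Bad (visitTable G H β j h s (strategyAt G H alg β j h s) ω N)
        (visitTable G H β j h s (lossAt G H alg β j) ω N)} 1) ≤
    pexp (advance G H alg β h s r n ω) fun c =>
      pexp (banditFrom (alg j) (visitEnv G H alg β j h s N ω₀) q (visitCount G H β j h s ω n)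
        (visitRun G H alg β j h s ω n c)) (Set.indicator {ρ | Bad ρ.θ ρ.ℓ} 1) := by
  classical
  induction r generalizing n ω q with
  | zero =>
    rcases q with _ | q
    · refine (pexp_badRun_le_of_le Bad t N hBad 0 n hn ω ht.ge).trans ?_
      simp only [banditFrom, pexp_pure]
      rw [advance, pexp_pure]
      exact le_rfl
    -- The path ended before the `t`-th visit, so the event on the left is empty.
    · subst hn
      rw [pathFrom, pexp_pure, Set.indicator_of_notMem]
      · exact zero_le
      · rintro ⟨h1, -⟩
        rw [add_zero] at h1
        omega
  | succ r ih =>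
    rcases q with _ | q
    · refine (pexp_badRun_le_of_le Bad t N hBad (r + 1) n hn ω ht.ge).trans ?_
      simp only [banditFrom, pexp_pure]
      refine (pexp_const (advance G H alg β h s (r + 1) n ω) _).ge.trans (le_of_eq ?_)
      rfl
    · rw [pathFrom, pexp_bind, advance]
      split_ifs with hv
      -- At a visit `advance` stops. One path entry is then the draw of `j` followed by the
      -- response, which itself runs on to the next visit.
      · rw [pexp_pure, pathStep_eq_bind n ω j, pexp_bind]
        have hpol : (pathProfile G H β ω n j).policy (alg j) (n % H) (pathState G H ω n) =
            (alg j).strategy ((pathProfile G H β ω n j).hist h s) := by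
          unfold AgentState.policy
          rw [hv.1, hv.2]
        have hnN : n < N := by omega
        have hr : N - (n + 1) = r := by omega
        rw [banditFrom, pexp_bind, hpol]
        refine pexp_mono _ fun b => ?_
        rw [pexp_bind]
        simp only [visitEnv, visitRun, if_pos hnN, hr]
        rw [pexp_bind]
        refine pexp_mono_support _ fun x hx => ?_
        rw [pexp_map]
        have hcount : visitCount G H β j h s (Function.update ω n x) (n + 1) =
            visitCount G H β j h s ω n + 1 := by rw [visitCount_update, if_pos hv]
        refine (ih (n + 1) (by omega) (Function.update ω n x) q (by omega)).trans ?_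
        refine pexp_mono _ fun c => le_of_eq ?_
        rw [hcount, visitRun_update ω n x c hv, eq_of_mem_support_pathStepPlay hx,
          clip_eq (hloss n hnN ω x)]
        simp only [fun x => clip_eq (hloss n hnN ω x), if_pos hnN]
        rfl
      · rw [pexp_bind]
        refine pexp_mono _ fun x => ?_
        have hcount : visitCount G H β j h s (Function.update ω n x) (n + 1) =
            visitCount G H β j h s ω n := by rw [visitCount_update, if_neg hv]
        refine (ih (n + 1) (by omega) (Function.update ω n x) (q + 1) (by omega)).trans ?_
        rw [hcount]
        refine pexp_mono _ fun c => le_of_eq ?_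
        rw [visitRun_update_of_not ω n x c hv]

/-- A bandit guarantee transfers to the visits of a state. -/
theorem badVisits_le (ω₀ : Path S A)
    (hBad : ∀ θ θ' ℓ ℓ', (∀ i ≤ t, θ i = θ' i) → (∀ i ≤ t, ℓ i = ℓ' i) → Bad θ ℓ → Bad θ' ℓ')
    (hloss : ∀ n < N, ∀ ω x, pathLoss G H β j n ω x ∈ Set.Icc (0 : ℝ) 1) :
    (pathFrom G H alg β N 0 ω₀).toOuterMeasure {ω | t ≤ visitCount G H β j h s ω N ∧
      Bad (visitTable G H β j h s (strategyAt G H alg β j h s) ω N)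
        (visitTable G H β j h s (lossAt G H alg β j) ω N)} ≤
    (banditLaw (alg j) (visitEnv G H alg β j h s N ω₀) t).toOuterMeasure {ρ | Bad ρ.θ ρ.ℓ} := by
  rw [toOuterMeasure_eq_pexp, toOuterMeasure_eq_pexp]
  have hc : visitCount G H β j h s ω₀ 0 = 0 := by
    simp [visitCount, pathProfile, AgentState.initial]
  refine (pexp_badRun_le Bad t N ω₀ hBad hloss N 0 (by omega) ω₀ t (by omega)).trans ?_
  have := banditLaw_add (alg j) (visitEnv G H alg β j h s N ω₀) t 0
  rw [zero_add] at this
  rw [this, pexp_bind, banditLaw, pexp_map, hc]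
  exact le_of_eq rfl

end

end Reduction

/-! ### Good events of training -/

section Core

variable {m S : ℕ} {A : Fin m → ℕ} [∀ j, NeZero (A j)]
  {G : MarkovGame m S A} {H : ℕ} {alg : ∀ j, BanditAlg (A j)} {β : Fin m → ℕ → ℝ}

theorem rexp_moveLaw (j : Fin m) (h : ℕ) (s : Fin S) (p : PMF (JointAction A)) (W : Fin S → ℝ) :
    rexp (G.moveLaw h s p) (fun x => G.reward j h s x.1 + W x.2) =
      rexp p (G.backup j h s W) := by
  unfold MarkovGame.moveLaw MarkovGame.backup
  rw [rexp_bind]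
  congr 1
  funext a
  rw [rexp_map]
  exact (rexp_add _ _ _).trans 
    (congrArg (· + _) (rexp_const _ (G.reward j h s a)))

theorem div_add_of_lt {k h : ℕ} (hh : h < H) : (k * H + h) / H = k := by
  rw [Nat.mul_comm, Nat.mul_add_div (by omega), Nat.div_eq_of_lt hh, add_zero]

theorem policies_eq (ω : Path S A) {k h : ℕ} (hh : h < H) {s : Fin S}
    (hs : pathState G H ω (k * H + h) = s) :
    (fun i => (pathProfile G H β ω (k * H + h) i).policy (alg i) ((k * H + h) % H)
      (pathState G H ω (k * H + h))) =
    fun i => (pathEpisode G H β ω k i).policy (alg i) h s := by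
  funext i
  unfold AgentState.policy
  rw [mul_add_mod_of_lt hh, hs, AgentState.hist_eq_of_row (row_of_le ω k h h le_rfl hh.le i)]
  rfl

theorem pathStep_eq (ω : Path S A) {k h : ℕ} (hh : h < H) {s : Fin S}
    (hs : pathState G H ω (k * H + h) = s) :
    pathStep G H alg β (k * H + h) ω =
      G.moveLaw h s (jointPolicy alg (pathEpisode G H β ω) k h s) := by
  unfold pathStep jointPolicy
  rw [policies_eq ω hh hs, mul_add_mod_of_lt hh, hs]

theorem pathStepPlay_eq (ω : Path S A) {k h : ℕ} (hh : h < H) {s : Fin S}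
    (hs : pathState G H ω (k * H + h) = s) (j : Fin m) (b : Fin (A j)) :
    pathStepPlay G H alg β j (k * H + h) ω b =
      G.moveLaw h s (pmfPi (Function.update
        (fun i => (pathEpisode G H β ω k i).policy (alg i) h s) j (PMF.pure b))) := by
  unfold pathStepPlay
  rw [policies_eq ω hh hs, mul_add_mod_of_lt hh, hs]

theorem V_next_eq (ω : Path S A) {k h : ℕ} (hh : h < H) (j : Fin m) :
    (pathProfile G H β ω (k * H + h) j).V (h + 1) = (pathEpisode G H β ω k j).V (h + 1) :=
  AgentState.V_eq_of_row (row_of_le ω k h (h + 1) (by omega) hh.le j)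

theorem pathLoss_eq (ω : Path S A) {k h : ℕ} (hh : h < H) {s : Fin S}
    (hs : pathState G H ω (k * H + h) = s) (j : Fin m) :
    pathLoss G H β j (k * H + h) ω = fun x =>
      1 - 1 / (H : ℝ) * (G.reward j h s x.1 + (pathEpisode G H β ω k j).V (h + 1) x.2) := by
  funext x
  have : (H : ℝ) ≠ 0 := by exact_mod_cast (by omega : H ≠ 0)
  unfold pathLoss
  rw [mul_add_mod_of_lt hh, hs, V_next_eq ω hh j]
  field_simp
  ring

/-- The expected loss of an action is an affine, decreasing function of the backup in which only the
action of `j` is replaced. With `sum_strategyAt_mul_lossAt`, bandit regret becomes regret of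
backups, divided by `H`. -/
theorem lossAt_eq (ω : Path S A) {k h : ℕ} (hh : h < H) {s : Fin S}
    (hs : pathState G H ω (k * H + h) = s) (j : Fin m) (b : Fin (A j)) :
    lossAt G H alg β j (k * H + h) ω b =
      1 - 1 / (H : ℝ) * rexp (jointPolicy alg (pathEpisode G H β ω) k h s)
        (fun a => G.backup j h s ((pathEpisode G H β ω k j).V (h + 1)) (Function.update a j b)) := by
  unfold lossAt
  rw [pathStepPlay_eq ω hh hs, pathLoss_eq ω hh hs, rexp_sub, rexp_const, rexp_const_mul,
    rexp_moveLaw j h s _ ((pathEpisode G H β ω k j).V (h + 1))]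
  unfold jointPolicy
  rw [rexp_pmfPi_update]

theorem sum_strategyAt_mul_lossAt (ω : Path S A) {k h : ℕ} (hh : h < H) {s : Fin S}
    (hs : pathState G H ω (k * H + h) = s) (j : Fin m) :
    ∑ b, strategyAt G H alg β j h s (k * H + h) ω b * lossAt G H alg β j (k * H + h) ω b =
      1 - 1 / (H : ℝ) * rexp (jointPolicy alg (pathEpisode G H β ω) k h s)
        (G.backup j h s ((pathEpisode G H β ω k j).V (h + 1))) := by
  have h1 : ∑ b, strategyAt G H alg β j h s (k * H + h) ω b *
      lossAt G H alg β j (k * H + h) ω b =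
      rexp (pathStep G H alg β (k * H + h) ω) (pathLoss G H β j (k * H + h) ω) := by
    rw [pathStep_eq_bind _ ω j, rexp_bind]
    unfold strategyAt lossAt AgentState.policy
    rw [mul_add_mod_of_lt hh, hs]
    rfl
  rw [h1, pathStep_eq ω hh hs, pathLoss_eq ω hh hs, rexp_sub, rexp_const, rexp_const_mul,
    rexp_moveLaw j h s _ ((pathEpisode G H β ω k j).V (h + 1))]

theorem pathLoss_mem (hH : 1 ≤ H) (K : ℕ) (j : Fin m)
    (hβ : ∀ t, 1 ≤ t → t ≤ K → 0 ≤ ∑ i ∈ Finset.Icc 1 t, alphaW H t i * β j i)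
    (n : ℕ) (hn : n < K * H) (ω : Path S A) (x : JointAction A × Fin S) :
    1 / (H : ℝ) * (G.reward j (n % H) (pathState G H ω n) x.1 +
      (pathEpisode G H β ω (n / H) j).V (n % H + 1) x.2) ∈ Set.Icc (0 : ℝ) 1 := by
  have hR := isRun_path (G := G) (β := β) ω hH
  have hk : n / H < K := Nat.div_lt_of_lt_mul (by rwa [Nat.mul_comm])
  have hmod := Nat.mod_lt n hH
  have h1 := hR.V_nonneg j K hβ (h := n % H + 1) (by omega) x.2 (n / H) hk.le
  have h2 := hR.V_le j (h := n % H + 1) (by omega) x.2 (n / H)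
  have h3 := G.reward_mem j (n % H) (pathState G H ω n) x.1
  have hHr : (1 : ℝ) ≤ H := by exact_mod_cast hH
  refine ⟨mul_nonneg (by positivity) (add_nonneg h3.1 h1), ?_⟩
  rw [one_div, inv_mul_le_iff₀ (by linarith)]
  push_cast at h2
  have : (0 : ℝ) ≤ (n % H : ℕ) := Nat.cast_nonneg _
  linarith [h3.2]

theorem ownValue_mem (hH : 1 ≤ H) (j : Fin m) (R : ℕ → Profile S A) (n : ℕ) (s : Fin S)
    (x : JointAction A × Fin S) :
    1 - 1 / (H : ℝ) * (G.reward j (n % H) s x.1 +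
      ownValue G H alg R j (H - (n % H + 1)) (n % H + 1) (n / H) x.2) ∈ Set.Icc (0 : ℝ) 1 := by
  have hmod := Nat.mod_lt n hH
  have h1 : 0 ≤ ownValue G H alg R j (H - (n % H + 1)) (n % H + 1) (n / H) x.2 :=
    ownValue_nonneg _ _ _ _ _
  have h2 : ownValue G H alg R j (H - (n % H + 1)) (n % H + 1) (n / H) x.2 ≤ _ :=
    ownValue_le _ _ _ _ _
  have h3 := G.reward_mem j (n % H) s x.1
  have hHr : (1 : ℝ) ≤ H := by exact_mod_cast hH
  have h4 : ((H - (n % H + 1) : ℕ) : ℝ) ≤ H - 1 := by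
    rw [Nat.cast_sub (by omega)]
    push_cast
    have : (0 : ℝ) ≤ (n % H : ℕ) := Nat.cast_nonneg _
    linarith
  have h5 : 0 ≤ 1 / (H : ℝ) * (G.reward j (n % H) s x.1 +
      ownValue G H alg R j (H - (n % H + 1)) (n % H + 1) (n / H) x.2) :=
    mul_nonneg (by positivity) (add_nonneg h3.1 h1)
  have h6 : 1 / (H : ℝ) * (G.reward j (n % H) s x.1 +
      ownValue G H alg R j (H - (n % H + 1)) (n % H + 1) (n / H) x.2) ≤ 1 := by
    rw [one_div, inv_mul_le_iff₀ (by linarith)]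
    linarith [h3.2]
  exact ⟨by linarith, by linarith⟩

/-- The regret bound fails at the `t`-th visit. -/
def regretFails (G : MarkovGame m S A) (H : ℕ) (alg : ∀ j, BanditAlg (A j)) (β : Fin m → ℕ → ℝ)
    (K : ℕ) (ρ : ℕ → ℝ) (j : Fin m) (h : ℕ) (s : Fin S) (t : ℕ) : Set (Path S A) :=
  {ω | t ≤ (pathEpisode G H β ω K j).N h s ∧ ∃ b : Fin (A j),
    ∑ i ∈ Finset.Icc 1 t, alphaW H t i *
        rexp (jointPolicy alg (pathEpisode G H β ω) ((pathEpisode G H β ω K j).ep h s i) h s)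
        (G.backup j h s
          ((pathEpisode G H β ω ((pathEpisode G H β ω K j).ep h s i) j).V (h + 1))) + H * ρ t <
    ∑ i ∈ Finset.Icc 1 t, alphaW H t i *
        rexp (jointPolicy alg (pathEpisode G H β ω) ((pathEpisode G H β ω K j).ep h s i) h s)
        (fun a => G.backup j h s
          ((pathEpisode G H β ω ((pathEpisode G H β ω K j).ep h s i) j).V (h + 1))
          (Function.update a j b))}

/-- The lower concentration bound fails at the `t`-th visit. -/
def lowerFails (G : MarkovGame m S A) (H : ℕ) (alg : ∀ j, BanditAlg (A j)) (β : Fin m → ℕ → ℝ)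
    (K : ℕ) (ι : ℝ) (j : Fin m) (h : ℕ) (s : Fin S) (t : ℕ) : Set (Path S A) :=
  {ω | t ≤ (pathEpisode G H β ω K j).N h s ∧
    ∑ i ∈ Finset.Icc 1 t, alphaW H t i *
      (G.reward j h s (ω ((pathEpisode G H β ω K j).ep h s i * H + h)).1 +
        (pathEpisode G H β ω ((pathEpisode G H β ω K j).ep h s i) j).V (h + 1)
          (ω ((pathEpisode G H β ω K j).ep h s i * H + h)).2) + H * (3 * √(H * ι / t)) <
    ∑ i ∈ Finset.Icc 1 t, alphaW H t i *
        rexp (jointPolicy alg (pathEpisode G H β ω) ((pathEpisode G H β ω K j).ep h s i) h s)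
        (G.backup j h s
          ((pathEpisode G H β ω ((pathEpisode G H β ω K j).ep h s i) j).V (h + 1)))}

/-- The upper concentration bound fails at the `t`-th visit. -/
def upperFails (G : MarkovGame m S A) (H : ℕ) (alg : ∀ j, BanditAlg (A j)) (β : Fin m → ℕ → ℝ)
    (K : ℕ) (ι : ℝ) (j : Fin m) (h : ℕ) (s : Fin S) (t : ℕ) : Set (Path S A) :=
  {ω | t ≤ (pathEpisode G H β ω K j).N h s ∧
    ∑ i ∈ Finset.Icc 1 t, alphaW H t i *
        rexp (jointPolicy alg (pathEpisode G H β ω) ((pathEpisode G H β ω K j).ep h s i) h s)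
        (G.backup j h s (ownValue G H alg (pathEpisode G H β ω) j (H - (h + 1)) (h + 1)
          ((pathEpisode G H β ω K j).ep h s i))) + H * (3 * √(H * ι / t)) <
    ∑ i ∈ Finset.Icc 1 t, alphaW H t i *
      (G.reward j h s (ω ((pathEpisode G H β ω K j).ep h s i * H + h)).1 +
        ownValue G H alg (pathEpisode G H β ω) j (H - (h + 1)) (h + 1)
          ((pathEpisode G H β ω K j).ep h s i)
          (ω ((pathEpisode G H β ω K j).ep h s i * H + h)).2)}

theorem pathState_visitTime (hH : 1 ≤ H) (ω : Path S A) (K : ℕ) (j : Fin m) {h : ℕ} (hh : h < H)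
    (s : Fin S) {t : ℕ} (ht : t ≤ (pathEpisode G H β ω K j).N h s) {i : ℕ}
    (hi : i ∈ Finset.Icc 1 t) :
    pathState G H ω ((pathEpisode G H β ω K j).ep h s i * H + h) = s := by
  have hi := Finset.mem_Icc.1 hi
  exact ((isRun_path ω hH).ep_spec j hh s K i hi.1 (hi.2.trans ht)).2.1

theorem regretFails_le (hH : 1 ≤ H) (K : ℕ) (ρ : ℕ → ℝ) (j : Fin m) {h : ℕ} (hh : h < H)
    (s : Fin S) (t : ℕ) (p : ℝ≥0∞)
    (hβ : ∀ t, 1 ≤ t → t ≤ K → 0 ≤ ∑ i ∈ Finset.Icc 1 t, alphaW H t i * β j i)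
    (hreg : ∀ E : BanditEnv (A j), (banditLaw (alg j) E t).toOuterMeasure
      {r | ∃ θ ∈ stdSimplex ℝ (Fin (A j)), ρ t < weightedRegret H t r θ} ≤ p) (ω₀ : Path S A) :
    (pathFrom G H alg β (K * H) 0 ω₀).toOuterMeasure (regretFails G H alg β K ρ j h s t) ≤ p := by
  have hHr : (0 : ℝ) < H := by exact_mod_cast hH
  set Bad : (ℕ → Fin (A j) → ℝ) → (ℕ → Fin (A j) → ℝ) → Prop := fun θ ℓ =>
    ∃ θ₀ ∈ stdSimplex ℝ (Fin (A j)), ρ t < ∑ i ∈ Finset.Icc 1 t, alphaW H t i *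
      ((∑ b, θ i b * ℓ i b) - ∑ b, θ₀ b * ℓ i b) with hBad
  refine le_trans ?_ ((badVisits_le (G := G) (H := H) (alg := alg) (β := β) (h := h) (s := s)
    Bad t (K * H) ω₀ ?_ ?_).trans (hreg _))
  · refine MeasureTheory.measure_mono ?_
    rintro ω ⟨ht, b, hb⟩
    -- The better action `b` is the comparator concentrated at a vertex of the simplex.
    refine ⟨ht, Pi.single b 1, single_mem_stdSimplex ℝ b, ?_⟩
    have hterm : ∀ i ∈ Finset.Icc 1 t, alphaW H t i *
        ((∑ b, visitTable G H β j h s (strategyAt G H alg β j h s) ω (K * H) i b *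
          visitTable G H β j h s (lossAt G H alg β j) ω (K * H) i b) -
          ∑ b', (Pi.single b (1 : ℝ) : Fin (A j) → ℝ) b' *
            visitTable G H β j h s (lossAt G H alg β j) ω (K * H) i b') =
        1 / (H : ℝ) * (alphaW H t i *
        rexp (jointPolicy alg (pathEpisode G H β ω) ((pathEpisode G H β ω K j).ep h s i) h s)
        (fun a => G.backup j h s
          ((pathEpisode G H β ω ((pathEpisode G H β ω K j).ep h s i) j).V (h + 1))
          (Function.update a j b))) - 1 / (H : ℝ) * (alphaW H t i *
        rexp (jointPolicy alg (pathEpisode G H β ω) ((pathEpisode G H β ω K j).ep h s i) h s)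
        (G.backup j h s
          ((pathEpisode G H β ω ((pathEpisode G H β ω K j).ep h s i) j).V (h + 1)))) := by
      intro i hi
      have hs := pathState_visitTime (β := β) hH ω K j hh s ht hi
      have hi := Finset.mem_Icc.1 hi
      have hcount : i ≤ visitCount G H β j h s ω (K * H) := hi.2.trans ht
      have hsingle : ∀ ℓ : Fin (A j) → ℝ,
          ∑ b', (Pi.single b (1 : ℝ) : Fin (A j) → ℝ) b' * ℓ b' = ℓ b := by
        intro ℓ
        rw [Finset.sum_eq_single b]
        · simp
        · intro b' _ hb'; simp [hb']
        · simp
      rw [hsingle, visitTable_apply _ ω _ i hi.1 hcount, visitTable_apply _ ω _ i hi.1 hcount]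
      have e1 := sum_strategyAt_mul_lossAt (alg := alg) (β := β) ω hh hs j
      have e2 := lossAt_eq (alg := alg) (β := β) ω hh hs j b
      unfold visitTime
      rw [show (pathProfile G H β ω (K * H) j) = pathEpisode G H β ω K j from rfl, e1, e2]
      ring
    rw [Finset.sum_congr rfl hterm, Finset.sum_sub_distrib, ← Finset.mul_sum, ← Finset.mul_sum,
      ← mul_sub, one_div, lt_inv_mul_iff₀ hHr]
    linarith
  · intro θ θ' ℓ ℓ' h1 h2
    rintro ⟨θ₀, hθ₀, hlt⟩
    refine ⟨θ₀, hθ₀, hlt.trans_eq (Finset.sum_congr rfl fun i hi => ?_)⟩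
    have hi := (Finset.mem_Icc.1 hi).2
    rw [h1 i hi, h2 i hi]
  · intro n hn ω x
    have hmem := pathLoss_mem (G := G) hH K j hβ n hn ω x
    have hlt := Nat.mod_lt n hH
    have heq : n / H * H + n % H = n := Nat.div_add_mod' n H
    have h1 := pathLoss_eq (G := G) (β := β) ω (k := n / H) hlt rfl j
    rw [heq] at h1
    rw [h1]
    exact ⟨by linarith [hmem.2], by linarith [hmem.1]⟩

theorem lowerFails_le (hH : 1 ≤ H) (K : ℕ) (ι : ℝ) (hι : 0 ≤ ι) (j : Fin m) {h : ℕ} (hh : h < H)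
    (s : Fin S) (t : ℕ) (ht : 1 ≤ t)
    (hβ : ∀ t, 1 ≤ t → t ≤ K → 0 ≤ ∑ i ∈ Finset.Icc 1 t, alphaW H t i * β j i)
    (ω₀ : Path S A) :
    (pathFrom G H alg β (K * H) 0 ω₀).toOuterMeasure (lowerFails G H alg β K ι j h s t) ≤
      ENNReal.ofReal (Real.exp (-2 * ι)) := by
  have hHr : (0 : ℝ) < H := by exact_mod_cast hH
  refine le_trans (MeasureTheory.measure_mono ?_) (azuma_visits (G := G) (H := H) (alg := alg)
    (β := β) (j := j) (h := h) (s := s) hH (K * H) (fun n ω x =>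
      1 / (H : ℝ) * (G.reward j (n % H) (pathState G H ω n) x.1 +
      (pathEpisode G H β ω (n / H) j).V (n % H + 1) x.2)) ?_
      (fun n hn ω x => pathLoss_mem hH K j hβ n hn ω x) t ht ι hι ω₀)
  · rintro ω ⟨ht, hb⟩
    refine ⟨ht, ?_⟩
    have hterm : ∀ i ∈ Finset.Icc 1 t, alphaW H t i *
        (rexp (pathStep G H alg β (visitTime G H β j h s ω (K * H) i) ω)
            (fun x => 1 / (H : ℝ) * (G.reward j (visitTime G H β j h s ω (K * H) i % H)
              (pathState G H ω (visitTime G H β j h s ω (K * H) i)) x.1 +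
              (pathEpisode G H β ω (visitTime G H β j h s ω (K * H) i / H) j).V
                (visitTime G H β j h s ω (K * H) i % H + 1) x.2)) -
          1 / (H : ℝ) * (G.reward j (visitTime G H β j h s ω (K * H) i % H)
              (pathState G H ω (visitTime G H β j h s ω (K * H) i))
              (ω (visitTime G H β j h s ω (K * H) i)).1 +
              (pathEpisode G H β ω (visitTime G H β j h s ω (K * H) i / H) j).V
                (visitTime G H β j h s ω (K * H) i % H + 1)
                (ω (visitTime G H β j h s ω (K * H) i)).2)) =
        1 / (H : ℝ) * (alphaW H t i *
        rexp (jointPolicy alg (pathEpisode G H β ω) ((pathEpisode G H β ω K j).ep h s i) h s)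
        (G.backup j h s
          ((pathEpisode G H β ω ((pathEpisode G H β ω K j).ep h s i) j).V (h + 1)))) -
        1 / (H : ℝ) * (alphaW H t i *
      (G.reward j h s (ω ((pathEpisode G H β ω K j).ep h s i * H + h)).1 +
        (pathEpisode G H β ω ((pathEpisode G H β ω K j).ep h s i) j).V (h + 1)
          (ω ((pathEpisode G H β ω K j).ep h s i * H + h)).2)) := by
      intro i hi
      have hs := pathState_visitTime (β := β) hH ω K j hh s ht hi
      rw [show visitTime G H β j h s ω (K * H) i =
        (pathEpisode G H β ω K j).ep h s i * H + h from rfl, pathStep_eq ω hh hs,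
        mul_add_mod_of_lt hh, div_add_of_lt hh, hs, rexp_const_mul,
        rexp_moveLaw j h s _ ((pathEpisode G H β ω ((pathEpisode G H β ω K j).ep h s i) j).V
          (h + 1))]
      ring
    rw [Finset.sum_congr rfl hterm, Finset.sum_sub_distrib, ← Finset.mul_sum, ← Finset.mul_sum,
      ← mul_sub, one_div, lt_inv_mul_iff₀ hHr]
    linarith
  · intro n ω ω' hω
    funext x
    rw [pathState_congr hω]
    unfold pathEpisode
    rw [pathProfile_congr fun l hl => hω l (hl.trans_le (Nat.div_mul_le_self n H))]

theorem upperFails_le (hH : 1 ≤ H) (K : ℕ) (ι : ℝ) (hι : 0 ≤ ι) (j : Fin m) {h : ℕ} (hh : h < H)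
    (s : Fin S) (t : ℕ) (ht : 1 ≤ t) (ω₀ : Path S A) :
    (pathFrom G H alg β (K * H) 0 ω₀).toOuterMeasure (upperFails G H alg β K ι j h s t) ≤
      ENNReal.ofReal (Real.exp (-2 * ι)) := by
  have hHr : (0 : ℝ) < H := by exact_mod_cast hH
  -- The Azuma bound is one-sided; the complement `1 - ·` reverses the direction.
  refine le_trans (MeasureTheory.measure_mono ?_) (azuma_visits (G := G) (H := H) (alg := alg)
    (β := β) (j := j) (h := h) (s := s) hH (K * H) (fun n ω x =>
      1 - 1 / (H : ℝ) * (G.reward j (n % H) (pathState G H ω n) x.1 +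
      ownValue G H alg (pathEpisode G H β ω) j (H - (n % H + 1)) (n % H + 1) (n / H) x.2)) ?_
      (fun n hn ω x => ownValue_mem hH j _ n _ x) t ht ι hι ω₀)
  · rintro ω ⟨ht, hb⟩
    refine ⟨ht, ?_⟩
    have hterm : ∀ i ∈ Finset.Icc 1 t, alphaW H t i *
        (rexp (pathStep G H alg β (visitTime G H β j h s ω (K * H) i) ω)
            (fun x => 1 - 1 / (H : ℝ) * (G.reward j (visitTime G H β j h s ω (K * H) i % H)
              (pathState G H ω (visitTime G H β j h s ω (K * H) i)) x.1 +
              ownValue G H alg (pathEpisode G H β ω) j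
                (H - (visitTime G H β j h s ω (K * H) i % H + 1))
                (visitTime G H β j h s ω (K * H) i % H + 1)
                (visitTime G H β j h s ω (K * H) i / H) x.2)) -
          (1 - 1 / (H : ℝ) * (G.reward j (visitTime G H β j h s ω (K * H) i % H)
              (pathState G H ω (visitTime G H β j h s ω (K * H) i))
              (ω (visitTime G H β j h s ω (K * H) i)).1 +
              ownValue G H alg (pathEpisode G H β ω) j
                (H - (visitTime G H β j h s ω (K * H) i % H + 1))
                (visitTime G H β j h s ω (K * H) i % H + 1)
                (visitTime G H β j h s ω (K * H) i / H)
                (ω (visitTime G H β j h s ω (K * H) i)).2))) =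
        1 / (H : ℝ) * (alphaW H t i *
      (G.reward j h s (ω ((pathEpisode G H β ω K j).ep h s i * H + h)).1 +
        ownValue G H alg (pathEpisode G H β ω) j (H - (h + 1)) (h + 1)
          ((pathEpisode G H β ω K j).ep h s i)
          (ω ((pathEpisode G H β ω K j).ep h s i * H + h)).2)) -
        1 / (H : ℝ) * (alphaW H t i *
        rexp (jointPolicy alg (pathEpisode G H β ω) ((pathEpisode G H β ω K j).ep h s i) h s)
        (G.backup j h s (ownValue G H alg (pathEpisode G H β ω) j (H - (h + 1)) (h + 1)
          ((pathEpisode G H β ω K j).ep h s i)))) := by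
      intro i hi
      have hs := pathState_visitTime (β := β) hH ω K j hh s ht hi
      rw [show visitTime G H β j h s ω (K * H) i =
        (pathEpisode G H β ω K j).ep h s i * H + h from rfl, pathStep_eq ω hh hs,
        mul_add_mod_of_lt hh, div_add_of_lt hh, hs, rexp_sub, rexp_const, rexp_const_mul,
        rexp_moveLaw j h s _ (ownValue G H alg (pathEpisode G H β ω) j (H - (h + 1)) (h + 1)
          ((pathEpisode G H β ω K j).ep h s i))]
      ring
    rw [Finset.sum_congr rfl hterm, Finset.sum_sub_distrib, ← Finset.mul_sum, ← Finset.mul_sum,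
      ← mul_sub, one_div, lt_inv_mul_iff₀ hHr]
    linarith
  -- The own value at time `n` reads profiles up to episode `n / H` only, all determined by earlier
  -- entries.
  · intro n ω ω' hω
    funext x
    have hmod := Nat.mod_lt n hH
    rw [pathState_congr hω, ownValue_congr (isRun_path ω hH) (pathEpisode G H β ω') j _ _ _
      (by omega) fun k' hk' => pathProfile_congr fun l hl => hω l (hl.trans_le
        ((Nat.mul_le_mul_right H hk').trans (Nat.div_mul_le_self n H)))]

theorem exp_neg_logTerm {K : ℕ} {δ : ℝ} (hδ : 0 < δ)
    (hpos : (0 : ℝ) < m * H * S * maxA A * K) :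
    Real.exp (-logTerm m H S K A δ) = δ / (m * H * S * maxA A * K) := by
  unfold logTerm
  rw [Real.exp_neg, Real.exp_log (by positivity), inv_div]

/-- V-learning with subroutines of regret `ρ`, at the confidence level `exp (-ι)`, outputs an
approximate coarse correlated equilibrium. -/
theorem goodRecords_of_regret [NeZero H] {K : ℕ} [NeZero K] (hA : 2 ≤ maxA A)
    {δ : ℝ} (hδ : 0 < δ) (hδ1 : δ < 1) {ι : ℝ} (hι : ι = logTerm m H S K A δ)
    (ρ : Fin m → ℕ → ℝ) (hρ : ∀ j t, 1 ≤ t → t ≤ K → 0 ≤ ρ j t)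
    (hreg : ∀ j t, 1 ≤ t → t ≤ K → ∀ E : BanditEnv (A j),
      (banditLaw (alg j) E t).toOuterMeasure
        {r | ∃ θ ∈ stdSimplex ℝ (Fin (A j)), ρ j t < weightedRegret H t r θ} ≤
        ENNReal.ofReal (Real.exp (-ι)))
    (hβ : ∀ j t, 1 ≤ t → t ≤ K → H * ρ j t + 3 * √((H : ℝ) ^ 3 * ι / t) ≤
      ∑ i ∈ Finset.Icc 1 t, alphaW H t i * β j i)
    (ε : ℝ) (hε : 0 ≤ ε) (hB : ∀ j, ∀ M : Fin S → ℕ, ∑ s, M s = K →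
      3 * H / K * (S * H + ∑ s, ∑ t ∈ Finset.Icc 1 (M s),
        2 * ∑ i ∈ Finset.Icc 1 t, alphaW H t i * β j i) ≤ ε) :
    ENNReal.ofReal (1 - δ) ≤
      (trainLaw G H alg β K).toOuterMeasure (goodRecords G H K alg ε) := by
  have hH : 1 ≤ H := NeZero.one_le
  have hHr : (0 : ℝ) < H := by exact_mod_cast hH
  have hKr : (0 : ℝ) < K := by exact_mod_cast NeZero.pos K
  have hSr : (0 : ℝ) < S := by exact_mod_cast G.s₁.pos
  have hmr : (0 : ℝ) < m := by
    refine Nat.cast_pos.2 (Nat.pos_of_ne_zero ?_)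
    rintro rfl
    simp [maxA] at hA
  have hAr : (2 : ℝ) ≤ maxA A := by exact_mod_cast hA
  have hpos : (0 : ℝ) < m * H * S * maxA A * K := by positivity
  set p := Real.exp (-ι) with hp
  have hp' : p = δ / (m * H * S * maxA A * K) := by rw [hp, hι, exp_neg_logTerm hδ hpos]
  have hp0 : 0 < p := Real.exp_pos _
  -- The union bound has no sum over actions, so the factor `A ≥ 2` inside `ι` is spare and leaves a
  -- factor two for the concentration events.
  have hcount : (m * H * S * K : ℝ) * p ≤ δ / 2 := by
    have : (m * H * S * K : ℝ) * p = δ / maxA A := by rw [hp']; field_simp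
    rw [this]
    exact div_le_div_of_nonneg_left hδ.le (by norm_num) hAr
  have hone : (1 : ℝ) ≤ m * H * S * K := by
    have : 1 ≤ m * H * S * K := Nat.one_le_iff_ne_zero.2 (by
      have e1 : m ≠ 0 := by rintro rfl; simp at hmr
      have e2 : S ≠ 0 := by rintro rfl; simp at hSr
      have e3 : H ≠ 0 := by omega
      have e4 : K ≠ 0 := NeZero.ne K
      positivity)
    exact_mod_cast this
  have hp2 : p ≤ 1 / 2 := by nlinarith
  have hι0 : 0 ≤ ι := by
    have : Real.exp (-ι) ≤ 1 := by linarith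
    rw [Real.exp_le_one_iff] at this
    linarith
  have hβ0 : ∀ j t, 1 ≤ t → t ≤ K → 0 ≤ ∑ i ∈ Finset.Icc 1 t, alphaW H t i * β j i := by
    intro j t h1 h2
    have := mul_nonneg hHr.le (hρ j t h1 h2)
    have := Real.sqrt_nonneg ((H : ℝ) ^ 3 * ι / t)
    linarith [hβ j t h1 h2]
  set ω₀ : Path S A := fun _ => (fun _ => 0, G.s₁)
  rw [ofReal_one_sub_le_iff _ _ _ hδ.le, trainLaw_compl_goodRecords_le ω₀]
  set μ := (pathFrom G H alg β (K * H) 0 ω₀).toOuterMeasure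
  set idx : Finset ((Fin m × Fin H) × (Fin S × Fin K)) := Finset.univ
  set F : (Fin m × Fin H) × (Fin S × Fin K) → Set (Path S A) := fun x =>
    regretFails G H alg β K (ρ x.1.1) x.1.1 x.1.2 x.2.1 (x.2.2 + 1) ∪
    (lowerFails G H alg β K ι x.1.1 x.1.2 x.2.1 (x.2.2 + 1) ∪
      upperFails G H alg β K ι x.1.1 x.1.2 x.2.1 (x.2.2 + 1)) with hF
  have hFx : ∀ x, μ (F x) ≤ ENNReal.ofReal (2 * p) := by
    intro x
    have ht2 : (x.2.2 : ℕ) + 1 ≤ K := x.2.2.2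
    have h1 : μ (regretFails G H alg β K (ρ x.1.1) x.1.1 x.1.2 x.2.1 (x.2.2 + 1)) ≤
        ENNReal.ofReal p := regretFails_le hH K _ _ x.1.2.2 _ _ _ (hβ0 _)
      (hreg _ _ (by omega) ht2) ω₀
    have h2 : μ (lowerFails G H alg β K ι x.1.1 x.1.2 x.2.1 (x.2.2 + 1)) ≤ _ :=
      lowerFails_le hH K ι hι0 _ x.1.2.2 _ _ (by omega) (hβ0 _) ω₀
    have h3 : μ (upperFails G H alg β K ι x.1.1 x.1.2 x.2.1 (x.2.2 + 1)) ≤ _ :=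
      upperFails_le hH K ι hι0 _ x.1.2.2 _ _ (by omega) ω₀
    -- The concentration events cost `p²` each, and `p + 2p² ≤ 2p` because `p ≤ 1/2`.
    have hexp : Real.exp (-2 * ι) = p * p := by
      rw [hp, ← Real.exp_add]; congr 1; ring
    rw [hexp] at h2 h3
    refine (MeasureTheory.measure_union_le _ _).trans ?_
    refine (add_le_add h1 ((MeasureTheory.measure_union_le _ _).trans (add_le_add h2 h3))).trans ?_
    rw [← ENNReal.ofReal_add (by positivity) (by positivity),
      ← ENNReal.ofReal_add (by positivity) (by positivity)]
    refine ENNReal.ofReal_le_ofReal ?_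
    nlinarith
  have hsub : {ω | pathEpisode G H β ω ∉ goodRecords G H K alg ε} ⊆ ⋃ x ∈ idx, F x := by
    intro ω hω
    by_contra hcon
    apply hω
    have hnot : ∀ j, ∀ h < H, ∀ s, ∀ t ∈ Finset.Icc 1 ((pathEpisode G H β ω K j).N h s),
        ω ∉ regretFails G H alg β K (ρ j) j h s t ∧ ω ∉ lowerFails G H alg β K ι j h s t ∧
          ω ∉ upperFails G H alg β K ι j h s t := by
      intro j h hh s t ht
      have ht := Finset.mem_Icc.1 ht
      have hNK := (isRun_path (G := G) (β := β) ω hH).N_le j hh s K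
      have : ω ∉ F ((j, ⟨h, hh⟩), (s, ⟨t - 1, by omega⟩)) := by
        intro hmem
        exact hcon (Set.mem_biUnion (Finset.mem_coe.2 (Finset.mem_univ _)) hmem)
      simp only [hF, Set.mem_union, not_or, Nat.sub_add_cancel ht.1] at this
      exact this
    have hw : ∀ t : ℕ, 3 * √((H : ℝ) ^ 3 * ι / t) = H * (3 * √(H * ι / t)) := by
      intro t
      rw [show (H : ℝ) ^ 3 * ι / t = (H : ℝ) ^ 2 * (H * ι / t) by ring,
        Real.sqrt_mul (by positivity), Real.sqrt_sq hHr.le]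
      ring
    intro j
    have hR := isRun_path (G := G) (β := β) ω hH
    have hgood : GoodEvents G H K alg (pathEpisode G H β ω) (fun k h => (ω (k * H + h)).1)
        (fun k h => (ω (k * H + h)).2) (ρ j) (fun t => H * (3 * √(H * ι / t))) j := by
      constructor
      · intro h hh s t ht b
        by_contra hlt
        exact (hnot j h hh s t ht).1 ⟨(Finset.mem_Icc.1 ht).2, b, not_le.1 hlt⟩
      · intro h hh s t ht
        by_contra hlt
        exact (hnot j h hh s t ht).2.1 ⟨(Finset.mem_Icc.1 ht).2, not_le.1 hlt⟩
      · intro h hh s t ht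
        by_contra hlt
        exact (hnot j h hh s t ht).2.2 ⟨(Finset.mem_Icc.1 ht).2, not_le.1 hlt⟩
    -- The budget `ε K / (3H)` is chosen so that the final factor `3H / K` returns `ε`.
    have hfin := bestResponseValue_sub_value_le hR hgood (hρ j) (fun t _ _ => by positivity)
      (fun t h1 h2 => by rw [← hw]; exact hβ j t h1 h2) (ε * K / (3 * H))
      (fun M hM => by
        have := hB j M hM
        rw [div_mul_eq_mul_div, div_le_iff₀ hKr] at this
        rw [le_div_iff₀ (by positivity)]
        linarith) (by positivity)
    refine hfin.trans_eq ?_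
    field_simp
  calc μ {ω | pathEpisode G H β ω ∉ goodRecords G H K alg ε} ≤ μ (⋃ x ∈ idx, F x) :=
        MeasureTheory.measure_mono hsub
    _ ≤ ∑ x ∈ idx, μ (F x) := MeasureTheory.measure_biUnion_finset_le _ _
    _ ≤ ∑ x ∈ idx, ENNReal.ofReal (2 * p) := Finset.sum_le_sum fun x _ => hFx x
    _ = ENNReal.ofReal ((m * H * S * K : ℝ) * (2 * p)) := by
        rw [Finset.sum_const, nsmul_eq_mul,
          ENNReal.ofReal_mul (p := (m * H * S * K : ℝ)) (by positivity)]
        congr 1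
        simp only [idx, Finset.card_univ, Fintype.card_prod, Fintype.card_fin]
        rw [← ENNReal.ofReal_natCast]
        congr 1
        push_cast
        ring
    _ ≤ ENNReal.ofReal δ := by
        refine ENNReal.ofReal_le_ofReal ?_
        linarith

end Core

/-! ### Sums along the history of a bandit -/

section Ftrl

/-- Sum of `g` over the rounds of a history; `g` sees the past, the action and the loss. -/
def histSum {B : ℕ} (g : List (Fin B × ℝ) → Fin B → ℝ → ℝ) : List (Fin B × ℝ) → ℝ
  | [] => 0
  | (b, y) :: τ => histSum g τ + g τ b y

theorem histSum_mono {B : ℕ} {g g' : List (Fin B × ℝ) → Fin B → ℝ → ℝ} (τ : List (Fin B × ℝ))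
    (hτ : ∀ x ∈ τ, x.2 ∈ Set.Icc (0 : ℝ) 1)
    (h : ∀ τ' b, ∀ y ∈ Set.Icc (0 : ℝ) 1, τ'.length < τ.length → g τ' b y ≤ g' τ' b y) :
    histSum g τ ≤ histSum g' τ := by
  induction τ with
  | nil => exact le_rfl
  | cons x τ ih =>
    obtain ⟨b, y⟩ := x
    refine add_le_add (ih (fun x hx => hτ x (List.mem_cons_of_mem _ hx))
      fun τ' b y hy hl => h τ' b y hy ?_) (h τ b y (hτ _ List.mem_cons_self) ?_)
    · rw [List.length_cons]; omega
    · rw [List.length_cons]; omega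

theorem histSum_congr {B : ℕ} {g g' : List (Fin B × ℝ) → Fin B → ℝ → ℝ} (τ : List (Fin B × ℝ))
    (h : ∀ τ' b y, τ'.length < τ.length → g τ' b y = g' τ' b y) :
    histSum g τ = histSum g' τ := by
  induction τ with
  | nil => rfl
  | cons x τ ih =>
    obtain ⟨b, y⟩ := x
    simp only [histSum]
    rw [ih fun τ' b y hl => h τ' b y (by rw [List.length_cons]; omega),
      h τ b y (by rw [List.length_cons]; omega)]

theorem histSum_const_mul {B : ℕ} (c : ℝ) (g : List (Fin B × ℝ) → Fin B → ℝ → ℝ)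
    (τ : List (Fin B × ℝ)) : histSum (fun τ b y => c * g τ b y) τ = c * histSum g τ := by
  induction τ with
  | nil => simp [histSum]
  | cons x τ ih => obtain ⟨b, y⟩ := x; simp only [histSum]; rw [ih]; ring

theorem histSum_add {B : ℕ} (g g' : List (Fin B × ℝ) → Fin B → ℝ → ℝ)
    (τ : List (Fin B × ℝ)) :
    histSum (fun τ b y => g τ b y + g' τ b y) τ = histSum g τ + histSum g' τ := by
  induction τ with
  | nil => simp [histSum]
  | cons x τ ih => obtain ⟨b, y⟩ := x; simp only [histSum]; rw [ih]; ring

theorem histSum_length {B : ℕ} (f : ℕ → ℝ) (τ : List (Fin B × ℝ)) :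
    histSum (fun τ _ _ => f (τ.length + 1)) τ = ∑ i ∈ Finset.Icc 1 τ.length, f i := by
  induction τ with
  | nil => simp [histSum]
  | cons x τ ih =>
    obtain ⟨b, y⟩ := x
    simp only [histSum]
    rw [ih, List.length_cons, Finset.sum_Icc_succ_top (by omega)]

/-! ### Exponential inequalities for the bandit protocol -/

theorem mem_support_banditLaw {B : ℕ} [NeZero B] {alg : BanditAlg B} {E : BanditEnv B} {n : ℕ}
    {r : BanditRun B E.X} (hr : r ∈ (banditLaw alg E n).support) :
    r.hist.length = n ∧ (∀ x ∈ r.hist, x.2 ∈ Set.Icc (0 : ℝ) 1) ∧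
      ∀ i ∈ Finset.Icc 1 n, (∀ b, r.ℓ i b ∈ Set.Icc (0 : ℝ) 1) ∧
        (∀ b, 0 ≤ r.θ i b) ∧ ∑ b, r.θ i b = 1 := by
  induction n generalizing r with
  | zero =>
    simp only [banditLaw, PMF.mem_support_map_iff] at hr
    obtain ⟨x, -, rfl⟩ := hr
    simp
  | succ n ih =>
    simp only [banditLaw, PMF.mem_support_bind_iff, PMF.mem_support_map_iff] at hr
    obtain ⟨r', hr', b, -, y, hy, rfl⟩ := hr
    obtain ⟨h1, h2, h3⟩ := ih hr'
    refine ⟨by simp [h1], ?_, ?_⟩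
    · intro x hx
      rcases List.mem_cons.1 hx with rfl | hx
      · exact E.feedback_mem _ _ _ hy
      · exact h2 x hx
    · intro i hi
      by_cases hin : i = n + 1
      · subst hin
        simp only [Function.update_self]
        exact ⟨fun b => E.loss_mem _ b, fun b => ENNReal.toReal_nonneg, sum_toReal_eq_one _⟩
      · simp only [Function.update_of_ne hin]
        have := Finset.mem_Icc.1 hi
        exact h3 i (Finset.mem_Icc.2 (by omega))

/-- An exponential supermartingale for the bandit protocol: conditionally on the past, the
exponential of `φ` is dominated by a function that is affine in the loss and has mean at most
`exp ψ`. -/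
theorem pexp_banditLaw_le_one {B : ℕ} [NeZero B] (alg : BanditAlg B) (E : BanditEnv B) (t : ℕ)
    (φ : List (Fin B × ℝ) → Fin B → ℝ → ℝ) (ψ : ℕ → (Fin B → ℝ) → (Fin B → ℝ) → ℝ)
    (u v : List (Fin B × ℝ) → Fin B → ℝ)
    (hu : ∀ τ b, τ.length < t → 0 ≤ u τ b) (huv : ∀ τ b, τ.length < t → 0 ≤ u τ b + v τ b)
    (hφ : ∀ τ b, ∀ y ∈ Set.Icc (0 : ℝ) 1, τ.length < t → Real.exp (φ τ b y) ≤ u τ b + v τ b * y)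
    (hψ : ∀ τ ℓ, (∀ b, ℓ b ∈ Set.Icc (0 : ℝ) 1) → τ.length < t →
      rexp (alg.strategy τ) (fun b => u τ b + v τ b * ℓ b) ≤
        Real.exp (ψ (τ.length + 1) (fun b => (alg.strategy τ b).toReal) ℓ))
    (n : ℕ) (hn : n ≤ t) :
    pexp (banditLaw alg E n) (fun r => ENNReal.ofReal (Real.exp
      (histSum φ r.hist - ∑ i ∈ Finset.Icc 1 n, ψ i (r.θ i) (r.ℓ i)))) ≤ 1 := by
  induction n with
  | zero =>
    rw [banditLaw, pexp_map]
    simp [histSum, pexp_const]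
  | succ n ih =>
    refine le_trans ?_ (ih (by omega))
    rw [banditLaw, pexp_bind]
    refine pexp_mono_support _ fun r hr => ?_
    obtain ⟨hlen, -, -⟩ := mem_support_banditLaw hr
    have hlt : r.hist.length < t := by omega
    set Ψ := ψ (n + 1) (fun b => (alg.strategy r.hist b).toReal) (E.loss r.env) with hΨ
    set Y := histSum φ r.hist - ∑ i ∈ Finset.Icc 1 n, ψ i (r.θ i) (r.ℓ i) with hY
    rw [pexp_bind]
    have h1 : ∀ b, pexp ((E.respond r.env b).map fun y => ({
          env := y.2
          hist := (b, y.1) :: r.hist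
          θ := Function.update r.θ (n + 1) fun b' => (alg.strategy r.hist b').toReal
          ℓ := Function.update r.ℓ (n + 1) (E.loss r.env) } : BanditRun B E.X))
        (fun r => ENNReal.ofReal (Real.exp
          (histSum φ r.hist - ∑ i ∈ Finset.Icc 1 (n + 1), ψ i (r.θ i) (r.ℓ i)))) ≤
        ENNReal.ofReal (Real.exp (Y - Ψ)) *
          ENNReal.ofReal (u r.hist b + v r.hist b * E.loss r.env b) := by
      intro b
      -- Because the dominating function is affine in the observed loss, averaging over the feedback
      -- only inserts its conditional mean.
      rw [pexp_map, ← E.feedback_mean r.env b, ← pexp_affine _ _ (E.feedback_mem r.env b) _ _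
        (hu _ b hlt) (huv _ b hlt), ← pexp_const_mul]
      refine pexp_mono_support _ fun y hy => ?_
      rw [← ENNReal.ofReal_mul (Real.exp_pos _).le]
      refine ENNReal.ofReal_le_ofReal ?_
      have hsum : ∑ i ∈ Finset.Icc 1 (n + 1),
          ψ i (Function.update r.θ (n + 1) (fun b' => (alg.strategy r.hist b').toReal) i)
            (Function.update r.ℓ (n + 1) (E.loss r.env) i) =
          ∑ i ∈ Finset.Icc 1 n, ψ i (r.θ i) (r.ℓ i) + Ψ := by
        rw [Finset.sum_Icc_succ_top (by omega), Function.update_self, Function.update_self]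
        congr 1
        refine Finset.sum_congr rfl fun i hi => ?_
        have := (Finset.mem_Icc.1 hi).2
        rw [Function.update_of_ne (by omega), Function.update_of_ne (by omega)]
      simp only [histSum]
      rw [hsum, show histSum φ r.hist + φ r.hist b y.1 -
        (∑ i ∈ Finset.Icc 1 n, ψ i (r.θ i) (r.ℓ i) + Ψ) = (Y - Ψ) + φ r.hist b y.1 by
          rw [hY]; ring, Real.exp_add]
      exact mul_le_mul_of_nonneg_left (hφ _ _ _ (E.feedback_mem r.env b y hy) hlt)
        (Real.exp_pos _).le
    refine (pexp_mono _ h1).trans ?_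
    rw [pexp_const_mul, pexp_ofReal]
    · rw [← ENNReal.ofReal_mul (Real.exp_pos _).le]
      refine ENNReal.ofReal_le_ofReal ?_
      calc _ ≤ Real.exp (Y - Ψ) * Real.exp Ψ := by
            refine mul_le_mul_of_nonneg_left ?_ (Real.exp_pos _).le
            have := hψ r.hist (E.loss r.env) (E.loss_mem r.env) hlt
            rwa [hlen] at this
        _ = Real.exp Y := by rw [← Real.exp_add]; congr 1; ring
    · intro b
      have h2 := E.loss_mem r.env b
      have h3 := hu r.hist b hlt
      have h4 := huv r.hist b hlt
      nlinarith [h2.1, h2.2, mul_nonneg h3 (sub_nonneg.2 h2.2), mul_nonneg h4 h2.1]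

/-- Tail bound for an exponential supermartingale. -/
theorem banditLaw_tail {B : ℕ} [NeZero B] (alg : BanditAlg B) (E : BanditEnv B) (t : ℕ)
    (φ : List (Fin B × ℝ) → Fin B → ℝ → ℝ) (ψ : ℕ → (Fin B → ℝ) → (Fin B → ℝ) → ℝ)
    (h : pexp (banditLaw alg E t) (fun r => ENNReal.ofReal (Real.exp
      (histSum φ r.hist - ∑ i ∈ Finset.Icc 1 t, ψ i (r.θ i) (r.ℓ i)))) ≤ 1) (x : ℝ) :
    (banditLaw alg E t).toOuterMeasure
      {r | x < histSum φ r.hist - ∑ i ∈ Finset.Icc 1 t, ψ i (r.θ i) (r.ℓ i)} ≤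
      ENNReal.ofReal (Real.exp (-x)) := by
  have := toOuterMeasure_le_of_pexp_le _
    {r | x < histSum φ r.hist - ∑ i ∈ Finset.Icc 1 t, ψ i (r.θ i) (r.ℓ i)} _
    (ENNReal.ofReal (Real.exp (-x))) 1 ?_ h
  · simpa using this
  · intro r hr
    rw [← ENNReal.ofReal_mul (Real.exp_pos _).le, ← Real.exp_add, ENNReal.one_le_ofReal,
      Real.one_le_exp_iff]
    have : x < _ := hr
    linarith

/-! ### Exponential weights -/

theorem expWeights_pos {B : ℕ} [NeZero B] (c : ℝ) (L : Fin B → ℝ) (b : Fin B) :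
    0 < expWeights c L b :=
  div_pos (Real.exp_pos _) (Finset.sum_pos (fun _ _ => Real.exp_pos _) ⟨0, Finset.mem_univ _⟩)

theorem sum_expWeights {B : ℕ} [NeZero B] (c : ℝ) (L : Fin B → ℝ) : ∑ b, expWeights c L b = 1 := by
  have : 0 < ∑ b, Real.exp (-c * L b) :=
    Finset.sum_pos (fun _ _ => Real.exp_pos _) ⟨0, Finset.mem_univ _⟩
  unfold expWeights
  rw [← Finset.sum_div, div_self this.ne']

/-- The strategy of FTRL after the history `τ`. -/
def ftrlStrategy (w η γ : ℕ → ℝ) {B : ℕ} (τ : List (Fin B × ℝ)) (b : Fin B) : ℝ :=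
  expWeights (η τ.length / w τ.length) (ftrlLoss w η γ τ) b

/-- The loss estimate of the played action. -/
def ftrlEst (w η γ : ℕ → ℝ) {B : ℕ} (τ : List (Fin B × ℝ)) (b : Fin B) (y : ℝ) : ℝ :=
  y / (ftrlStrategy w η γ τ b + γ (τ.length + 1))

theorem ftrl_strategy {w η γ : ℕ → ℝ} {B : ℕ} [NeZero B] (τ : List (Fin B × ℝ)) (b : Fin B) :
    ((ftrl w η γ B).strategy τ b).toReal = ftrlStrategy w η γ τ b := by
  unfold BanditAlg.strategy
  split_ifs with h
  · subst h
    simp [PMF.uniformOfFintype_apply, ftrlStrategy, expWeights, ftrlLoss]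
  · unfold ftrl
    rw [PMF.ofFintype_apply, ENNReal.toReal_ofReal (expWeights_pos _ _ _).le]
    rfl

theorem ftrlLoss_eq_histSum (w η γ : ℕ → ℝ) {B : ℕ} (τ : List (Fin B × ℝ)) (b : Fin B) :
    ftrlLoss w η γ τ b = histSum (fun τ b₀ y => w (τ.length + 1) *
      (if b₀ = b then ftrlEst w η γ τ b₀ y else 0)) τ := by
  induction τ with
  | nil => rfl
  | cons x τ ih =>
    obtain ⟨b₀, y⟩ := x
    simp only [ftrlLoss, histSum, ih]
    congr 2
    split_ifs with h
    · subst h; rfl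
    · simp

/-- The potential of exponential weights. -/
def softMin {B : ℕ} (c : ℝ) (L : Fin B → ℝ) : ℝ :=
  -(1 / c) * Real.log (1 / (B : ℝ) * ∑ b, Real.exp (-c * L b))

section softMin

variable {B : ℕ} [NeZero B]

theorem mean_exp_pos (c : ℝ) (L : Fin B → ℝ) :
    0 < 1 / (B : ℝ) * ∑ b, Real.exp (-c * L b) := by
  have : (0 : ℝ) < B := by exact_mod_cast NeZero.pos B
  exact mul_pos (by positivity)
    (Finset.sum_pos (fun _ _ => Real.exp_pos _) ⟨0, Finset.mem_univ _⟩)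

/-- Only the summand of `b` is kept; the uniform prior costs `log B / c`. -/
theorem softMin_le {c : ℝ} (hc : 0 < c) (L : Fin B → ℝ) (b : Fin B) :
    softMin c L ≤ L b + Real.log B / c := by
  have hB : (0 : ℝ) < B := by exact_mod_cast NeZero.pos B
  have h1 : 1 / (B : ℝ) * Real.exp (-c * L b) ≤ 1 / (B : ℝ) * ∑ b, Real.exp (-c * L b) :=
    mul_le_mul_of_nonneg_left (Finset.single_le_sum (f := fun b => Real.exp (-c * L b))
      (fun _ _ => (Real.exp_pos _).le) (Finset.mem_univ b)) (by positivity)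
  have h2 := Real.log_le_log (by positivity) h1
  rw [Real.log_mul (by positivity) (Real.exp_pos _).ne', Real.log_exp, one_div,
    Real.log_inv] at h2
  unfold softMin
  rw [one_div (B : ℝ)]
  have h3 : L b + Real.log B / c = -(1 / c) * (-Real.log B + -c * L b) := by field_simp; ring
  rw [h3]
  exact mul_le_mul_of_nonpos_left h2 (neg_nonpos.2 (by positivity))

theorem softMin_mono {c : ℝ} (hc : 0 < c) {L L' : Fin B → ℝ} (h : ∀ b, L b ≤ L' b) :
    softMin c L ≤ softMin c L' := by
  unfold softMin
  refine mul_le_mul_of_nonpos_left (Real.log_le_log (mean_exp_pos c L') ?_)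
    (neg_nonpos.2 (by positivity))
  refine mul_le_mul_of_nonneg_left (Finset.sum_le_sum fun b _ => ?_) (by positivity)
  rw [Real.exp_le_exp]
  nlinarith [h b]

theorem softMin_zero (c : ℝ) : softMin c (fun _ : Fin B => 0) = 0 := by
  have hB : (B : ℝ) ≠ 0 := by exact_mod_cast NeZero.ne B
  simp [softMin, hB]

/-- The potential is non-increasing in the learning rate. -/
theorem softMin_anti {c c' : ℝ} (hc' : 0 < c') (hcc : c' ≤ c) (L : Fin B → ℝ) :
    softMin c L ≤ softMin c' L := by
  have hB : (0 : ℝ) < B := by exact_mod_cast NeZero.pos B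
  have hc : 0 < c := hc'.trans_le hcc
  -- The power mean inequality with exponent `c / c' ≥ 1`, applied to the numbers `exp (-c' L b)`.
  have h1 := Real.rpow_arith_mean_le_arith_mean_rpow Finset.univ (fun _ : Fin B => 1 / (B : ℝ))
    (fun b => Real.exp (-c' * L b)) (fun _ _ => by positivity)
    (by simp [hB.ne']) (fun _ _ => (Real.exp_pos _).le) (p := c / c')
    ((one_le_div hc').2 hcc)
  simp only [← Real.exp_mul, ← Finset.mul_sum] at h1
  have h2 : ∀ b, Real.exp (-c' * L b * (c / c')) = Real.exp (-c * L b) := by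
    intro b; congr 1; field_simp
  simp only [h2] at h1
  have h3 := Real.log_le_log (Real.rpow_pos_of_pos (mean_exp_pos c' L) _) h1
  rw [Real.log_rpow (mean_exp_pos c' L)] at h3
  unfold softMin
  have h4 : -(1 / c') * Real.log (1 / (B : ℝ) * ∑ b, Real.exp (-c' * L b)) =
      -(1 / c) * (c / c' * Real.log (1 / (B : ℝ) * ∑ b, Real.exp (-c' * L b))) := by
    field_simp
  rw [h4]
  exact mul_le_mul_of_nonpos_left h3 (neg_nonpos.2 (by positivity))

/-- One step of exponential weights. -/
theorem expWeights_step {c : ℝ} (hc : 0 < c) (L x : Fin B → ℝ) (hx : ∀ b, 0 ≤ x b) :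
    ∑ b, expWeights c L b * x b ≤ softMin c (fun b => L b + x b) - softMin c L +
      c / 2 * ∑ b, expWeights c L b * x b ^ 2 := by
  have hM := mean_exp_pos (B := B) c L
  have hM' := mean_exp_pos (B := B) c (fun b => L b + x b)
  have hB : (B : ℝ) ≠ 0 := by exact_mod_cast NeZero.ne B
  have hsum : 0 < ∑ b, Real.exp (-c * L b) :=
    Finset.sum_pos (fun _ _ => Real.exp_pos _) ⟨0, Finset.mem_univ _⟩
  have hratio : (1 / (B : ℝ) * ∑ b, Real.exp (-c * (L b + x b))) /
      (1 / (B : ℝ) * ∑ b, Real.exp (-c * L b)) =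
      ∑ b, expWeights c L b * Real.exp (-(c * x b)) := by
    rw [mul_div_mul_left _ _ (by positivity), Finset.sum_div]
    refine Finset.sum_congr rfl fun b _ => ?_
    unfold expWeights
    rw [show -c * (L b + x b) = -c * L b + -(c * x b) by ring, Real.exp_add]
    ring
  have hle : ∑ b, expWeights c L b * Real.exp (-(c * x b)) ≤
      1 - c * ∑ b, expWeights c L b * x b + c ^ 2 / 2 * ∑ b, expWeights c L b * x b ^ 2 := by
    calc _ ≤ ∑ b, expWeights c L b * (1 - c * x b + (c * x b) ^ 2 / 2) :=
          Finset.sum_le_sum fun b _ => mul_le_mul_of_nonneg_left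
            (exp_neg_le_quadratic (mul_nonneg hc.le (hx b))) (expWeights_pos _ _ _).le
      _ = ∑ b, (expWeights c L b - c * (expWeights c L b * x b) +
            c ^ 2 / 2 * (expWeights c L b * x b ^ 2)) :=
          Finset.sum_congr rfl fun b _ => by ring
      _ = _ := by
          rw [Finset.sum_add_distrib, Finset.sum_sub_distrib, sum_expWeights, Finset.mul_sum,
            Finset.mul_sum]
  -- The ratio of the two means is an expectation under the current strategy; `log u ≤ u - 1` and
  -- the quadratic bound for the exponential finish the step.
  have hlog : Real.log (1 / (B : ℝ) * ∑ b, Real.exp (-c * (L b + x b))) -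
      Real.log (1 / (B : ℝ) * ∑ b, Real.exp (-c * L b)) ≤
      - c * ∑ b, expWeights c L b * x b + c ^ 2 / 2 * ∑ b, expWeights c L b * x b ^ 2 := by
    rw [← Real.log_div hM'.ne' hM.ne']
    have := Real.log_le_sub_one_of_pos (div_pos hM' hM)
    rw [hratio] at this ⊢
    linarith
  have h2 : softMin c (fun b => L b + x b) - softMin c L = -(1 / c) *
      (Real.log (1 / (B : ℝ) * ∑ b, Real.exp (-c * (L b + x b))) -
      Real.log (1 / (B : ℝ) * ∑ b, Real.exp (-c * L b))) := by
    unfold softMin; ring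
  have h3 := mul_le_mul_of_nonpos_left hlog (show -(1 / c) ≤ 0 from neg_nonpos.2 (by positivity))
  rw [h2]
  have h4 : -(1 / c) * (- c * ∑ b, expWeights c L b * x b +
      c ^ 2 / 2 * ∑ b, expWeights c L b * x b ^ 2) =
      ∑ b, expWeights c L b * x b - c / 2 * ∑ b, expWeights c L b * x b ^ 2 := by
    field_simp
    ring
  rw [h4] at h3
  linarith

end softMin

/-- The regret of FTRL against the estimated losses. The first `H` rounds are bounded
trivially. -/
theorem ftrl_regret_le {w η γ : ℕ → ℝ} {B : ℕ} [NeZero B] (H : ℕ) (hH : 1 ≤ H)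
    (hw : ∀ n, 1 ≤ n → 0 < w n) (hη : ∀ n, 1 ≤ n → 0 < η n) (hγ : ∀ n, 1 ≤ n → 0 < γ n)
    (hwmono : ∀ n, 1 ≤ n → w n ≤ w (n + 1)) (hηanti : ∀ n, 1 ≤ n → η (n + 1) ≤ η n)
    (hw2 : ∀ n, H ≤ n → w (n + 1) ≤ 2 * w n) (hη2 : ∀ n, 1 ≤ n → η n ≤ 2 * η (n + 1))
    (τ : List (Fin B × ℝ)) (hτ : ∀ x ∈ τ, x.2 ∈ Set.Icc (0 : ℝ) 1) (hne : τ ≠ []) (b : Fin B) :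
    histSum (fun τ b y => w (τ.length + 1) * (ftrlStrategy w η γ τ b * ftrlEst w η γ τ b y)) τ ≤
      ftrlLoss w η γ τ b + Real.log B * (w τ.length / η τ.length) +
      histSum (fun τ b y => if τ.length + 1 ≤ H then w (τ.length + 1) else
        w (τ.length + 1) * (2 * η (τ.length + 1) * ftrlEst w η γ τ b y)) τ := by
  have hstr : ∀ τ b, 0 < ftrlStrategy w η γ (B := B) τ b := fun τ b => expWeights_pos _ _ _
  have hest : ∀ (τ : List (Fin B × ℝ)) b, ∀ y ∈ Set.Icc (0 : ℝ) 1, 0 ≤ ftrlEst w η γ τ b y ∧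
      ftrlStrategy w η γ τ b * ftrlEst w η γ τ b y ≤ 1 := by
    intro τ b y hy
    have h1 := hstr τ b
    have h2 := hγ (τ.length + 1) (by omega)
    unfold ftrlEst
    refine ⟨div_nonneg hy.1 (by positivity), ?_⟩
    rw [mul_div_assoc', div_le_one (by positivity)]
    nlinarith [hy.1, hy.2]
  have hloss : ∀ τ : List (Fin B × ℝ), (∀ x ∈ τ, x.2 ∈ Set.Icc (0 : ℝ) 1) →
      ∀ b, 0 ≤ ftrlLoss w η γ τ b := by
    intro τ hτ b
    rw [ftrlLoss_eq_histSum]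
    have h0 : histSum (fun (_ : List (Fin B × ℝ)) _ _ => (0 : ℝ)) τ = 0 := by
      have := histSum_length (B := B) (fun _ => (0 : ℝ)) τ
      simpa using this
    refine le_of_eq_of_le h0.symm (histSum_mono τ hτ fun τ' b' y hy _ => ?_)
    refine mul_nonneg (hw (τ'.length + 1) (by omega)).le ?_
    split_ifs
    · exact (hest τ' b' y hy).1
    · exact le_rfl
  -- The potential at the current learning rate absorbs the weighted played losses. It can only grow
  -- when the rate `η / w` falls, so the per-round inequalities add up.
  have key : histSum (fun τ b y => w (τ.length + 1) *
        (ftrlStrategy w η γ τ b * ftrlEst w η γ τ b y)) τ ≤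
      softMin (η τ.length / w τ.length) (ftrlLoss w η γ τ) +
      histSum (fun τ b y => if τ.length + 1 ≤ H then w (τ.length + 1) else
        w (τ.length + 1) * (2 * η (τ.length + 1) * ftrlEst w η γ τ b y)) τ := by
    induction τ with
    | nil => exact absurd rfl hne
    | cons z τ ih =>
      obtain ⟨b₀, y⟩ := z
      have hy : y ∈ Set.Icc (0 : ℝ) 1 := hτ (b₀, y) List.mem_cons_self
      have hτ' : ∀ x ∈ τ, x.2 ∈ Set.Icc (0 : ℝ) 1 := fun x hx => hτ x (List.mem_cons_of_mem _ hx)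
      have hw1 := hw (τ.length + 1) (by omega)
      have hη1 := hη (τ.length + 1) (by omega)
      have hrate : 0 < η (τ.length + 1) / w (τ.length + 1) := div_pos hη1 hw1
      set x : Fin B → ℝ := fun b => w (τ.length + 1) *
        (if b₀ = b then ftrlEst w η γ τ b₀ y else 0) with hx
      have hx0 : ∀ b, 0 ≤ x b := by
        intro b
        refine mul_nonneg hw1.le ?_
        split_ifs
        · exact (hest τ b₀ y hy).1
        · exact le_rfl
      have hL : ftrlLoss w η γ ((b₀, y) :: τ) = fun b => ftrlLoss w η γ τ b + x b := by
        funext b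
        rw [ftrlLoss_eq_histSum, ftrlLoss_eq_histSum]
        rfl
      have hlin : ∑ b, ftrlStrategy w η γ τ b * x b = w (τ.length + 1) *
          (ftrlStrategy w η γ τ b₀ * ftrlEst w η γ τ b₀ y) := by
        rw [Finset.sum_eq_single b₀]
        · simp [hx]; ring
        · intro b _ hb; simp [hx, Ne.symm hb]
        · simp
      have hquad : ∑ b, ftrlStrategy w η γ τ b * x b ^ 2 ≤
          w (τ.length + 1) ^ 2 * ftrlEst w η γ τ b₀ y := by
        rw [Finset.sum_eq_single b₀]
        · have h1 := hest τ b₀ y hy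
          have h2 : ftrlStrategy w η γ τ b₀ * x b₀ ^ 2 = w (τ.length + 1) ^ 2 *
              ((ftrlStrategy w η γ τ b₀ * ftrlEst w η γ τ b₀ y) * ftrlEst w η γ τ b₀ y) := by
            simp [hx]; ring
          rw [h2]
          refine mul_le_mul_of_nonneg_left ?_ (sq_nonneg _)
          exact mul_le_of_le_one_left h1.1 h1.2
        · intro b _ hb; simp [hx, Ne.symm hb]
        · simp
      simp only [histSum, List.length_cons]
      have hle1 : w (τ.length + 1) * (ftrlStrategy w η γ τ b₀ * ftrlEst w η γ τ b₀ y) ≤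
          w (τ.length + 1) := mul_le_of_le_one_right hw1.le (hest τ b₀ y hy).2
      -- The rate with index `0` is unconstrained, so the first round is charged in full, as `H ≥ 1`
      -- allows; the potential after it is nonnegative.
      by_cases hnil : τ = []
      · subst hnil
        have h0 : 0 ≤ softMin (η ([] : List (Fin B × ℝ)).length.succ /
            w ([] : List (Fin B × ℝ)).length.succ) (ftrlLoss w η γ [(b₀, y)]) := by
          rw [← softMin_zero (B := B) (η ([] : List (Fin B × ℝ)).length.succ /
            w ([] : List (Fin B × ℝ)).length.succ)]
          exact softMin_mono hrate fun b => hloss _ hτ b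
        simp only [List.length_nil, zero_add, histSum, if_pos hH, Nat.succ_eq_add_one] at h0 hle1 ⊢
        linarith
      · have hn1 : 1 ≤ τ.length := List.length_pos_iff.2 hnil
        have hih := ih hτ' hnil
        have hwn := hw τ.length hn1
        have hηn := hη τ.length hn1
        have hraten : 0 < η τ.length / w τ.length := div_pos hηn hwn
        have hanti : softMin (η τ.length / w τ.length) (ftrlLoss w η γ ((b₀, y) :: τ)) ≤
            softMin (η (τ.length + 1) / w (τ.length + 1)) (ftrlLoss w η γ ((b₀, y) :: τ)) := by
          refine softMin_anti hrate ?_ _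
          exact div_le_div₀ hηn.le (hηanti _ hn1) hwn (hwmono _ hn1)
        -- In the first `H` rounds `w` may grow by more than a factor two, so the played loss is
        -- bounded by `w` itself and monotonicity of the potential suffices.
        split_ifs with hle
        · have hmono : softMin (η τ.length / w τ.length) (ftrlLoss w η γ τ) ≤
              softMin (η τ.length / w τ.length) (ftrlLoss w η γ ((b₀, y) :: τ)) := by
            rw [hL]
            exact softMin_mono hraten fun b => le_add_of_nonneg_right (hx0 b)
          linarith
        · have hstep := expWeights_step hraten (ftrlLoss w η γ τ) x hx0
          rw [← hL] at hstep
          change ∑ b, ftrlStrategy w η γ τ b * x b ≤ _ +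
            _ * ∑ b, ftrlStrategy w η γ τ b * x b ^ 2 at hstep
          rw [hlin] at hstep
          -- The strategy of round `n + 1` uses the rate of round `n`; `w_{n+1} ≤ 2 w_n` and `η_n ≤
          -- 2 η_{n+1}` convert the second-order term to quantities of the current round.
          have h5 : η τ.length / w τ.length / 2 * ∑ b, ftrlStrategy w η γ τ b * x b ^ 2 ≤
              w (τ.length + 1) * (2 * η (τ.length + 1) * ftrlEst w η γ τ b₀ y) := by
            have he := (hest τ b₀ y hy).1
            calc _ ≤ η τ.length / w τ.length / 2 * (w (τ.length + 1) ^ 2 *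
                  ftrlEst w η γ τ b₀ y) := mul_le_mul_of_nonneg_left hquad (by positivity)
              _ = (η τ.length * (w (τ.length + 1) / (2 * w τ.length))) *
                  (w (τ.length + 1) * ftrlEst w η γ τ b₀ y) := by field_simp
              _ ≤ (2 * η (τ.length + 1) * 1) * (w (τ.length + 1) * ftrlEst w η γ τ b₀ y) := by
                  refine mul_le_mul_of_nonneg_right ?_ (by positivity)
                  refine mul_le_mul (hη2 _ hn1) ?_ (by positivity) (by positivity)
                  rw [div_le_one (by positivity)]
                  exact hw2 _ (by omega)
              _ = _ := by ring
          linarith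
  have hlen : 1 ≤ τ.length := List.length_pos_iff.2 hne
  have h1 := softMin_le (div_pos (hη _ hlen) (hw _ hlen)) (ftrlLoss w η γ τ) b
  rw [div_div_eq_mul_div, mul_div_assoc] at h1
  linarith

/-! ### Concentration of the loss estimates -/

/-- The heart of implicit exploration: with `z = c y / θ`, the inequality `2z / (z + 2) ≤ log (1 +
z)` dominates the biased exponent as soon as `c y ≤ 2γ`. The right side is the unbiased estimate,
affine in the loss. -/
theorem exp_mul_div_le {c γ θ y : ℝ} (hc : 0 ≤ c) (hcγ : c ≤ 2 * γ) (hγ : 0 < γ) (hθ : 0 < θ)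
    (hy : y ∈ Set.Icc (0 : ℝ) 1) : Real.exp (c * (y / (θ + γ))) ≤ 1 + c / θ * y := by
  have hz : 0 ≤ c / θ * y := mul_nonneg (by positivity) hy.1
  rw [← Real.le_log_iff_exp_le (by linarith)]
  refine le_trans ?_ (Real.le_log_one_add_of_nonneg hz)
  have e : 2 * (c / θ * y) / (c / θ * y + 2) = 2 * c * y / (c * y + 2 * θ) := by
    field_simp
  rw [e, mul_div_assoc', div_le_div_iff₀ (by positivity)
    (by have := mul_nonneg hc hy.1; positivity)]
  have h1 : c * y ≤ 2 * γ := (mul_le_of_le_one_right hc hy.2).trans hcγ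
  have h2 : 0 ≤ c * y := mul_nonneg hc hy.1
  nlinarith [mul_le_mul_of_nonneg_left h1 h2]

/-- Implicit exploration: the loss estimates rarely exceed the losses by much. -/
theorem ftrl_est_tail {w η γ : ℕ → ℝ} {B : ℕ} [NeZero B] (E : BanditEnv B) (t : ℕ)
    (hγ : ∀ n, 1 ≤ n → 0 < γ n) (c : ℕ → Fin B → ℝ)
    (hc : ∀ i b, 1 ≤ i → i ≤ t → 0 ≤ c i b ∧ c i b ≤ 2 * γ i) (x : ℝ) :
    (banditLaw (ftrl w η γ B) E t).toOuterMeasure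
      {r | x < histSum (fun τ b y => c (τ.length + 1) b * ftrlEst w η γ τ b y) r.hist -
        ∑ i ∈ Finset.Icc 1 t, ∑ b, c i b * r.ℓ i b} ≤ ENNReal.ofReal (Real.exp (-x)) := by
  -- Averaging `1 + (c/θ) ℓ` over the played action cancels `θ` and gives `1 + ∑ c ℓ ≤ exp (∑ c ℓ)`.
  have hmain := pexp_banditLaw_le_one (ftrl w η γ B) E t
    (fun τ b y => c (τ.length + 1) b * ftrlEst w η γ τ b y) (fun i _ ℓ => ∑ b, c i b * ℓ b)
    (fun _ _ => 1) (fun τ b => c (τ.length + 1) b / ftrlStrategy w η γ τ b)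
    (fun _ _ _ => zero_le_one) ?_ ?_ ?_ t le_rfl
  · exact banditLaw_tail (ftrl w η γ B) E t
      (fun τ b y => c (τ.length + 1) b * ftrlEst w η γ τ b y) (fun i _ ℓ => ∑ b, c i b * ℓ b)
      hmain x
  · intro τ b hτ
    have := (hc (τ.length + 1) b (by omega) (by omega)).1
    have h2 : 0 < ftrlStrategy w η γ τ b := expWeights_pos _ _ _
    positivity
  · intro τ b y hy hτ
    have h1 := hc (τ.length + 1) b (by omega) (by omega)
    exact exp_mul_div_le h1.1 h1.2 (hγ _ (by omega)) (expWeights_pos _ _ _) hy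
  · intro τ ℓ hℓ hτ
    unfold rexp
    simp only [ftrl_strategy]
    have h1 : ∑ b, ftrlStrategy w η γ τ b * (1 + c (τ.length + 1) b / ftrlStrategy w η γ τ b * ℓ b)
        = 1 + ∑ b, c (τ.length + 1) b * ℓ b := by
      have h2 : ∑ b, ftrlStrategy w η γ τ b = 1 := sum_expWeights _ _
      rw [← h2, ← Finset.sum_add_distrib]
      refine Finset.sum_congr rfl fun b _ => ?_
      have h3 : ftrlStrategy w η γ τ b ≠ 0 := (expWeights_pos _ _ _).ne'
      rw [h2]
      field_simp
    rw [h1, add_comm]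
    exact Real.add_one_le_exp _

/-- Azuma's inequality for the estimated loss of FTRL. -/
theorem ftrl_play_tail {w η γ : ℕ → ℝ} {B : ℕ} [NeZero B] (E : BanditEnv B) (t : ℕ)
    (hγ : ∀ n, 1 ≤ n → 0 < γ n) (c : ℕ → ℝ) (hc : ∀ i, 0 ≤ c i) (x : ℝ) :
    (banditLaw (ftrl w η γ B) E t).toOuterMeasure
      {r | x < histSum (fun τ b y => -(c (τ.length + 1) *
          (ftrlStrategy w η γ τ b * ftrlEst w η γ τ b y))) r.hist -
        ∑ i ∈ Finset.Icc 1 t, (c i ^ 2 / 2 -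
          c i * ∑ b, r.θ i b * (r.θ i b / (r.θ i b + γ i)) * r.ℓ i b)} ≤
      ENNReal.ofReal (Real.exp (-x)) := by
  have hfrac : ∀ (τ : List (Fin B × ℝ)) b,
      0 ≤ ftrlStrategy w η γ τ b / (ftrlStrategy w η γ τ b + γ (τ.length + 1)) ∧
      ftrlStrategy w η γ τ b / (ftrlStrategy w η γ τ b + γ (τ.length + 1)) ≤ 1 := by
    intro τ b
    have h1 : 0 < ftrlStrategy w η γ τ b := expWeights_pos _ _ _
    have h2 := hγ (τ.length + 1) (by omega)
    exact ⟨by positivity, by rw [div_le_one (by positivity)]; linarith⟩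
  -- The played estimate `θ y / (θ + γ)` lies in `[0, 1]`, so its lower tail follows from `exp (-z)
  -- ≤ 1 - z + z²/2` with the square replaced by `c²`. The dominating function stays nonnegative
  -- because `1 + c²/2 ≥ c`.
  have hmain := pexp_banditLaw_le_one (ftrl w η γ B) E t
    (fun τ b y => -(c (τ.length + 1) * (ftrlStrategy w η γ τ b * ftrlEst w η γ τ b y)))
    (fun i θ ℓ => c i ^ 2 / 2 - c i * ∑ b, θ b * (θ b / (θ b + γ i)) * ℓ b)
    (fun τ _ => 1 + c (τ.length + 1) ^ 2 / 2)
    (fun τ b => -(c (τ.length + 1) * (ftrlStrategy w η γ τ b /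
      (ftrlStrategy w η γ τ b + γ (τ.length + 1))))) (fun _ _ _ => by positivity)
    ?_ ?_ ?_ t le_rfl
  · exact banditLaw_tail (ftrl w η γ B) E t
      (fun τ b y => -(c (τ.length + 1) * (ftrlStrategy w η γ τ b * ftrlEst w η γ τ b y)))
      (fun i θ ℓ => c i ^ 2 / 2 - c i * ∑ b, θ b * (θ b / (θ b + γ i)) * ℓ b) hmain x
  · intro τ b hτ
    have h1 := hfrac τ b
    have h2 := hc (τ.length + 1)
    have := mul_le_of_le_one_right h2 h1.2
    nlinarith [sq_nonneg (c (τ.length + 1) - 1)]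
  · intro τ b y hy hτ
    have h1 := hfrac τ b
    have h2 := hc (τ.length + 1)
    have e : ftrlStrategy w η γ τ b * ftrlEst w η γ τ b y = ftrlStrategy w η γ τ b /
        (ftrlStrategy w η γ τ b + γ (τ.length + 1)) * y := by unfold ftrlEst; ring
    rw [e]
    set f := ftrlStrategy w η γ τ b / (ftrlStrategy w η γ τ b + γ (τ.length + 1))
    have hf0 : 0 ≤ f * y := mul_nonneg h1.1 hy.1
    have hf1 : f * y ≤ 1 := mul_le_one₀ h1.2 hy.1 hy.2
    refine (exp_neg_le_quadratic (mul_nonneg h2 hf0)).trans ?_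
    have : (c (τ.length + 1) * (f * y)) ^ 2 ≤ c (τ.length + 1) ^ 2 := by
      rw [mul_pow]
      exact mul_le_of_le_one_right (sq_nonneg _) (pow_le_one₀ hf0 hf1)
    linarith
  · intro τ ℓ hℓ hτ
    unfold rexp
    simp only [ftrl_strategy]
    have h1 : ∑ b, ftrlStrategy w η γ τ b * (1 + c (τ.length + 1) ^ 2 / 2 +
        -(c (τ.length + 1) * (ftrlStrategy w η γ τ b /
          (ftrlStrategy w η γ τ b + γ (τ.length + 1)))) * ℓ b) =
        (1 + c (τ.length + 1) ^ 2 / 2) - c (τ.length + 1) * ∑ b, ftrlStrategy w η γ τ b *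
          (ftrlStrategy w η γ τ b / (ftrlStrategy w η γ τ b + γ (τ.length + 1))) * ℓ b := by
      have h2 : ∑ b, ftrlStrategy w η γ τ b = 1 := sum_expWeights _ _
      rw [Finset.mul_sum]
      conv_rhs => rw [← mul_one (1 + c (τ.length + 1) ^ 2 / 2), ← h2, Finset.mul_sum]
      rw [← Finset.sum_sub_distrib]
      exact Finset.sum_congr rfl fun b _ => by rw [h2]; ring
    rw [h1]
    refine le_trans (le_of_eq ?_) (Real.add_one_le_exp _)
    ring

end Ftrl

/-! ### The weighted regret of tuned FTRL -/

section Tuned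

/-- The product starts at `2` because `1 - α_1 = 0`. -/
theorem prod_one_sub_alpha_pos (H t : ℕ) : 0 < ∏ i ∈ Finset.Icc 2 t, (1 - alpha H i) := by
  refine Finset.prod_pos fun i hi => ?_
  have h2 : 2 ≤ i := (Finset.mem_Icc.1 hi).1
  have h3 : (2 : ℝ) ≤ i := by exact_mod_cast h2
  rw [one_sub_alpha H i (by omega)]
  exact div_pos (by linarith) (by positivity)

theorem alpha_pos (H t : ℕ) (ht : 1 ≤ t) : 0 < alpha H t := by
  have : (0 : ℝ) < t := by exact_mod_cast ht
  unfold alpha; positivity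

theorem ftrlWeight_pos (H t : ℕ) (ht : 1 ≤ t) : 0 < ftrlWeight H t :=
  mul_pos (alpha_pos H t ht) (inv_pos.2 (prod_one_sub_alpha_pos H t))

/-- The dependence on `t` factors out, so one run with fixed weights `w` controls the
`α_t^i`-weighted regret at every `t`. -/
theorem alphaW_eq_ftrlWeight (H t i : ℕ) (hi : 1 ≤ i) (hit : i ≤ t) :
    alphaW H t i = ftrlWeight H i * ∏ l ∈ Finset.Icc 2 t, (1 - alpha H l) := by
  induction t, hit using Nat.le_induction with
  | base =>
    rw [alphaW_self H i hi, ftrlWeight, mul_assoc,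
      inv_mul_cancel₀ (prod_one_sub_alpha_pos H i).ne', mul_one]
  | succ t hit ih => rw [alphaW_succ H t i hit, ih, Finset.prod_Icc_succ_top (by omega), mul_assoc]

theorem ftrlWeight_succ (H t : ℕ) (ht : 1 ≤ t) :
    ftrlWeight H (t + 1) = ftrlWeight H t * ((H + t) / t) := by
  have hP := (prod_one_sub_alpha_pos H t).ne'
  have h0 : (0 : ℝ) < t := by exact_mod_cast ht
  unfold ftrlWeight
  rw [Finset.prod_Icc_succ_top (by omega), one_sub_alpha H (t + 1) (by omega), alpha, alpha]
  push_cast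
  have h1 : (H : ℝ) + (t + 1) ≠ 0 := by positivity
  rw [show (t : ℝ) + 1 - 1 = t by ring]
  field_simp

theorem ftrlWeight_le_succ (H t : ℕ) (ht : 1 ≤ t) : ftrlWeight H t ≤ ftrlWeight H (t + 1) := by
  have h0 : (0 : ℝ) < t := by exact_mod_cast ht
  rw [ftrlWeight_succ H t ht]
  refine le_mul_of_one_le_right (ftrlWeight_pos H t ht).le ?_
  rw [le_div_iff₀ h0]
  have : (0 : ℝ) ≤ H := Nat.cast_nonneg H
  linarith

/-- The growth ratio is `(H + t) / t`, which is at most two only from `t = H` on. This is why the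
first `H` rounds of FTRL are treated separately. -/
theorem ftrlWeight_succ_le (H t : ℕ) (ht : 1 ≤ t) (hHt : H ≤ t) :
    ftrlWeight H (t + 1) ≤ 2 * ftrlWeight H t := by
  have h0 : (0 : ℝ) < t := by exact_mod_cast ht
  have h1 : (H : ℝ) ≤ t := by exact_mod_cast hHt
  rw [ftrlWeight_succ H t ht, mul_comm]
  refine mul_le_mul_of_nonneg_right ?_ (ftrlWeight_pos H t ht).le
  rw [div_le_iff₀ h0]
  linarith

/-- The learning rate of tuned FTRL. -/
def tunedRate (H : ℕ) (ι : ℝ) (B n : ℕ) : ℝ := √(H * ι / (B * n))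

theorem tunedRate_eq (H : ℕ) (ι : ℝ) (B n : ℕ) :
    tunedRate H ι B n = √(H * ι / B) * (1 / √(n : ℝ)) := by
  unfold tunedRate
  rw [← div_div, Real.sqrt_div' _ (Nat.cast_nonneg n)]
  ring

section

variable {H : ℕ} {ι : ℝ} {B : ℕ}

theorem tunedRate_pos [NeZero B] (hH : 1 ≤ H) (hι : 0 < ι) {n : ℕ} (hn : 1 ≤ n) :
    0 < tunedRate H ι B n := by
  have h1 : (0 : ℝ) < H := by exact_mod_cast hH
  have h2 : (0 : ℝ) < n := by exact_mod_cast hn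
  have h3 : (0 : ℝ) < B := by exact_mod_cast NeZero.pos B
  unfold tunedRate
  positivity

theorem tunedRate_anti {n k : ℕ} (hn : 1 ≤ n) (hnk : n ≤ k) :
    tunedRate H ι B k ≤ tunedRate H ι B n := by
  have h2 : (0 : ℝ) < n := by exact_mod_cast hn
  have h3 : (n : ℝ) ≤ k := by exact_mod_cast hnk
  rw [tunedRate_eq, tunedRate_eq]
  refine mul_le_mul_of_nonneg_left ?_ (Real.sqrt_nonneg _)
  exact one_div_le_one_div_of_le (Real.sqrt_pos.2 h2) (Real.sqrt_le_sqrt h3)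

theorem tunedRate_le_two_mul {n : ℕ} (hn : 1 ≤ n) :
    tunedRate H ι B n ≤ 2 * tunedRate H ι B (n + 1) := by
  have h2 : (1 : ℝ) ≤ n := by exact_mod_cast hn
  rw [tunedRate_eq, tunedRate_eq, mul_left_comm]
  refine mul_le_mul_of_nonneg_left ?_ (Real.sqrt_nonneg _)
  push_cast
  rw [mul_one_div, div_le_div_iff₀ (Real.sqrt_pos.2 (by linarith)) (Real.sqrt_pos.2 (by linarith)),
    one_mul]
  refine Real.sqrt_le_iff.2 ⟨by positivity, ?_⟩
  rw [mul_pow, Real.sq_sqrt (by linarith)]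
  linarith

theorem sum_alphaW_tunedRate_le {t : ℕ} (ht : 1 ≤ t) :
    ∑ i ∈ Finset.Icc 1 t, alphaW H t i * tunedRate H ι B i ≤ 2 * tunedRate H ι B t := by
  have h := mul_le_mul_of_nonneg_left (sum_alphaW_div_sqrt_le H t ht)
    (Real.sqrt_nonneg (H * ι / B))
  rw [Finset.mul_sum] at h
  refine le_trans (le_of_eq (Finset.sum_congr rfl fun i _ => ?_)) (h.trans (le_of_eq ?_))
  · rw [tunedRate_eq]; ring
  · rw [tunedRate_eq]; ring

theorem mul_tunedRate [NeZero B] (t : ℕ) : (B : ℝ) * tunedRate H ι B t = √(H * B * ι / t) := by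
  have h3 : (0 : ℝ) < B := by exact_mod_cast NeZero.pos B
  unfold tunedRate
  rw [← Real.sqrt_sq h3.le, ← Real.sqrt_mul (sq_nonneg _), Real.sqrt_sq h3.le]
  congr 1
  rw [← div_div]
  field_simp

/-- The rate balances the two error terms: with `η_t² = Hι / (Bt)` and `α_t ≤ 2H/t`, the cost `ι α_t
/ η_t` is at most `2 B η_t`. -/
theorem mul_alpha_div_tunedRate_le [NeZero B] (hH : 1 ≤ H) (hι : 0 < ι) {t : ℕ} (ht : 1 ≤ t) :
    ι * alpha H t / tunedRate H ι B t ≤ 2 * √(H * B * ι / t) := by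
  have h0 : (0 : ℝ) < t := by exact_mod_cast ht
  have hB : (0 : ℝ) < B := by exact_mod_cast NeZero.pos B
  have hg := tunedRate_pos (B := B) hH hι ht
  rw [div_le_iff₀ hg, ← mul_tunedRate]
  have h1 : tunedRate H ι B t * tunedRate H ι B t = H * ι / (B * t) := by
    unfold tunedRate
    exact Real.mul_self_sqrt (by positivity)
  calc ι * alpha H t ≤ ι * (2 * H / t) := mul_le_mul_of_nonneg_left (alpha_le H t hH ht) hι.le
    _ = 2 * (B * (H * ι / (B * t))) := by field_simp
    _ = _ := by rw [← h1]; ring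

end

/-- The regret is affine in the comparator, so the vertices of the simplex decide. -/
theorem weightedRegret_le_of_forall {H t B : ℕ} {X : Type} (r : BanditRun B X) (M : ℝ)
    (h : ∀ b, ∑ i ∈ Finset.Icc 1 t, alphaW H t i * ((∑ b', r.θ i b' * r.ℓ i b') - r.ℓ i b) ≤ M)
    (θ : Fin B → ℝ) (hθ : θ ∈ stdSimplex ℝ (Fin B)) : weightedRegret H t r θ ≤ M := by
  have h1 : weightedRegret H t r θ = ∑ b, θ b * ∑ i ∈ Finset.Icc 1 t, alphaW H t i *
      ((∑ b', r.θ i b' * r.ℓ i b') - r.ℓ i b) := by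
    unfold weightedRegret
    simp only [Finset.mul_sum]
    rw [Finset.sum_comm]
    refine Finset.sum_congr rfl fun i _ => ?_
    have h2 : ∀ b, θ b * (alphaW H t i * (∑ b', r.θ i b' * r.ℓ i b' - r.ℓ i b)) =
        alphaW H t i * (θ b * (∑ b', r.θ i b' * r.ℓ i b')) - alphaW H t i * (θ b * r.ℓ i b) :=
      fun b => by ring
    rw [Finset.sum_congr rfl fun b _ => h2 b, Finset.sum_sub_distrib, ← Finset.mul_sum,
      ← Finset.mul_sum, ← Finset.sum_mul, hθ.2, one_mul, mul_sub]
  rw [h1]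
  calc _ ≤ ∑ b, θ b * M := Finset.sum_le_sum fun b _ => mul_le_mul_of_nonneg_left (h b) (hθ.1 b)
    _ = M := by rw [← Finset.sum_mul, hθ.2, one_mul]

/-- Rescaled form of the regret of tuned FTRL against the estimated losses. -/
theorem tuned_regret_le {H : ℕ} {ι : ℝ} {B : ℕ} [NeZero B] (hH : 1 ≤ H) (hι : 1 / 2 ≤ ι)
    (hB : Real.log B ≤ ι) {t : ℕ} (ht : 1 ≤ t) (τ : List (Fin B × ℝ)) (hlen : τ.length = t)
    (hτ : ∀ x ∈ τ, x.2 ∈ Set.Icc (0 : ℝ) 1) (b : Fin B) :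
    histSum (fun τ b y => alphaW H t (τ.length + 1) *
      (ftrlStrategy (ftrlWeight H) (tunedRate H ι B) (tunedRate H ι B) τ b *
        ftrlEst (ftrlWeight H) (tunedRate H ι B) (tunedRate H ι B) τ b y)) τ ≤
      histSum (fun τ b₀ y => alphaW H t (τ.length + 1) * (if b₀ = b then
        ftrlEst (ftrlWeight H) (tunedRate H ι B) (tunedRate H ι B) τ b₀ y else 0)) τ +
      6 * √(H * B * ι / t) +
      histSum (fun τ b y => 2 * tunedRate H ι B (τ.length + 1) * alphaW H t (τ.length + 1) *
        ftrlEst (ftrlWeight H) (tunedRate H ι B) (tunedRate H ι B) τ b y) τ := by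
  have hι0 : 0 < ι := by linarith
  have ht0 : (0 : ℝ) < t := by exact_mod_cast ht
  have hB1 : (1 : ℝ) ≤ B := by exact_mod_cast NeZero.pos B
  have hH0 : (0 : ℝ) < H := by exact_mod_cast hH
  set w := ftrlWeight H with hw
  set g := tunedRate H ι B with hg
  set P := ∏ l ∈ Finset.Icc 2 t, (1 - alpha H l) with hP
  have hP0 : 0 < P := prod_one_sub_alpha_pos H t
  have hgpos : ∀ n, 1 ≤ n → 0 < g n := fun n hn => tunedRate_pos hH hι0 hn
  have hne : τ ≠ [] := by rintro rfl; simp at hlen; omega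
  have h := mul_le_mul_of_nonneg_right (ftrl_regret_le H hH (fun n hn => ftrlWeight_pos H n hn)
    hgpos hgpos (fun n hn => ftrlWeight_le_succ H n hn)
    (fun n hn => tunedRate_anti hn (Nat.le_succ n))
    (fun n hn => ftrlWeight_succ_le H n (by omega) hn) (fun n hn => tunedRate_le_two_mul hn)
    τ hτ hne b) hP0.le
  rw [add_mul, add_mul, ftrlLoss_eq_histSum, hlen] at h
  simp only [← hw] at h
  have hscale : ∀ f : List (Fin B × ℝ) → Fin B → ℝ → ℝ,
      histSum (fun τ b y => w (τ.length + 1) * f τ b y) τ * P =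
        histSum (fun τ b y => alphaW H t (τ.length + 1) * f τ b y) τ := by
    intro f
    rw [mul_comm, ← histSum_const_mul]
    refine histSum_congr τ fun τ' b y hl => ?_
    rw [alphaW_eq_ftrlWeight H t (τ'.length + 1) (by omega) (by omega)]
    ring
  rw [hscale, hscale] at h
  have hlog : Real.log B * (w t / g t) * P ≤ 2 * √(H * B * ι / t) := by
    have e : Real.log B * (w t / g t) * P = Real.log B * (alphaW H t t / g t) := by
      rw [alphaW_eq_ftrlWeight H t t ht le_rfl]; ring
    rw [e, alphaW_self H t ht]
    refine le_trans ?_ (mul_alpha_div_tunedRate_le (B := B) hH hι0 ht)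
    rw [mul_div_assoc]
    exact mul_le_mul_of_nonneg_right hB (div_nonneg (alpha_nonneg H t) (hgpos t ht).le)
  -- In the first `H` rounds `1 ≤ √(H/i)`, so their total weight is at most `∑ α_t^i √(H/i) ≤ 2
  -- √(H/t)`.
  have hrest : histSum (fun τ b y => if τ.length + 1 ≤ H then w (τ.length + 1) else
      w (τ.length + 1) * (2 * g (τ.length + 1) * ftrlEst w g g τ b y)) τ * P ≤
      4 * √(H * B * ι / t) + histSum (fun τ b y => 2 * g (τ.length + 1) *
        alphaW H t (τ.length + 1) * ftrlEst w g g τ b y) τ := by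
    have h1 : histSum (fun τ b y => if τ.length + 1 ≤ H then w (τ.length + 1) else
        w (τ.length + 1) * (2 * g (τ.length + 1) * ftrlEst w g g τ b y)) τ * P ≤
        histSum (fun (τ : List (Fin B × ℝ)) (b : Fin B) (y : ℝ) =>
          (fun i => alphaW H t i * (√(H : ℝ) * (1 / √(i : ℝ)))) (τ.length + 1) +
          2 * g (τ.length + 1) * alphaW H t (τ.length + 1) * ftrlEst w g g τ b y) τ := by
      rw [mul_comm, ← histSum_const_mul]
      refine histSum_mono τ hτ fun τ' b y hy hl => ?_
      have hW := alphaW_eq_ftrlWeight H t (τ'.length + 1) (by omega) (by omega)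
      have hest : 0 ≤ ftrlEst w g g τ' b y := by
        have h1 : 0 < ftrlStrategy w g g τ' b := expWeights_pos _ _ _
        have h2 := hgpos (τ'.length + 1) (by omega)
        exact div_nonneg hy.1 (by positivity)
      have hWn := alphaW_nonneg H t (τ'.length + 1)
      have hgn := (hgpos (τ'.length + 1) (by omega)).le
      split_ifs with hle
      · have h3 : 1 ≤ √(H : ℝ) * (1 / √((τ'.length + 1 : ℕ) : ℝ)) := by
          rw [mul_one_div, one_le_div (Real.sqrt_pos.2 (by positivity))]
          exact Real.sqrt_le_sqrt (by exact_mod_cast hle)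
        have h4 : P * w (τ'.length + 1) = alphaW H t (τ'.length + 1) := by
          rw [hW, mul_comm]
        rw [h4]
        refine le_add_of_le_of_nonneg (le_mul_of_one_le_right hWn h3) (by positivity)
      · have h4 : P * (w (τ'.length + 1) * (2 * g (τ'.length + 1) * ftrlEst w g g τ' b y)) =
            2 * g (τ'.length + 1) * alphaW H t (τ'.length + 1) * ftrlEst w g g τ' b y := by
          rw [hW]; ring
        rw [h4]
        exact le_add_of_nonneg_left (by positivity)
    refine h1.trans ?_
    rw [histSum_add, histSum_length (fun i => alphaW H t i * (√(H : ℝ) * (1 / √(i : ℝ)))) τ, hlen]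
    refine add_le_add_left ?_ _
    have h2 : ∑ i ∈ Finset.Icc 1 t, alphaW H t i * (√(H : ℝ) * (1 / √(i : ℝ))) ≤
        √(H : ℝ) * (2 / √(t : ℝ)) := by
      refine le_trans (le_of_eq ?_) (mul_le_mul_of_nonneg_left (sum_alphaW_div_sqrt_le H t ht)
        (Real.sqrt_nonneg _))
      rw [Finset.mul_sum]
      exact Finset.sum_congr rfl fun i _ => by ring
    refine h2.trans ?_
    have h3 : √(H : ℝ) * (2 / √(t : ℝ)) = 2 * √(H / t : ℝ) := by
      rw [Real.sqrt_div hH0.le]; ring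
    have h4 : √(H / t : ℝ) ≤ 2 * √(H * B * ι / t) := by
      refine Real.sqrt_le_iff.2 ⟨by positivity, ?_⟩
      rw [mul_pow, Real.sq_sqrt (by positivity), mul_div_assoc', div_le_div_iff_of_pos_right ht0]
      nlinarith [mul_le_mul hB1 hι (by norm_num) (by linarith), mul_pos hH0 hι0]
    rw [h3]
    linarith
  linarith

/-- The deterministic part of the regret bound of tuned FTRL. -/
theorem tuned_regret_det {H : ℕ} {ι : ℝ} {B : ℕ} [NeZero B] (hH : 1 ≤ H) (hι : 1 / 2 ≤ ι)
    (hB : Real.log B ≤ ι) {t : ℕ} (ht : 1 ≤ t) (htB : H * B * ι ≤ t) (τ : List (Fin B × ℝ))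
    (hlen : τ.length = t) (hτ : ∀ x ∈ τ, x.2 ∈ Set.Icc (0 : ℝ) 1) (θ ℓ : ℕ → Fin B → ℝ)
    (hℓ : ∀ i ∈ Finset.Icc 1 t, ∀ b, ℓ i b ∈ Set.Icc (0 : ℝ) 1)
    (hθ : ∀ i ∈ Finset.Icc 1 t, ∀ b, 0 ≤ θ i b) (b : Fin B)
    (h1 : histSum (fun τ b' y => (if b' = b then
        2 * tunedRate H ι B t * (alphaW H t (τ.length + 1) / alpha H t) else 0) *
        ftrlEst (ftrlWeight H) (tunedRate H ι B) (tunedRate H ι B) τ b' y) τ -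
      ∑ i ∈ Finset.Icc 1 t, ∑ b', (if b' = b then
        2 * tunedRate H ι B t * (alphaW H t i / alpha H t) else 0) * ℓ i b' ≤ 3 * ι)
    (h2 : histSum (fun τ b' y => 2 * tunedRate H ι B (τ.length + 1) *
        (alphaW H t (τ.length + 1) / alpha H t) *
        ftrlEst (ftrlWeight H) (tunedRate H ι B) (tunedRate H ι B) τ b' y) τ -
      ∑ i ∈ Finset.Icc 1 t, ∑ b', 2 * tunedRate H ι B i * (alphaW H t i / alpha H t) * ℓ i b' ≤
        3 * ι)
    (h3 : histSum (fun τ b' y => -(√(ι * t / H) * alphaW H t (τ.length + 1) *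
        (ftrlStrategy (ftrlWeight H) (tunedRate H ι B) (tunedRate H ι B) τ b' *
          ftrlEst (ftrlWeight H) (tunedRate H ι B) (tunedRate H ι B) τ b' y))) τ -
      ∑ i ∈ Finset.Icc 1 t, ((√(ι * t / H) * alphaW H t i) ^ 2 / 2 -
        √(ι * t / H) * alphaW H t i *
          ∑ b', θ i b' * (θ i b' / (θ i b' + tunedRate H ι B i)) * ℓ i b') ≤ 3 * ι) :
    ∑ i ∈ Finset.Icc 1 t, alphaW H t i * ((∑ b', θ i b' * ℓ i b') - ℓ i b) ≤
      25 * √(H * B * ι / t) := by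
  have hι0 : 0 < ι := by linarith
  have ht0 : (0 : ℝ) < t := by exact_mod_cast ht
  have hB1 : (1 : ℝ) ≤ B := by exact_mod_cast NeZero.pos B
  have hH0 : (0 : ℝ) < H := by exact_mod_cast hH
  have hreg := tuned_regret_le hH hι hB ht τ hlen hτ b
  set w := ftrlWeight H with hw
  set g := tunedRate H ι B with hg
  set x := √(H * B * ι / t) with hx
  have hgpos : ∀ n, 1 ≤ n → 0 < g n := fun n hn => tunedRate_pos hH hι0 hn
  have hgt := hgpos t ht
  have hα := alpha_pos H t ht
  have hx0 : 0 ≤ x := Real.sqrt_nonneg _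
  have hBg : (B : ℝ) * g t = x := mul_tunedRate t
  have hια : ι * alpha H t / g t ≤ 2 * x := mul_alpha_div_tunedRate_le hH hι0 ht
  have hsum : ∑ i ∈ Finset.Icc 1 t, alphaW H t i * g i ≤ 2 * g t := sum_alphaW_tunedRate_le ht
  have hBsum : (B : ℝ) * ∑ i ∈ Finset.Icc 1 t, alphaW H t i * g i ≤ 2 * x := by
    rw [← hBg]; nlinarith
  -- the comparator
  have k1 : histSum (fun τ b₀ y => alphaW H t (τ.length + 1) *
      (if b₀ = b then ftrlEst w g g τ b₀ y else 0)) τ ≤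
      ∑ i ∈ Finset.Icc 1 t, alphaW H t i * ℓ i b + 3 * x := by
    have e1 : histSum (fun τ b' y => (if b' = b then
        2 * g t * (alphaW H t (τ.length + 1) / alpha H t) else 0) * ftrlEst w g g τ b' y) τ =
        2 * g t / alpha H t * histSum (fun τ b₀ y => alphaW H t (τ.length + 1) *
          (if b₀ = b then ftrlEst w g g τ b₀ y else 0)) τ := by
      rw [← histSum_const_mul]
      refine histSum_congr τ fun τ' b' y _ => ?_
      split_ifs
      · ring
      · ring
    have e2 : ∑ i ∈ Finset.Icc 1 t, ∑ b', (if b' = b then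
        2 * g t * (alphaW H t i / alpha H t) else 0) * ℓ i b' =
        2 * g t / alpha H t * ∑ i ∈ Finset.Icc 1 t, alphaW H t i * ℓ i b := by
      rw [Finset.mul_sum]
      refine Finset.sum_congr rfl fun i _ => ?_
      rw [Finset.sum_eq_single b (fun b' _ hb => by rw [if_neg hb, zero_mul]) (by simp), if_pos rfl]
      ring
    rw [e1, e2, ← mul_sub] at h1
    -- Undoing the normalization turns `3ι` into `(3/2) ι α_t / g_t`, which is at most `3x`.
    have e3 : 2 * g t / alpha H t * (3 * (ι * alpha H t / g t) / 2) = 3 * ι := by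
      field_simp
    rw [← e3] at h1
    have := le_of_mul_le_mul_left h1 (by positivity)
    linarith
  -- the quadratic terms
  have k2 : histSum (fun τ b y => 2 * g (τ.length + 1) * alphaW H t (τ.length + 1) *
      ftrlEst w g g τ b y) τ ≤ 10 * x := by
    have e1 : histSum (fun τ b' y => 2 * g (τ.length + 1) *
        (alphaW H t (τ.length + 1) / alpha H t) * ftrlEst w g g τ b' y) τ =
        1 / alpha H t * histSum (fun τ b y => 2 * g (τ.length + 1) * alphaW H t (τ.length + 1) *
          ftrlEst w g g τ b y) τ := by
      rw [← histSum_const_mul]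
      exact histSum_congr τ fun τ' b' y _ => by ring
    have e2 : ∑ i ∈ Finset.Icc 1 t, ∑ b', 2 * g i * (alphaW H t i / alpha H t) * ℓ i b' ≤
        1 / alpha H t * (4 * x) := by
      calc _ ≤ ∑ i ∈ Finset.Icc 1 t, ∑ _b' : Fin B, 2 * g i * (alphaW H t i / alpha H t) * 1 := by
            refine Finset.sum_le_sum fun i hi => Finset.sum_le_sum fun b' _ => ?_
            have h5 := hgpos i (Finset.mem_Icc.1 hi).1
            have h6 := alphaW_nonneg H t i
            exact mul_le_mul_of_nonneg_left (hℓ i hi b').2 (by positivity)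
        _ = 1 / alpha H t * (2 * (B * ∑ i ∈ Finset.Icc 1 t, alphaW H t i * g i)) := by
            simp only [Finset.sum_const, Finset.card_univ, Fintype.card_fin, nsmul_eq_mul,
              Finset.mul_sum]
            exact Finset.sum_congr rfl fun i _ => by ring
        _ ≤ _ := mul_le_mul_of_nonneg_left (by linarith) (by positivity)
    have e3 : 3 * ι = 1 / alpha H t * (3 * (ι * alpha H t)) := by field_simp
    have h4 := h2.trans_eq e3
    rw [e1] at h4
    have h5 : 1 / alpha H t * histSum (fun τ b y => 2 * g (τ.length + 1) *
        alphaW H t (τ.length + 1) * ftrlEst w g g τ b y) τ ≤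
        1 / alpha H t * (3 * (ι * alpha H t) + 4 * x) := by rw [mul_add]; linarith
    have h6 := le_of_mul_le_mul_left h5 (by positivity)
    -- Here `t ≥ HBι` is used: it gives `g t ≤ x ≤ 1`.
    have h7 : ι * alpha H t ≤ 2 * x := by
      have hy : (H : ℝ) * B * ι / t ≤ 1 := by rw [div_le_one ht0]; exact htB
      have hgx : g t ≤ 1 := by
        have h8 : x ≤ 1 := Real.sqrt_le_one.2 hy
        nlinarith
      have h9 := mul_le_mul_of_nonneg_right hια hgt.le
      rw [div_mul_cancel₀ _ hgt.ne'] at h9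
      refine h9.trans ?_
      exact mul_le_of_le_one_right (by positivity) hgx
    linarith
  -- the played actions
  set F : ℕ → ℝ := fun i => ∑ b', θ i b' * (θ i b' / (θ i b' + g i)) * ℓ i b' with hF
  -- Chosen so that the variance term `lam² ∑ (α_t^i)² / 2` is at most `ι`, while `ι / lam ≤ x`.
  set lam := √(ι * t / H) with hlam
  have hlam0 : 0 < lam := Real.sqrt_pos.2 (by positivity)
  have k3 : ∑ i ∈ Finset.Icc 1 t, alphaW H t i * F i ≤
      histSum (fun τ b y => alphaW H t (τ.length + 1) *
        (ftrlStrategy w g g τ b * ftrlEst w g g τ b y)) τ + 4 * x := by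
    have e1 : histSum (fun τ b' y => -(lam * alphaW H t (τ.length + 1) *
        (ftrlStrategy w g g τ b' * ftrlEst w g g τ b' y))) τ =
        -lam * histSum (fun τ b y => alphaW H t (τ.length + 1) *
        (ftrlStrategy w g g τ b * ftrlEst w g g τ b y)) τ := by
      rw [← histSum_const_mul]
      exact histSum_congr τ fun τ' b' y _ => by ring
    have e2 : ∑ i ∈ Finset.Icc 1 t, ((lam * alphaW H t i) ^ 2 / 2 - lam * alphaW H t i * F i) =
        lam ^ 2 / 2 * ∑ i ∈ Finset.Icc 1 t, alphaW H t i ^ 2 -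
          lam * ∑ i ∈ Finset.Icc 1 t, alphaW H t i * F i := by
      rw [Finset.sum_sub_distrib, Finset.mul_sum, Finset.mul_sum]
      congr 1
      · exact Finset.sum_congr rfl fun i _ => by ring
      · exact Finset.sum_congr rfl fun i _ => by ring
    have h4 : histSum (fun τ b' y => -(lam * alphaW H t (τ.length + 1) *
        (ftrlStrategy w g g τ b' * ftrlEst w g g τ b' y))) τ -
        ∑ i ∈ Finset.Icc 1 t, ((lam * alphaW H t i) ^ 2 / 2 - lam * alphaW H t i * F i) ≤
        3 * ι := h3
    rw [e1, e2] at h4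
    have hl2 : lam ^ 2 = ι * t / H := Real.sq_sqrt (by positivity)
    have h5 := mul_le_mul_of_nonneg_left (sum_alphaW_sq_le H t hH ht)
      (show 0 ≤ lam ^ 2 / 2 by positivity)
    have h6 : lam ^ 2 / 2 * (2 * H / t) = ι := by rw [hl2]; field_simp
    have h7 : lam * x ≥ ι := by
      rw [hlam, hx, ← Real.sqrt_mul (by positivity)]
      refine Real.le_sqrt_of_sq_le ?_
      have : ι * t / H * (H * B * ι / t) = ι ^ 2 * B := by field_simp
      rw [this]
      exact le_mul_of_one_le_right (sq_nonneg _) hB1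
    refine le_of_mul_le_mul_left ?_ hlam0
    nlinarith
  -- The bias of implicit exploration is `γ θ / (θ + γ) ≤ γ` per action, hence at most `B g i` per
  -- round.
  have k4 : ∑ i ∈ Finset.Icc 1 t, alphaW H t i * ∑ b', θ i b' * ℓ i b' ≤
      ∑ i ∈ Finset.Icc 1 t, alphaW H t i * F i + 2 * x := by
    have h4 : ∀ i ∈ Finset.Icc 1 t, alphaW H t i * ∑ b', θ i b' * ℓ i b' ≤
        alphaW H t i * F i + B * (alphaW H t i * g i) := by
      intro i hi
      have hgi := hgpos i (Finset.mem_Icc.1 hi).1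
      have h5 : ∑ b', θ i b' * ℓ i b' ≤ F i + B * g i := by
        have : F i + B * g i = ∑ b', (θ i b' * (θ i b' / (θ i b' + g i)) * ℓ i b' + g i) := by
          rw [Finset.sum_add_distrib]; simp [hF]
        rw [this]
        refine Finset.sum_le_sum fun b' _ => ?_
        have h6 := hθ i hi b'
        have h7 := hℓ i hi b'
        have h8 : 0 < θ i b' + g i := by linarith
        have h9 : θ i b' * ℓ i b' = θ i b' * (θ i b' / (θ i b' + g i)) * ℓ i b' +
            g i * (θ i b' / (θ i b' + g i) * ℓ i b') := by field_simp
        have h10 : θ i b' / (θ i b' + g i) ≤ 1 := by rw [div_le_one h8]; linarith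
        have h11 : g i * (θ i b' / (θ i b' + g i) * ℓ i b') ≤ g i * 1 :=
          mul_le_mul_of_nonneg_left (mul_le_one₀ h10 h7.1 h7.2) hgi.le
        linarith
      have := mul_le_mul_of_nonneg_left h5 (alphaW_nonneg H t i)
      linarith
    have h5 := Finset.sum_le_sum h4
    rw [Finset.sum_add_distrib, ← Finset.mul_sum] at h5
    linarith
  simp only [mul_sub, Finset.sum_sub_distrib]
  -- The constant is `25 = 2 + 4 + 6 + 3 + 10`: exploration bias, played losses, FTRL, comparator,
  -- quadratic terms.
  linarith

/-- The weighted regret of tuned FTRL. -/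
theorem ftrlTuned_regret {H : ℕ} {ι : ℝ} {B : ℕ} [NeZero B] (hH : 1 ≤ H) (hι : Real.log 2 ≤ ι)
    (hB : Real.log B ≤ ι) {t : ℕ} (ht : 1 ≤ t) (E : BanditEnv B) :
    (banditLaw (ftrlTuned H ι B) E t).toOuterMeasure
      {r | ∃ θ ∈ stdSimplex ℝ (Fin B), 25 * √(H * B * ι / t) < weightedRegret H t r θ} ≤
      ENNReal.ofReal (Real.exp (-ι)) := by
  have hι2 : 1 / 2 ≤ ι := by have := Real.log_two_gt_d9; linarith
  have hι0 : 0 < ι := by linarith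
  have ht0 : (0 : ℝ) < t := by exact_mod_cast ht
  have hB1 : (1 : ℝ) ≤ B := by exact_mod_cast NeZero.pos B
  have hB0 : (0 : ℝ) < B := by linarith
  have hH0 : (0 : ℝ) < H := by exact_mod_cast hH
  set p := banditLaw (ftrlTuned H ι B) E t with hp
  set x := √(H * B * ι / t) with hx
  -- For `t < HBι` the bound exceeds one, and the regret never does.
  rcases lt_or_ge (t : ℝ) (H * B * ι) with htB | htB
  · refine le_trans (PMF.toOuterMeasure_mono p (t := ∅) ?_) (by simp)
    rintro r ⟨⟨θ, hθ, hlt⟩, hr⟩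
    refine absurd hlt (not_lt.2 (weightedRegret_le_of_forall r _ (fun b => ?_) θ hθ))
    obtain ⟨-, -, h3⟩ := mem_support_banditLaw hr
    calc _ ≤ ∑ i ∈ Finset.Icc 1 t, alphaW H t i := by
          refine Finset.sum_le_sum fun i hi => ?_
          obtain ⟨h4, h5, h6⟩ := h3 i hi
          refine mul_le_of_le_one_right (alphaW_nonneg H t i) ?_
          have : ∑ b', r.θ i b' * r.ℓ i b' ≤ ∑ b', r.θ i b' :=
            Finset.sum_le_sum fun b' _ => mul_le_of_le_one_right (h5 b') (h4 b').2
          have := (h4 b).1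
          linarith
      _ = 1 := sum_alphaW_Icc H t ht
      _ ≤ x := Real.one_le_sqrt.2 (by rw [one_le_div ht0]; exact htB.le)
      _ ≤ 25 * x := by have := Real.sqrt_nonneg (H * B * ι / t); linarith
  have hgpos : ∀ n, 1 ≤ n → 0 < tunedRate H ι B n := fun n hn => tunedRate_pos hH hι0 hn
  have hα := alpha_pos H t ht
  have hdiv : ∀ i, 1 ≤ i → i ≤ t → 0 ≤ alphaW H t i / alpha H t ∧
      alphaW H t i / alpha H t ≤ 1 := fun i hi hit =>
    ⟨div_nonneg (alphaW_nonneg H t i) hα.le, (div_le_one hα).2 (alphaW_le_alpha H t i hi hit)⟩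
  set w := ftrlWeight H with hw
  set g := tunedRate H ι B with hg
  have hpe : p = banditLaw (ftrl w g g B) E t := rfl
  -- Dividing the weights by `α_t` brings them into `[0, 1]`, and `g t ≤ g i` then makes the
  -- coefficients admissible for implicit exploration.
  have E1 := fun b : Fin B => ftrl_est_tail (w := w) (η := g) E t hgpos
    (fun i b' => if b' = b then 2 * g t * (alphaW H t i / alpha H t) else 0) (by
      intro i b' hi hit
      have h1 := hdiv i hi hit
      have h2 := hgpos t ht
      have h3 : g t ≤ g i := tunedRate_anti hi hit
      have h4 := hgpos i hi
      split_ifs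
      · refine ⟨by have := h1.1; positivity, ?_⟩
        exact (mul_le_of_le_one_right (by positivity) h1.2).trans (by linarith)
      · exact ⟨le_rfl, by positivity⟩) (3 * ι)
  have E2 := ftrl_est_tail (w := w) (η := g) E t hgpos
    (fun i _ => 2 * g i * (alphaW H t i / alpha H t)) (by
      intro i b' hi hit
      have h1 := hdiv i hi hit
      have h4 := hgpos i hi
      exact ⟨by have := h1.1; positivity, mul_le_of_le_one_right (by positivity) h1.2⟩) (3 * ι)
  have E3 := ftrl_play_tail (w := w) (η := g) E t hgpos (fun i => √(ι * t / H) * alphaW H t i)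
    (fun i => mul_nonneg (Real.sqrt_nonneg _) (alphaW_nonneg H t i)) (3 * ι)
  rw [← hpe] at E2 E3
  simp only [← hpe] at E1
  set S1 := fun b : Fin B => {r : BanditRun B E.X | 3 * ι < histSum (fun τ b' y => (if b' = b then
        2 * g t * (alphaW H t (τ.length + 1) / alpha H t) else 0) *
        ftrlEst w g g τ b' y) r.hist -
      ∑ i ∈ Finset.Icc 1 t, ∑ b', (if b' = b then
        2 * g t * (alphaW H t i / alpha H t) else 0) * r.ℓ i b'} with hS1
  set S2 := {r : BanditRun B E.X | 3 * ι < histSum (fun τ b' y => 2 * g (τ.length + 1) *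
        (alphaW H t (τ.length + 1) / alpha H t) * ftrlEst w g g τ b' y) r.hist -
      ∑ i ∈ Finset.Icc 1 t, ∑ b', 2 * g i * (alphaW H t i / alpha H t) * r.ℓ i b'} with hS2
  set S3 := {r : BanditRun B E.X | 3 * ι < histSum (fun τ b' y =>
        -(√(ι * t / H) * alphaW H t (τ.length + 1) *
        (ftrlStrategy w g g τ b' * ftrlEst w g g τ b' y))) r.hist -
      ∑ i ∈ Finset.Icc 1 t, ((√(ι * t / H) * alphaW H t i) ^ 2 / 2 -
        √(ι * t / H) * alphaW H t i *
          ∑ b', r.θ i b' * (r.θ i b' / (r.θ i b' + g i)) * r.ℓ i b')} with hS3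
  calc _ ≤ p.toOuterMeasure ((⋃ b, S1 b) ∪ (S2 ∪ S3)) := by
        refine PMF.toOuterMeasure_mono p ?_
        rintro r ⟨⟨θ, hθ, hlt⟩, hr⟩
        by_contra hnot
        simp only [Set.mem_union, Set.mem_iUnion, not_or, not_exists] at hnot
        obtain ⟨n1, n2, n3⟩ := hnot
        obtain ⟨hlen, hh, h3⟩ := mem_support_banditLaw hr
        refine absurd hlt (not_lt.2 (weightedRegret_le_of_forall r _ (fun b => ?_) θ hθ))
        exact tuned_regret_det hH hι2 hB ht htB r.hist hlen hh r.θ r.ℓ (fun i hi => (h3 i hi).1)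
          (fun i hi => (h3 i hi).2.1) b (not_lt.1 (n1 b)) (not_lt.1 n2) (not_lt.1 n3)
    _ ≤ (∑ b, p.toOuterMeasure (S1 b)) + (p.toOuterMeasure S2 + p.toOuterMeasure S3) :=
        (MeasureTheory.measure_union_le _ _).trans (add_le_add
          (MeasureTheory.measure_iUnion_fintype_le _ _) (MeasureTheory.measure_union_le _ _))
    _ ≤ (∑ _b : Fin B, ENNReal.ofReal (Real.exp (-(3 * ι)))) +
          (ENNReal.ofReal (Real.exp (-(3 * ι))) + ENNReal.ofReal (Real.exp (-(3 * ι)))) :=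
        add_le_add (Finset.sum_le_sum fun b _ => E1 b) (add_le_add E2 E3)
    _ = ENNReal.ofReal ((B + 2) * Real.exp (-(3 * ι))) := by
        rw [← ENNReal.ofReal_add (Real.exp_pos _).le (Real.exp_pos _).le,
          ← ENNReal.ofReal_sum_of_nonneg (fun _ _ => (Real.exp_pos _).le),
          ← ENNReal.ofReal_add (Finset.sum_nonneg fun _ _ => (Real.exp_pos _).le) (by positivity)]
        congr 1
        simp
        ring
    _ ≤ _ := by
        refine ENNReal.ofReal_le_ofReal ?_
        have h1 : (B : ℝ) ≤ Real.exp ι := (Real.log_le_iff_le_exp hB0).1 hB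
        have h2 : (2 : ℝ) ≤ Real.exp ι := (Real.log_le_iff_le_exp two_pos).1 hι
        -- There are `B + 2` events of probability `exp (-3ι)` each; two factors `exp ι` pay for
        -- their number.
        have h3 : (B : ℝ) + 2 ≤ Real.exp ι * Real.exp ι := by nlinarith
        calc _ ≤ Real.exp ι * Real.exp ι * Real.exp (-(3 * ι)) :=
              mul_le_mul_of_nonneg_right h3 (Real.exp_pos _).le
          _ = _ := by rw [← Real.exp_add, ← Real.exp_add]; congr 1; ring

end Tuned

/-! ### Trivial cases -/

section Trivial

variable {m S : ℕ} {A : Fin m → ℕ}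

theorem MarkovGame.valueToGo_mem (G : MarkovGame m S A) (σ : ∀ j, DetPolicy S A j) (j : Fin m)
    (n : ℕ) (τ : History S A) (s : Fin S) :
    G.valueToGo σ j n τ s ∈ Set.Icc (0 : ℝ) n := by
  induction n generalizing τ s with
  | zero => simp [MarkovGame.valueToGo]
  | succ n ih =>
    rw [MarkovGame.valueToGo]
    have hr := G.reward_mem j τ.length s (fun i => σ i τ s)
    have hsum := sum_toReal_eq_one (G.trans τ.length s (fun i => σ i τ s))
    constructor
    · exact add_nonneg hr.1 (Finset.sum_nonneg fun s' _ =>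
        mul_nonneg ENNReal.toReal_nonneg (ih _ s').1)
    · have : ∑ s', (G.trans τ.length s (fun i => σ i τ s) s').toReal *
          G.valueToGo σ j n ((s, fun i => σ i τ s) :: τ) s' ≤
          ∑ s', (G.trans τ.length s (fun i => σ i τ s) s').toReal * (n : ℝ) :=
        Finset.sum_le_sum fun s' _ =>
          mul_le_mul_of_nonneg_left (ih _ s').2 ENNReal.toReal_nonneg
      rw [← Finset.sum_mul, hsum, one_mul] at this
      push_cast
      linarith [hr.2]

theorem MarkovGame.value_mem (G : MarkovGame m S A) (H : ℕ) {Ω : Type} [MeasurableSpace Ω]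
    (P : MeasureTheory.Measure Ω) [MeasureTheory.IsProbabilityMeasure P]
    (π : ∀ i, Ω → DetPolicy S A i) (j : Fin m) : G.value H P π j ∈ Set.Icc (0 : ℝ) H := by
  unfold MarkovGame.value
  refine ⟨MeasureTheory.integral_nonneg fun ω => (G.valueToGo_mem _ j H [] _).1, ?_⟩
  calc _ ≤ ∫ _ω, (H : ℝ) ∂P := MeasureTheory.integral_mono_of_nonneg
        (Filter.Eventually.of_forall fun ω => (G.valueToGo_mem _ j H [] _).1)
        (MeasureTheory.integrable_const _)
        (Filter.Eventually.of_forall fun ω => (G.valueToGo_mem _ j H [] _).2)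
    _ = H := by simp

theorem MarkovGame.isApproxCCE_of_horizon_le (G : MarkovGame m S A) (H : ℕ) {Ω : Type}
    [MeasurableSpace Ω] (P : MeasureTheory.Measure Ω) [MeasureTheory.IsProbabilityMeasure P]
    (π : ∀ i, Ω → DetPolicy S A i) {ε : ℝ} (hε : H ≤ ε) : G.IsApproxCCE H P π ε := by
  intro j
  have h1 : G.bestResponseValue H P π j ≤ H := by
    refine Real.sSup_le ?_ (Nat.cast_nonneg H)
    rintro v ⟨Ω', _, P', _, π', -, rfl⟩
    exact (G.value_mem H _ _ j).2
  have h2 := (G.value_mem H P π j).1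
  linarith

/-- With one action per player there is only one policy. The case is split off because `ι` can then
be arbitrarily small, whereas the analysis needs `ι ≥ log 2`. -/
theorem MarkovGame.isApproxCCE_of_subsingleton (G : MarkovGame m S A) (H : ℕ) {Ω : Type}
    [MeasurableSpace Ω] (P : MeasureTheory.Measure Ω) [MeasureTheory.IsProbabilityMeasure P]
    (π : ∀ i, Ω → DetPolicy S A i) (hA : ∀ j, A j = 1) {ε : ℝ} (hε : 0 ≤ ε) :
    G.IsApproxCCE H P π ε := by
  intro j
  have hsub : Subsingleton (∀ i, DetPolicy S A i) := by
    have : ∀ i, Subsingleton (Fin (A i)) := fun i => by rw [hA i]; infer_instance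
    infer_instance
  have h1 : G.bestResponseValue H P π j ≤ G.value H P π j := by
    refine Real.sSup_le ?_ (G.value_mem H P π j).1
    rintro v ⟨Ω', _, P', _, π', -, rfl⟩
    have hne : Nonempty Ω := MeasureTheory.nonempty_of_isProbabilityMeasure P
    obtain ⟨ω₀⟩ := hne
    refine le_of_eq ?_
    have e : ∀ σ : ∀ i, DetPolicy S A i, σ = fun i => π i ω₀ := fun σ => Subsingleton.elim _ _
    unfold MarkovGame.value
    rw [MeasureTheory.integral_congr_ae (g := fun _ => G.valueToGo (fun i => π i ω₀) j H [] G.s₁)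
        (Filter.Eventually.of_forall fun ω => by dsimp only; rw [e (fun i => _)]),
      MeasureTheory.integral_congr_ae (μ := P)
        (g := fun _ => G.valueToGo (fun i => π i ω₀) j H [] G.s₁)
        (Filter.Eventually.of_forall fun ω => by dsimp only; rw [e (fun i => π i ω)])]
    simp
  linarith

theorem ofReal_one_sub_le_of_eq_univ {α : Type*} (p : PMF α) {s : Set α} (hs : ∀ a, a ∈ s) {δ : ℝ}
    (hδ : 0 ≤ δ) : ENNReal.ofReal (1 - δ) ≤ p.toOuterMeasure s := by
  rw [ofReal_one_sub_le_iff p s δ hδ, Set.compl_empty_iff.2 (Set.eq_univ_of_forall hs)]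
  simp

end Trivial

/-! ### Estimates of the sample size -/

section Estimates

theorem sum_one_div_sqrt_le (M : ℕ) : ∑ t ∈ Finset.Icc 1 M, 1 / √(t : ℝ) ≤ 2 * √(M : ℝ) := by
  induction M with
  | zero => simp
  | succ M ih =>
    rw [Finset.sum_Icc_succ_top (by omega)]
    have h1 : (0 : ℝ) < √((M + 1 : ℕ) : ℝ) := Real.sqrt_pos.2 (by positivity)
    have h2 : √((M + 1 : ℕ) : ℝ) ^ 2 = M + 1 := by rw [Real.sq_sqrt (by positivity)]; push_cast; rfl
    have h3 : √(M : ℝ) ^ 2 = M := Real.sq_sqrt (by positivity)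
    have h4 : 0 ≤ √(M : ℝ) := Real.sqrt_nonneg _
    have h5 : 1 / √((M + 1 : ℕ) : ℝ) ≤ 2 * √((M + 1 : ℕ) : ℝ) - 2 * √(M : ℝ) := by
      rw [div_le_iff₀ h1]
      nlinarith [sq_nonneg (√((M + 1 : ℕ) : ℝ) - √(M : ℝ))]
    linarith

theorem sum_sum_one_div_sqrt_le {S K : ℕ} (M : Fin S → ℕ) (hM : ∑ s, M s = K) :
    ∑ s, ∑ t ∈ Finset.Icc 1 (M s), 1 / √(t : ℝ) ≤ 2 * √(S * K : ℝ) := by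
  calc _ ≤ ∑ s, 2 * √(M s : ℝ) := Finset.sum_le_sum fun s _ => sum_one_div_sqrt_le (M s)
    _ = 2 * ∑ s, √(M s : ℝ) := by rw [Finset.mul_sum]
    _ ≤ _ := by
      -- Cauchy-Schwarz over the states: the worst case is an even spread of the visits.
      refine mul_le_mul_of_nonneg_left (Real.le_sqrt_of_sq_le ?_) zero_le_two
      have h := sq_sum_le_card_mul_sum_sq (s := Finset.univ) (f := fun s => √(M s : ℝ))
      simp only [Real.sq_sqrt (Nat.cast_nonneg _), Finset.card_univ, Fintype.card_fin] at h
      rw [← hM]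
      push_cast
      exact h

variable {S H K : ℕ} {ι : ℝ}

theorem div_mul_sqrt_mul_sqrt [NeZero K] (hι : 0 ≤ ι) (a : ℝ) (ha : 0 ≤ a) :
    (H : ℝ) / K * (√((H : ℝ) ^ 3 * a * ι) * √(S * K : ℝ)) = √((H : ℝ) ^ 5 * S * a * ι / K) := by
  have hK : (0 : ℝ) < K := by exact_mod_cast NeZero.pos K
  rw [← Real.sqrt_mul (by positivity), ← Real.sqrt_sq (show 0 ≤ (H : ℝ) / K by positivity),
    ← Real.sqrt_mul (sq_nonneg _)]
  congr 1
  field_simp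

/-- The cost of the first visits, about `H²S/K`, is of lower order when `S ≤ KHι`; in the opposite
regime `horizon_le_sqrt` makes the claim trivial. -/
theorem sq_mul_div_le_sqrt [NeZero K] (h : (S : ℝ) ≤ K * H * ι) :
    (H : ℝ) ^ 2 * S / K ≤ √((H : ℝ) ^ 5 * S * ι / K) := by
  have hK : (0 : ℝ) < K := by exact_mod_cast NeZero.pos K
  refine Real.le_sqrt_of_sq_le ?_
  have e1 : ((H : ℝ) ^ 2 * S / K) ^ 2 = (H : ℝ) ^ 4 * S / K ^ 2 * S := by ring
  have e2 : (H : ℝ) ^ 5 * S * ι / K = (H : ℝ) ^ 4 * S / K ^ 2 * (K * H * ι) := by field_simp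
  rw [e1, e2]
  exact mul_le_mul_of_nonneg_left h (by positivity)

theorem horizon_le_sqrt [NeZero K] (hH : 1 ≤ H) (hι : 1 / 2 ≤ ι) (h : K * H * ι ≤ (S : ℝ)) :
    (H : ℝ) ≤ 2 * √((H : ℝ) ^ 5 * S * ι / K) := by
  have hK : (0 : ℝ) < K := by exact_mod_cast NeZero.pos K
  have hH1 : (1 : ℝ) ≤ H := by exact_mod_cast hH
  have h1 : (H : ℝ) / 2 ≤ √((H : ℝ) ^ 5 * S * ι / K) := by
    refine Real.le_sqrt_of_sq_le ?_
    have e2 : (H : ℝ) ^ 5 * S * ι / K = (H : ℝ) ^ 5 * ι / K * S := by ring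
    rw [e2]
    calc ((H : ℝ) / 2) ^ 2 = (H : ℝ) ^ 2 * (1 / 2) ^ 2 := by ring
      _ ≤ (H : ℝ) ^ 6 * ι ^ 2 := by
          refine mul_le_mul (pow_le_pow_right₀ hH1 (by norm_num)) ?_ (by positivity) (by positivity)
          exact pow_le_pow_left₀ (by norm_num) hι 2
      _ = (H : ℝ) ^ 5 * ι / K * (K * H * ι) := by field_simp
      _ ≤ _ := mul_le_mul_of_nonneg_left h (by positivity)
  linarith

end Estimates

/-! ### The logarithmic factor. -/

section LogTerm

variable {m H S K : ℕ} {A : Fin m → ℕ} {δ : ℝ}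

theorem le_maxA (j : Fin m) : A j ≤ maxA A := Finset.le_sup (f := A) (Finset.mem_univ j)

theorem maxA_pos [NeZero m] [∀ j, NeZero (A j)] : 0 < maxA A :=
  (NeZero.pos (A 0)).trans_le (le_maxA 0)

theorem maxA_lt_size_div [NeZero m] [NeZero H] [NeZero S] [NeZero K] [∀ j, NeZero (A j)]
    (hδ : 0 < δ) (hδ1 : δ < 1) : (maxA A : ℝ) < (m * H * S * maxA A * K : ℝ) / δ := by
  have h0 : (0 : ℝ) < maxA A := by exact_mod_cast maxA_pos (A := A)
  rw [lt_div_iff₀ hδ]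
  have h1 : 1 ≤ m * H * S * K := Nat.pos_of_ne_zero (by simp [NeZero.ne])
  have h2 : (1 : ℝ) ≤ m * H * S * K := by exact_mod_cast h1
  nlinarith

theorem log_le_logTerm [NeZero m] [NeZero H] [NeZero S] [NeZero K] [∀ j, NeZero (A j)]
    (hδ : 0 < δ) (hδ1 : δ < 1) {n : ℕ} (hn : 1 ≤ n) (hnA : n ≤ maxA A) :
    Real.log n ≤ logTerm m H S K A δ := by
  have h1 : (n : ℝ) ≤ maxA A := by exact_mod_cast hnA
  exact Real.log_le_log (by exact_mod_cast hn) (h1.trans (maxA_lt_size_div hδ hδ1).le)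

theorem logTerm_pos [NeZero m] [NeZero H] [NeZero S] [NeZero K] [∀ j, NeZero (A j)]
    (hδ : 0 < δ) (hδ1 : δ < 1) : 0 < logTerm m H S K A δ := by
  have h1 : (1 : ℝ) ≤ maxA A := by exact_mod_cast maxA_pos (A := A)
  exact Real.log_pos (h1.trans_lt (maxA_lt_size_div hδ hδ1))

end LogTerm

/-! ### Consequences of the weighted regret assumption. -/

namespace WeightedExternalRegret

variable {H : ℕ} {alg : (B : ℕ) → [NeZero B] → BanditAlg B} {ξ : ℕ → ℕ → ℝ → ℝ}
  {Ξ : ℕ → ℝ → ℝ → ℝ}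

theorem regret_fails (h : WeightedExternalRegret H alg ξ Ξ) (B : ℕ) [NeZero B] (E : BanditEnv B)
    {t : ℕ} (ht : 1 ≤ t) {x : ℝ} (hx : 0 < x) :
    (banditLaw (alg B) E t).toOuterMeasure
      {r | ∃ θ ∈ stdSimplex ℝ (Fin B), ξ B t x < weightedRegret H t r θ} ≤
      ENNReal.ofReal (Real.exp (-x)) := by
  have h1 := h.regret_le B E t ht (Real.exp (-x)) (Real.exp_pos _) (by simpa using hx)
  rw [ofReal_one_sub_le_iff _ _ _ (Real.exp_pos _).le, one_div, ← Real.exp_neg, neg_neg,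
    Real.log_exp] at h1
  convert h1 using 2
  ext r
  simp

/-- With a single action there is no regret, so the bound on the regret is nonnegative. -/
theorem nonneg (h : WeightedExternalRegret H alg ξ Ξ) (B : ℕ) [NeZero B] {t : ℕ} (ht : 1 ≤ t)
    {x : ℝ} (hx : 0 < x) : 0 ≤ ξ B t x := by
  refine le_trans ?_ (h.mono 1 B (NeZero.pos B) t ht x hx)
  let E : BanditEnv 1 :=
    { X := Unit
      init := PMF.pure ()
      loss := fun _ _ => 0
      respond := fun _ _ => PMF.pure (0, ())
      loss_mem := fun _ _ => by simp
      feedback_mem := fun _ _ y hy => by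
        rw [PMF.mem_support_pure_iff] at hy; subst hy; simp
      feedback_mean := fun _ _ => by
        rw [tsum_eq_single ((0 : ℝ), ())]
        · simp
        · intro y hy; simp [PMF.pure_apply, hy] }
  by_contra hneg
  have h1 := h.regret_fails 1 E ht hx
  have h2 : (banditLaw (alg 1) E t).toOuterMeasure Set.univ ≤ (banditLaw (alg 1) E t).toOuterMeasure
      {r | ∃ θ ∈ stdSimplex ℝ (Fin 1), ξ 1 t x < weightedRegret H t r θ} := by
    refine PMF.toOuterMeasure_mono _ ?_
    rintro r ⟨-, hr⟩
    obtain ⟨-, -, h3⟩ := mem_support_banditLaw hr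
    refine ⟨fun _ => 1, ⟨fun _ => zero_le_one, by simp⟩, (not_le.1 hneg).trans_eq ?_⟩
    unfold weightedRegret
    symm
    refine Finset.sum_eq_zero fun i hi => ?_
    have h4 := (h3 i hi).2.2
    simp only [Fin.sum_univ_one] at h4 ⊢
    rw [h4]
    ring
  have h5 : (banditLaw (alg 1) E t).toOuterMeasure Set.univ = 1 := by
    rw [PMF.toOuterMeasure_apply_eq_one_iff]; exact Set.subset_univ _
  have h6 := h2.trans h1
  rw [h5, ENNReal.one_le_ofReal] at h6
  have : Real.exp (-x) < 1 := by simpa using hx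
  linarith

/-- Jensen's inequality for the concave `Ξ`, with the uniform law on the states; the mean visit
count is `K / S`. -/
theorem sum_le_mul_mean (h : WeightedExternalRegret H alg ξ Ξ) (B : ℕ) [NeZero B] {S K : ℕ}
    [NeZero S] (M : Fin S → ℕ) (hM : ∑ s, M s = K) {x : ℝ} (hx : 0 < x) :
    ∑ s, ∑ t ∈ Finset.Icc 1 (M s), ξ B t x ≤ S * Ξ B ((K : ℝ) / S) x := by
  have hS : (0 : ℝ) < S := by exact_mod_cast NeZero.pos S
  have h1 := (h.concave B x hx).le_map_sum (t := Finset.univ) (w := fun _ : Fin S => 1 / (S : ℝ))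
    (p := fun s => (M s : ℝ)) (fun _ _ => by positivity) (by simp [hS.ne'])
    (fun s _ => Set.mem_Ici.2 (Nat.cast_nonneg _))
  have e : ∑ s, (1 / (S : ℝ)) • (M s : ℝ) = (K : ℝ) / S := by
    rw [← Finset.smul_sum, ← hM, smul_eq_mul]; push_cast; ring
  rw [e, ← Finset.smul_sum, smul_eq_mul, one_div, inv_mul_le_iff₀ hS] at h1
  exact (Finset.sum_le_sum fun s _ => h.sum_le B (M s) x hx).trans h1

/-- `sum_le_mul_mean` with all visits placed on one state bounds it below by a sum of nonnegative
terms. -/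
theorem mean_nonneg (h : WeightedExternalRegret H alg ξ Ξ) (B : ℕ) [NeZero B] {S : ℕ} (s₁ : Fin S)
    (K : ℕ) {x : ℝ} (hx : 0 < x) : 0 ≤ Ξ B ((K : ℝ) / S) x := by
  have : NeZero S := ⟨by have := s₁.2; omega⟩
  have hS : (0 : ℝ) < S := by exact_mod_cast NeZero.pos S
  have h1 := h.sum_le_mul_mean B (K := K) (Pi.single s₁ K) (by simp) hx
  refine nonneg_of_mul_nonneg_right (le_trans ?_ h1) hS
  exact Finset.sum_nonneg fun s _ => Finset.sum_nonneg fun t ht =>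
    h.nonneg B (Finset.mem_Icc.1 ht).1 hx

end WeightedExternalRegret

/-! ### V-learning finds approximate coarse correlated equilibria -/

section Main

variable {m S H K : ℕ} [NeZero m] [NeZero H] [NeZero K] {A : Fin m → ℕ} [∀ j, NeZero (A j)]
  {G : MarkovGame m S A} {δ ι : ℝ}

theorem goodRecords_of_horizon_le {alg : ∀ j, BanditAlg (A j)} {β : Fin m → ℕ → ℝ} (hδ : 0 < δ)
    {ε : ℝ} (hε : H ≤ ε) :
    ENNReal.ofReal (1 - δ) ≤ (trainLaw G H alg β K).toOuterMeasure (goodRecords G H K alg ε) :=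
  ofReal_one_sub_le_of_eq_univ _ (fun _ => G.isApproxCCE_of_horizon_le H _ _ hε) hδ.le

theorem goodRecords_of_maxA_lt {alg : ∀ j, BanditAlg (A j)} {β : Fin m → ℕ → ℝ} (hδ : 0 < δ)
    (hA : maxA A < 2) {ε : ℝ} (hε : 0 ≤ ε) :
    ENNReal.ofReal (1 - δ) ≤ (trainLaw G H alg β K).toOuterMeasure (goodRecords G H K alg ε) := by
  refine ofReal_one_sub_le_of_eq_univ _ (fun _ => G.isApproxCCE_of_subsingleton H _ _
    (fun j => ?_) hε) hδ.le
  have h1 := le_maxA (A := A) j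
  have h2 := NeZero.pos (A j)
  omega

/-- Of the constant, `3` pays for the first visits and `12 c = 3 · 2c · 2` for the square-root
bonuses; the regret part needs only `6 c`. -/
theorem goodRecords_of_weightedExternalRegret {alg : (B : ℕ) → [NeZero B] → BanditAlg B}
    {ξ : ℕ → ℕ → ℝ → ℝ} {Ξ : ℕ → ℝ → ℝ → ℝ} (h : WeightedExternalRegret H alg ξ Ξ)
    (hδ : 0 < δ) (hδ1 : δ < 1) (hι : ι = logTerm m H S K A δ) {c : ℝ} (hc : 0 ≤ c)
    {β : Fin m → ℕ → ℝ}
    (hβ : ∀ j, ∀ t ∈ Finset.Icc 1 K,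
      3 * (H * ξ (A j) t ι + √((H : ℝ) ^ 3 * ι / t)) ≤
          ∑ i ∈ Finset.Icc 1 t, alphaW H t i * β j i ∧
        ∑ i ∈ Finset.Icc 1 t, alphaW H t i * β j i ≤
          c * (H * ξ (A j) t ι + √((H : ℝ) ^ 3 * ι / t))) :
    ENNReal.ofReal (1 - δ) ≤
      (trainLaw G H (fun j => alg (A j)) β K).toOuterMeasure
        (goodRecords G H K (fun j => alg (A j))
          ((12 * c + 3) * ((H : ℝ) ^ 2 * S / K * Ξ (maxA A) ((K : ℝ) / S) ι
            + √((H : ℝ) ^ 5 * S * ι / K)))) := by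
  have : NeZero S := ⟨by have := G.s₁.2; omega⟩
  have : NeZero (maxA A) := ⟨maxA_pos.ne'⟩
  have hH : 1 ≤ H := NeZero.pos H
  have hK : (0 : ℝ) < K := by exact_mod_cast NeZero.pos K
  have hι0 : 0 < ι := hι ▸ logTerm_pos hδ hδ1
  have hΞ := h.mean_nonneg (maxA A) G.s₁ K hι0
  set y := √((H : ℝ) ^ 5 * S * ι / K) with hy
  have hy0 : 0 ≤ y := Real.sqrt_nonneg _
  set X := (H : ℝ) ^ 2 * S / K * Ξ (maxA A) ((K : ℝ) / S) ι with hX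
  have hX0 : 0 ≤ X := mul_nonneg (by positivity) hΞ
  have hε : 0 ≤ (12 * c + 3) * (X + y) := by positivity
  rcases lt_or_ge (maxA A) 2 with hA | hA
  · exact goodRecords_of_maxA_lt hδ hA hε
  have hι2 : 1 / 2 ≤ ι := by
    have h1 := log_le_logTerm (m := m) (H := H) (S := S) (K := K) hδ hδ1 one_le_two hA
    rw [← hι] at h1
    have := Real.log_two_gt_d9
    push_cast at h1
    linarith
  rcases lt_or_ge (K * H * ι : ℝ) S with hS | hS
  · refine goodRecords_of_horizon_le hδ ((horizon_le_sqrt hH hι2 hS.le).trans ?_)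
    nlinarith [mul_nonneg hc hX0, mul_nonneg hc hy0]
  refine goodRecords_of_regret hA hδ hδ1 hι (fun j t => ξ (A j) t ι)
    (fun j t ht _ => h.nonneg (A j) ht hι0)
    (fun j t ht _ E => h.regret_fails (A j) E ht hι0) (fun j t ht htK => ?_) _ hε
    (fun j M hM => ?_)
  · refine le_trans ?_ (hβ j t (Finset.mem_Icc.2 ⟨ht, htK⟩)).1
    have h1 := mul_nonneg (Nat.cast_nonneg (α := ℝ) H) (h.nonneg (A j) ht hι0)
    linarith
  · have hsum : ∑ s, ∑ t ∈ Finset.Icc 1 (M s), 2 * ∑ i ∈ Finset.Icc 1 t, alphaW H t i * β j i ≤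
        2 * c * (H * (S * Ξ (maxA A) ((K : ℝ) / S) ι) +
          √((H : ℝ) ^ 3 * 1 * ι) * (2 * √(S * K : ℝ))) := by
      calc _ ≤ ∑ s, ∑ t ∈ Finset.Icc 1 (M s), (2 * c * H * ξ (maxA A) t ι +
            2 * c * √((H : ℝ) ^ 3 * 1 * ι) * (1 / √(t : ℝ))) := by
            refine Finset.sum_le_sum fun s _ => Finset.sum_le_sum fun t ht => ?_
            have ht' := Finset.mem_Icc.1 ht
            have hMs : M s ≤ K := hM ▸ Finset.single_le_sum (f := M) (fun _ _ => Nat.zero_le _)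
              (Finset.mem_univ s)
            have h1 := (hβ j t (Finset.mem_Icc.2 ⟨ht'.1, ht'.2.trans hMs⟩)).2
            have h2 := h.mono (A j) (maxA A) (le_maxA j) t ht'.1 ι hι0
            rw [Real.sqrt_div' _ (Nat.cast_nonneg t)] at h1
            have h3 : c * (H * ξ (A j) t ι) ≤ c * (H * ξ (maxA A) t ι) := by gcongr
            rw [mul_one]
            have h4 : c * (√((H : ℝ) ^ 3 * ι) / √(t : ℝ)) =
              c * √((H : ℝ) ^ 3 * ι) * (1 / √(t : ℝ)) := by ring
            linarith
        _ = 2 * c * H * (∑ s, ∑ t ∈ Finset.Icc 1 (M s), ξ (maxA A) t ι) +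
            2 * c * √((H : ℝ) ^ 3 * 1 * ι) * ∑ s, ∑ t ∈ Finset.Icc 1 (M s), 1 / √(t : ℝ) := by
            simp only [Finset.sum_add_distrib, Finset.mul_sum]
        _ ≤ 2 * c * H * (S * Ξ (maxA A) ((K : ℝ) / S) ι) +
            2 * c * √((H : ℝ) ^ 3 * 1 * ι) * (2 * √(S * K : ℝ)) := by
            have h1 := h.sum_le_mul_mean (maxA A) M hM hι0
            have h2 := sum_sum_one_div_sqrt_le M hM
            gcongr
        _ = _ := by ring
    calc _ ≤ 3 * H / K * (S * H + 2 * c * (H * (S * Ξ (maxA A) ((K : ℝ) / S) ι) +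
          √((H : ℝ) ^ 3 * 1 * ι) * (2 * √(S * K : ℝ)))) := by gcongr
      _ = 3 * ((H : ℝ) ^ 2 * S / K) + 6 * c * X +
          12 * c * ((H : ℝ) / K * (√((H : ℝ) ^ 3 * 1 * ι) * √(S * K : ℝ))) := by
          rw [hX]; ring
      _ ≤ 3 * y + 6 * c * X + 12 * c * y := by
          have h1 := sq_mul_div_le_sqrt hS
          rw [div_mul_sqrt_mul_sqrt hι0.le 1 zero_le_one, mul_one]
          linarith
      _ ≤ _ := by nlinarith [mul_nonneg hc hX0]

/-- The bonus constant is `28 = 25 + 3`, for regret and concentration. The gap analysis yields the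
error constant `3 · 2 · 28 · 2 · 2 + 3 = 675`, rounded up. -/
theorem goodRecords_ftrlTuned (hδ : 0 < δ) (hδ1 : δ < 1) (hι : ι = logTerm m H S K A δ)
    {β : Fin m → ℕ → ℝ} (hβ : ∀ j t, β j t = 28 * √((H : ℝ) ^ 3 * A j * ι / t)) :
    ENNReal.ofReal (1 - δ) ≤
      (trainLaw G H (fun j => ftrlTuned H ι (A j)) β K).toOuterMeasure
        (goodRecords G H K (fun j => ftrlTuned H ι (A j))
          (1000 * √((H : ℝ) ^ 5 * S * maxA A * ι / K))) := by
  have : NeZero S := ⟨by have := G.s₁.2; omega⟩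
  have hH : 1 ≤ H := NeZero.pos H
  have hK : (0 : ℝ) < K := by exact_mod_cast NeZero.pos K
  have hHr : (0 : ℝ) < H := by exact_mod_cast hH
  have hι0 : 0 < ι := hι ▸ logTerm_pos hδ hδ1
  set y := √((H : ℝ) ^ 5 * S * maxA A * ι / K) with hy
  have hy0 : 0 ≤ y := Real.sqrt_nonneg _
  rcases lt_or_ge (maxA A) 2 with hA | hA
  · exact goodRecords_of_maxA_lt hδ hA (by positivity)
  have hlog2 : Real.log 2 ≤ ι := by
    have h1 := log_le_logTerm (m := m) (H := H) (S := S) (K := K) hδ hδ1 one_le_two hA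
    rw [← hι] at h1
    exact_mod_cast h1
  have hι2 : 1 / 2 ≤ ι := by
    have := Real.log_two_gt_d9
    linarith
  have hyy : √((H : ℝ) ^ 5 * S * ι / K) ≤ y := by
    refine Real.sqrt_le_sqrt ?_
    have h1 : (1 : ℝ) ≤ maxA A := by exact_mod_cast (one_le_two.trans hA)
    refine div_le_div_of_nonneg_right (mul_le_mul_of_nonneg_right ?_ hι0.le) hK.le
    exact le_mul_of_one_le_right (by positivity) h1
  rcases lt_or_ge (K * H * ι : ℝ) S with hS | hS
  · refine goodRecords_of_horizon_le hδ ((horizon_le_sqrt hH hι2 hS.le).trans ?_)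
    linarith
  have hbonus : ∀ j t, ∑ i ∈ Finset.Icc 1 t, alphaW H t i * β j i =
      28 * √((H : ℝ) ^ 3 * A j * ι) * ∑ i ∈ Finset.Icc 1 t, alphaW H t i * (1 / √(i : ℝ)) := by
    intro j t
    rw [Finset.mul_sum]
    refine Finset.sum_congr rfl fun i _ => ?_
    rw [hβ, Real.sqrt_div' _ (Nat.cast_nonneg i)]
    ring
  refine goodRecords_of_regret hA hδ hδ1 hι (fun j t => 25 * √(H * A j * ι / t))
    (fun j t _ _ => by positivity)
    (fun j t ht _ E => ftrlTuned_regret hH hlog2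
      (hι ▸ log_le_logTerm hδ hδ1 (NeZero.pos (A j)) (le_maxA j)) ht E) (fun j t ht htK => ?_) _
    (by positivity) (fun j M hM => ?_)
  · have hAj : (1 : ℝ) ≤ A j := by exact_mod_cast NeZero.pos (A j)
    have ht0 : (0 : ℝ) < t := by exact_mod_cast ht
    rw [hbonus]
    have h1 : (H : ℝ) * (25 * √(H * A j * ι / t)) = 25 * √((H : ℝ) ^ 3 * A j * ι / t) := by
      rw [mul_left_comm]
      congr 1
      nth_rewrite 1 [← Real.sqrt_sq hHr.le]
      rw [← Real.sqrt_mul (sq_nonneg _)]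
      congr 1
      ring
    have h2 : √((H : ℝ) ^ 3 * ι / t) ≤ √((H : ℝ) ^ 3 * A j * ι / t) := by
      refine Real.sqrt_le_sqrt ?_
      gcongr
      exact le_mul_of_one_le_right (by positivity) hAj
    have h3 : √((H : ℝ) ^ 3 * A j * ι / t) = √((H : ℝ) ^ 3 * A j * ι) * (1 / √(t : ℝ)) := by
      rw [Real.sqrt_div' _ ht0.le]; ring
    have h4 := mul_le_mul_of_nonneg_left (le_sum_alphaW_div_sqrt H t ht)
      (show 0 ≤ 28 * √((H : ℝ) ^ 3 * A j * ι) by positivity)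
    refine le_trans ?_ h4
    rw [h1, mul_assoc 28, ← h3]
    linarith
  · have hAj : (A j : ℝ) ≤ maxA A := by exact_mod_cast le_maxA j
    have hsum : ∑ s, ∑ t ∈ Finset.Icc 1 (M s), 2 * ∑ i ∈ Finset.Icc 1 t, alphaW H t i * β j i ≤
        112 * √((H : ℝ) ^ 3 * maxA A * ι) * (2 * √(S * K : ℝ)) := by
      calc _ ≤ ∑ s, ∑ t ∈ Finset.Icc 1 (M s),
            112 * √((H : ℝ) ^ 3 * maxA A * ι) * (1 / √(t : ℝ)) := by
            refine Finset.sum_le_sum fun s _ => Finset.sum_le_sum fun t ht => ?_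
            have ht1 := (Finset.mem_Icc.1 ht).1
            rw [hbonus]
            have h1 := sum_alphaW_div_sqrt_le H t ht1
            have h0 : 0 ≤ ∑ i ∈ Finset.Icc 1 t, alphaW H t i * (1 / √(i : ℝ)) :=
              Finset.sum_nonneg fun i _ => mul_nonneg (alphaW_nonneg H t i) (by positivity)
            have h2 : √((H : ℝ) ^ 3 * A j * ι) ≤ √((H : ℝ) ^ 3 * maxA A * ι) := by
              gcongr
            calc _ ≤ 2 * (28 * √((H : ℝ) ^ 3 * maxA A * ι) * (2 / √(t : ℝ))) := by gcongr
              _ = _ := by ring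
        _ = 112 * √((H : ℝ) ^ 3 * maxA A * ι) * ∑ s, ∑ t ∈ Finset.Icc 1 (M s), 1 / √(t : ℝ) := by
            simp only [Finset.mul_sum]
        _ ≤ _ := by
            have h2 := sum_sum_one_div_sqrt_le M hM
            gcongr
    calc _ ≤ 3 * H / K * (S * H + 112 * √((H : ℝ) ^ 3 * maxA A * ι) * (2 * √(S * K : ℝ))) := by
          gcongr
      _ = 3 * ((H : ℝ) ^ 2 * S / K) +
          672 * ((H : ℝ) / K * (√((H : ℝ) ^ 3 * maxA A * ι) * √(S * K : ℝ))) := by ring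
      _ ≤ 3 * y + 672 * y := by
          have h1 := (sq_mul_div_le_sqrt hS).trans hyy
          rw [div_mul_sqrt_mul_sqrt hι0.le _ (Nat.cast_nonneg _)]
          linarith
      _ ≤ _ := by linarith

end Main

end VLearning

end

theorem theorem3 :
    (∃ c₀ : ℝ, 0 < c₀ ∧ ∀ c₁ : ℝ, ∃ C : ℝ, 0 < C ∧
      ∀ (m S H K : ℕ) [NeZero m] [NeZero H] [NeZero K]
        (A : Fin m → ℕ) [∀ j, NeZero (A j)] (G : MarkovGame m S A)
        (alg : (B : ℕ) → [NeZero B] → BanditAlg B)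
        (ξ : ℕ → ℕ → ℝ → ℝ) (Ξ : ℕ → ℝ → ℝ → ℝ),
        WeightedExternalRegret H alg ξ Ξ →
        ∀ δ : ℝ, 0 < δ → δ < 1 →
        ∀ ι : ℝ, ι = logTerm m H S K A δ →
        ∀ β : Fin m → ℕ → ℝ,
          (∀ j, ∀ t ∈ Finset.Icc 1 K,
            c₀ * (H * ξ (A j) t ι + √((H : ℝ) ^ 3 * ι / t)) ≤
                ∑ i ∈ Finset.Icc 1 t, alphaW H t i * β j i ∧
              ∑ i ∈ Finset.Icc 1 t, alphaW H t i * β j i ≤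
                c₁ * (H * ξ (A j) t ι + √((H : ℝ) ^ 3 * ι / t))) →
          ENNReal.ofReal (1 - δ) ≤
            (trainLaw G H (fun j => alg (A j)) β K).toOuterMeasure
              (goodRecords G H K (fun j => alg (A j))
                (C * ((H : ℝ) ^ 2 * S / K * Ξ (maxA A) ((K : ℝ) / S) ι
                  + √((H : ℝ) ^ 5 * S * ι / K))))) ∧
    (∃ c : ℝ, 0 < c ∧ ∃ C : ℝ, 0 < C ∧
      ∀ (m S H K : ℕ) [NeZero m] [NeZero H] [NeZero K]
        (A : Fin m → ℕ) [∀ j, NeZero (A j)] (G : MarkovGame m S A),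
        ∀ δ : ℝ, 0 < δ → δ < 1 →
        ∀ ι : ℝ, ι = logTerm m H S K A δ →
        ∀ β : Fin m → ℕ → ℝ,
          (∀ j t, β j t = c * √((H : ℝ) ^ 3 * A j * ι / t)) →
          ENNReal.ofReal (1 - δ) ≤
            (trainLaw G H (fun j => ftrlTuned H ι (A j)) β K).toOuterMeasure
              (goodRecords G H K (fun j => ftrlTuned H ι (A j))
                (C * √((H : ℝ) ^ 5 * S * maxA A * ι / K)))) := by
  -- The lower constant `3` is that of the concentration width. As `ξ` is nonnegative, `c₁` may be
  -- replaced by `|c₁|`, which keeps `C` positive for every real `c₁`.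
  refine ⟨⟨3, by norm_num, fun c₁ => ⟨12 * |c₁| + 3, by positivity, ?_⟩⟩,
    28, by norm_num, 1000, by norm_num, ?_⟩
  · intro m S H K _ _ _ A _ G alg ξ Ξ hreg δ hδ hδ1 ι hι β hβ
    have : NeZero S := ⟨by have := G.s₁.2; omega⟩
    have hι0 : 0 < ι := hι ▸ logTerm_pos hδ hδ1
    refine goodRecords_of_weightedExternalRegret hreg hδ hδ1 hι (abs_nonneg c₁)
      fun j t ht => ⟨(hβ j t ht).1, (hβ j t ht).2.trans ?_⟩
    have h1 := mul_nonneg (Nat.cast_nonneg (α := ℝ) H)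
      (hreg.nonneg (A j) (Finset.mem_Icc.1 ht).1 hι0)
    exact mul_le_mul_of_nonneg_right (le_abs_self c₁) (add_nonneg h1 (Real.sqrt_nonneg _))
  · intro m S H K _ _ _ A _ G δ hδ hδ1 ι hι β hβ
    exact goodRecords_ftrlTuned hδ hδ1 hι hβ
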